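/- **Setting.** Let $d\ge 1$. For $k\ge 1$ let $\mathcal S_s(\mathbb R^{dk})$ be the space of complex Schwartz functions $f(x_1,\dots,x_k)$, $x_i\in\mathbb R^d$, that are invariant under all permutations of $x_1,\dots,x_k$, with the subspace topology, and let $\mathrm{Sym}_k f(x_1,\dots,x_k)=\frac1{k!}\sum_{\pi\in\mathbb S_k}f(x_{\pi(1)},\dots,x_{\pi(k)})$ for $f\in\mathcal S(\mathbb R^{dk})$. Let $\mathfrak g_k$ be the real vector space of continuous $\mathbb C$-linear maps $A:\mathcal S_s(\mathbb R^{dk})\to\mathcal S_s(\mathbb R^{dk})$ with $\int \overline{f}\,Ag=-\int\overline{Af}\,g$ for all $f,g\in \mathcal S_s(\mathbb R^{dk})$. It carries the topology induced by the space $\mathcal L(\mathcal S_s(\mathbb R^{dk}),\mathcal S_s'(\mathbb R^{dk}))$ of continuous linear maps into the strong dual, with uniform convergence on bounded sets, where $\mathcal S_s\subset\mathcal S_s'$ through the pairing $\int fg$. Let $$\mathfrak F_\infty=\bigoplus_{k=1}^\infty\mathfrak g_k$$ be the locally convex direct sum, and for $N\ge 1$ let $\mathfrak G_N=\{A=(A^{(k)})_{k\ge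 1}\in\mathfrak F_\infty: A^{(k)}=0 \text{ for } k>N\}$. For $k\le N$ let $P_k^N$ be the set of $k$-tuples of distinct elements of $\{1,\dots,N\}$ and $C_{k,N}=1/|P_k^N|$. An operator $A$ on $\mathcal S_s(\mathbb R^{dk})$ is extended to $\mathcal S(\mathbb R^{dk})$ as $A\circ\mathrm{Sym}_k$, and for $(p_1,\dots,p_k)\in P_k^N$ the operator $A_{(p_1,\dots,p_k)}$ on $\mathcal S(\mathbb R^{dN})$ is this extension acting in the variables $x_{p_1},\dots,x_{p_k}$, and the identity in the others. Put $$\epsilon_{k,N}(A)=C_{k,N}\sum_{(p_1,\dots,p_k)\in P_k^N}A_{(p_1,\dots,p_k)}\Big|_{\mathcal S_s(\mathbb R^{dN})}.$$ On $\mathfrak g_N$ let $[S,T]_{\mathfrak g_N}=N(ST-TS)$. The bracket of $A,B\in\mathfrak G_N$ is the element of $\mathfrak G_N$ with components $$[A,B]_{\mathfrak G_N}^{(k)}=\sum_{\substack{1\le \ell,j\le N\\ \min\{\ell+j-1,N\}=k}}\epsilon_{k,N}^{-1}\Big(\big[\epsilon_{\ell,N}(A^{(\ell)}),\epsilon_{j,N}(B^{(j)})\big]_{\mathfrak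 g_N}\Big),\qquad 1\le k\le N.$$ For $A\in\mathfrak g_\ell$, $B\in\mathfrak g_j$, $k=\ell+j-1$ and $1\le r\le\min\{\ell,j\}$, define operators on $\mathcal S(\mathbb R^{dk})$ by $$A\circ_r B=A_{(1,\dots,\ell)}\sum_{\alpha\in P_r^\ell}B_{(\alpha_1,\dots,\alpha_r,\ell+1,\dots,\ell+j-r)},\qquad [A,B]_r=\binom jr A\circ_rB-\binom \ell r B\circ_rA .$$ For an operator $T$ on $\mathcal S(\mathbb R^{dk})$ let $\mathrm{Sym}_k(T)=\frac1{k!}\sum_{\pi\in\mathbb S_k}\pi T\pi^{-1}$, regarded as an operator on $\mathcal S_s(\mathbb R^{dk})$, where $(\pi f)(x_1,\dots,x_k)=f(x_{\pi(1)},\dots,x_{\pi(k)})$. Let $$C_{\ell jkrN}=\frac{N\,C_{\ell,N}\,C_{j,N}}{C_{k,N}\prod_{m=1}^{r-1}(N-k+m)}\qquad(N\ge k).$$ **Proposition.** Let $N_0\ge 1$ and $A=(A^{(k)})_{k\ge1},\,B=(B^{(k)})_{k\ge1}\in\mathfrak G_{N_0}$. 1. For all $N\ge N_0$ the bracket $[A,B]_{\mathfrak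 G_N}$ is well defined: for all $1\le\ell,j\le N$ and $k=\min\{\ell+j-1,N\}$ there is exactly one $D\in\mathfrak g_k$ with $\epsilon_{k,N}(D)=[\epsilon_{\ell,N}(A^{(\ell)}),\epsilon_{j,N}(B^{(j)})]_{\mathfrak g_N}$. 2. In the topology of $\mathfrak F_\infty$, $$\lim_{N\to\infty}[A,B]_{\mathfrak G_N}=C=(C^{(k)})_{k\ge1},\qquad C^{(k)}=\sum_{\substack{\ell,j\ge1\\ \ell+j-1=k}}\mathrm{Sym}_k\big([A^{(\ell)},B^{(j)}]_1\big);$$ in particular $C\in\mathfrak F_\infty$. 3. All higher contraction terms vanish in the limit: for all $k\ge 1$ and all $N\ge\max\{N_0,2N_0-1\}$ $$[A,B]_{\mathfrak G_N}^{(k)}=\sum_{\substack{\ell,j\ge1\\ \ell+j-1=k}}\ \sum_{r=1}^{\min\{\ell,j\}}C_{\ell jkrN}\,\mathrm{Sym}_k\big([A^{(\ell)},B^{(j)}]_r\big)$$ (for $k>N$ both sides are $0$, as each $\mathrm{Sym}_k([A^{(\ell)},B^{(j)}]_r)$ is then $0$), and for all $\ell,j\ge1$ with $\ell+j-1=k$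 and all $2\le r\le\min\{\ell,j\}$, $$C_{\ell jkrN}\,\mathrm{Sym}_k\big([A^{(\ell)},B^{(j)}]_r\big)\longrightarrow 0\quad\text{as }N\to\infty$$ in the space of continuous linear operators on $\mathcal S_s(\mathbb R^{dk})$ with the topology induced by $\mathcal L(\mathcal S_s(\mathbb R^{dk}),\mathcal S_s'(\mathbb R^{dk}))$. -/

import Mathlib

open SchwartzMap Filter Topology Asymptotics
open scoped LineDeriv ContDiff

namespace BosonHierarchy

/- ### Operators acting on the slices of a Schwartz function -/

theorem exists_taylor_bound {W : Type} [NormedAddCommGroup W] [NormedSpace ℝ W] (n : ℕ) :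
    ∀ {F : Type} [NormedAddCommGroup F] [NormedSpace ℝ F] (g : 𝓢(W, F)) (k : ℕ),
      ∃ C : ℝ, ∀ h : W, ‖h‖ ≤ 1 → ∀ x : W,
        ‖x‖ ^ k * ‖iteratedFDeriv ℝ n (fun y => g (y + h) - g y - fderiv ℝ g y h) x‖
          ≤ C * ‖h‖ ^ 2 := by
  induction n with
  | zero =>
    intro F _ _ g k
    set G : 𝓢(W, W →L[ℝ] F) := fderivCLM ℝ W F g with hG
    set H := fderivCLM ℝ W (W →L[ℝ] F) G with hH
    set M : ℝ := SchwartzMap.seminorm ℝ 0 0 H + SchwartzMap.seminorm ℝ k 0 H with hM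
    refine ⟨2 ^ k * M, fun h hh x => ?_⟩
    have hGd : ∀ z, HasFDerivAt G (H z) z := fun z => by
      simpa [hH] using G.hasFDerivAt z
    have hgd : ∀ z, HasFDerivAt g (G z) z := fun z => by
      simpa [hG] using g.hasFDerivAt z
    have key : ∀ z ∈ segment ℝ x (x + h), ‖x‖ ^ k * ‖H z‖ ≤ 2 ^ k * M := by
      intro z hz
      have hxz : ‖x‖ ≤ 1 + ‖z‖ := by
        have : dist x z ≤ 1 := by
          have h1 : z ∈ Metric.closedBall x 1 := by
            refine (convex_closedBall x 1).segment_subset ?_ ?_ hz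
            · simp
            · simpa using hh
          rw [dist_comm]; simpa using h1
        have := norm_sub_norm_le x z
        rw [← dist_eq_norm] at this
        linarith
      have h0 := H.norm_le_seminorm ℝ z
      have h1 := H.norm_pow_mul_le_seminorm ℝ k z
      have h2 : ‖x‖ ^ k ≤ 2 ^ k * (1 + ‖z‖ ^ k) := by
        calc ‖x‖ ^ k ≤ (1 + ‖z‖) ^ k := by gcongr
          _ ≤ (2 * max 1 ‖z‖) ^ k := by
            gcongr
            have := le_max_left 1 ‖z‖
            have := le_max_right 1 ‖z‖
            linarith
          _ = 2 ^ k * (max 1 ‖z‖) ^ k := by rw [mul_pow]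
          _ ≤ 2 ^ k * (1 + ‖z‖ ^ k) := by
            gcongr
            rcases max_cases 1 ‖z‖ with ⟨h, _⟩ | ⟨h, _⟩ <;> rw [h]
            · simp
            · simp
      calc ‖x‖ ^ k * ‖H z‖ ≤ 2 ^ k * (1 + ‖z‖ ^ k) * ‖H z‖ := by gcongr
        _ = 2 ^ k * (‖H z‖ + ‖z‖ ^ k * ‖H z‖) := by ring
        _ ≤ 2 ^ k * M := by
          rw [hM]
          gcongr
    have hconv := convex_segment (𝕜 := ℝ) x (x + h)
    rcases eq_or_lt_of_le (show 0 ≤ ‖x‖ ^ k by positivity) with h0 | hpos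
    · rw [← h0]
      have : 0 ≤ M := by positivity
      simp only [zero_mul]
      positivity
    have hb : ∀ z ∈ segment ℝ x (x + h), ‖H z‖ ≤ 2 ^ k * M / ‖x‖ ^ k := by
      intro z hz
      rw [le_div_iff₀ hpos, mul_comm]
      exact key z hz
    have hseg : ∀ z ∈ segment ℝ x (x + h), ‖G z - G x‖ ≤ 2 ^ k * M / ‖x‖ ^ k * ‖h‖ := by
      intro z hz
      have := hconv.norm_image_sub_le_of_norm_hasFDerivWithin_le
        (fun w hw => (hGd w).hasFDerivWithinAt) hb (left_mem_segment ℝ _ _) hz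
      refine this.trans (mul_le_mul_of_nonneg_left ?_ ((norm_nonneg _).trans (hb z hz)))
      · have h1 : z ∈ Metric.closedBall x ‖h‖ := by
          refine (convex_closedBall x ‖h‖).segment_subset ?_ ?_ hz
          · simp
          · simp
        simpa [dist_eq_norm] using h1
    have := hconv.norm_image_sub_le_of_norm_hasFDerivWithin_le'
        (fun w hw => (hgd w).hasFDerivWithinAt) hseg (left_mem_segment ℝ _ _)
        (right_mem_segment ℝ _ _)
    simp only [add_sub_cancel_left] at this
    rw [norm_iteratedFDeriv_zero, ← (hgd x).fderiv.symm]
    calc _ ≤ ‖x‖ ^ k * (2 ^ k * M / ‖x‖ ^ k * ‖h‖ * ‖h‖) := by gcongr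
      _ = 2 ^ k * M * ‖h‖ ^ 2 := by field_simp
  | succ n ih =>
    intro F _ _ g k
    obtain ⟨C, hC⟩ := ih (fderivCLM ℝ W F g) k
    refine ⟨C, fun h hh x => ?_⟩
    convert hC h hh x using 2
    rw [← norm_iteratedFDeriv_fderiv]
    congr 2
    funext y
    have hG : ∀ z, HasFDerivAt (fderivCLM ℝ W F g) (fderiv ℝ (fderivCLM ℝ W F g) z) z :=
      fun z => (fderivCLM ℝ W F g).hasFDerivAt z
    have hGf : (fderivCLM ℝ W F g : W → W →L[ℝ] F) = fderiv ℝ g := by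
      funext z; simp
    have e1 : HasFDerivAt (fun y => g (y + h)) (fderiv ℝ g (y + h)) y := by
      rw [hasFDerivAt_comp_add_right]; exact g.hasFDerivAt _
    have e3 : HasFDerivAt (fun y => fderiv ℝ g y h)
        ((ContinuousLinearMap.apply ℝ F h).comp (fderiv ℝ (fderiv ℝ g) y)) y := by
      have := hG y
      rw [hGf] at this
      exact ((ContinuousLinearMap.apply ℝ F h).hasFDerivAt).comp y this
    have e4 : fderiv ℝ (fun y => g (y + h) - g y - fderiv ℝ g y h) y = _ :=
      ((e1.sub (g.hasFDerivAt y)).sub e3).fderiv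
    rw [e4, hGf]
    ext w
    have hs : IsSymmSndFDerivAt ℝ g y :=
      ((g.smooth 2).contDiffAt).isSymmSndFDerivAt (by simp)
    simp [hs.eq w h]

theorem seminorm_finsetSum_apply {ι E : Type} [AddCommGroup E] [Module ℂ E]
    (p : ι → Seminorm ℂ E) (s : Finset ι) (x : E) : (∑ i ∈ s, p i) x = ∑ i ∈ s, p i x := by
  classical
  induction s using Finset.induction_on with
  | empty => simp
  | insert a s ha ih => simp [Finset.sum_insert ha, ih]

section Slice

variable {V W : Type} [NormedAddCommGroup V] [NormedSpace ℝ V]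
  [NormedAddCommGroup W] [NormedSpace ℝ W]

/-- Restriction of a Schwartz function to an affine subspace: `f ↦ (y ↦ f (Q y + a))`. -/
noncomputable def restrictAffine (Q : V →L[ℝ] W) (hQ : AntilipschitzWith 1 Q) (a : W) :
    𝓢(W, ℂ) →L[ℂ] 𝓢(V, ℂ) :=
  (compCLMOfAntilipschitz ℂ Q.hasTemperateGrowth hQ) ∘L (compSubConstCLM ℂ (-a))

theorem restrictAffine_apply (Q : V →L[ℝ] W) (hQ : AntilipschitzWith 1 Q) (a : W)
    (f : 𝓢(W, ℂ)) (y : V) : restrictAffine Q hQ a f y = f (Q y + a) := by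
  simp [restrictAffine]

theorem seminorm_restrictAffine_le (Q : V →L[ℝ] W) (hQ : AntilipschitzWith 1 Q) (a : W)
    (ha : ∀ y, ‖a‖ ≤ ‖Q y + a‖) (hy : ∀ y, ‖y‖ ≤ ‖Q y + a‖) (f : 𝓢(W, ℂ)) (m k n : ℕ) :
    ‖a‖ ^ m * SchwartzMap.seminorm ℂ k n (restrictAffine Q hQ a f) ≤
      ‖Q‖ ^ n * SchwartzMap.seminorm ℂ (m + k) n f := by
  rcases eq_or_lt_of_le (show 0 ≤ ‖a‖ ^ m by positivity) with h0 | hpos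
  · rw [← h0, zero_mul]; positivity
  rw [mul_comm, ← le_div_iff₀ hpos]
  refine seminorm_le_bound ℂ k n _ (by positivity) fun y => ?_
  rw [le_div_iff₀ hpos]
  have e : (restrictAffine Q hQ a f : V → ℂ) = (fun w => f (w + a)) ∘ Q := by
    funext y; simp [restrictAffine_apply]
  have hsm : ContDiff ℝ n (fun w => f (w + a)) := (f.smooth n).comp (contDiff_id.add contDiff_const)
  rw [e, Q.iteratedFDeriv_comp_right hsm y (i := n) le_rfl, iteratedFDeriv_comp_add_right]
  calc _ ≤ ‖y‖ ^ k * (‖iteratedFDeriv ℝ n f (Q y + a)‖ * ∏ _i : Fin n, ‖Q‖) * ‖a‖ ^ m := by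
        gcongr
        exact ContinuousMultilinearMap.norm_compContinuousLinearMap_le _ _
    _ ≤ ‖Q y + a‖ ^ k * (‖iteratedFDeriv ℝ n f (Q y + a)‖ * ∏ _i : Fin n, ‖Q‖) * ‖Q y + a‖ ^ m := by
        gcongr
        · exact hy y
        · exact ha y
    _ = ‖Q‖ ^ n * (‖Q y + a‖ ^ (m + k) * ‖iteratedFDeriv ℝ n f (Q y + a)‖) := by
        simp; ring
    _ ≤ _ := by
        gcongr
        exact le_seminorm ℂ _ _ f _

variable (P : W →L[ℝ] W) (Q : V →L[ℝ] W) (R : W →L[ℝ] V) (hQ : AntilipschitzWith 1 Q)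

/-- `B` acting on the affine slices of `f`. -/
noncomputable def sliceFun (B : 𝓢(V, ℂ) →L[ℂ] 𝓢(V, ℂ)) (f : 𝓢(W, ℂ)) (x : W) : ℂ :=
  B (restrictAffine Q hQ (P x) f) (R x)

theorem sliceFun_decay (hPQ : ∀ x y, ‖P x‖ ≤ ‖Q y + P x‖)
    (hQQ : ∀ x y, ‖y‖ ≤ ‖Q y + P x‖) (hPR : ∀ x, ‖x‖ ≤ max ‖P x‖ ‖R x‖)
    (B : 𝓢(V, ℂ) →L[ℂ] 𝓢(V, ℂ)) (m : ℕ) :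
    ∃ q : Seminorm ℂ 𝓢(W, ℂ), Continuous q ∧
      ∀ f x, ‖x‖ ^ m * ‖sliceFun P Q R hQ B f x‖ ≤ q f := by
  have hq1 : Continuous (fun g : 𝓢(V, ℂ) => ((SchwartzMap.seminorm ℂ 0 0 +
      SchwartzMap.seminorm ℂ m 0 : Seminorm ℂ 𝓢(V, ℂ)).comp B.toLinearMap) g) := by
    have h1 := (schwartz_withSeminorms ℂ V ℂ).continuous_seminorm (0, 0)
    have h2 := (schwartz_withSeminorms ℂ V ℂ).continuous_seminorm (m, 0)
    exact (h1.add h2).comp B.continuous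
  obtain ⟨s, C, -, hC⟩ := Seminorm.bound_of_continuous (schwartz_withSeminorms ℂ V ℂ) _ hq1
  have hC' : ∀ g : 𝓢(V, ℂ), SchwartzMap.seminorm ℂ 0 0 (B g) + SchwartzMap.seminorm ℂ m 0 (B g)
      ≤ C * ∑ i ∈ s, SchwartzMap.seminorm ℂ i.1 i.2 g := by
    intro g
    refine (hC g).trans ?_
    have := Seminorm.finset_sup_le_sum (schwartzSeminormFamily ℂ V ℂ) s g
    rw [seminorm_finsetSum_apply] at this
    exact mul_le_mul_of_nonneg_left this C.2
  refine ⟨C • ∑ i ∈ s, (‖Q‖₊ ^ i.2 • SchwartzMap.seminorm ℂ (0 + i.1) i.2 +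
      ‖Q‖₊ ^ i.2 • SchwartzMap.seminorm ℂ (m + i.1) i.2), ?_, fun f x => ?_⟩
  · have : ∀ k n, Continuous (SchwartzMap.seminorm ℂ k n : Seminorm ℂ 𝓢(W, ℂ)) := fun k n =>
      (schwartz_withSeminorms ℂ W ℂ).continuous_seminorm (k, n)
    have e : ∀ f : 𝓢(W, ℂ), (C • ∑ i ∈ s, (‖Q‖₊ ^ i.2 • SchwartzMap.seminorm ℂ (0 + i.1) i.2 +
        ‖Q‖₊ ^ i.2 • SchwartzMap.seminorm ℂ (m + i.1) i.2) : Seminorm ℂ 𝓢(W, ℂ)) f =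
        C * ∑ i ∈ s, (‖Q‖ ^ i.2 * SchwartzMap.seminorm ℂ (0 + i.1) i.2 f +
          ‖Q‖ ^ i.2 * SchwartzMap.seminorm ℂ (m + i.1) i.2 f) := fun f => by
      simp [NNReal.smul_def]
    refine (Continuous.congr ?_ fun f => (e f).symm)
    fun_prop
  set g := restrictAffine Q hQ (P x) f with hg
  have hs := fun a k n => seminorm_restrictAffine_le Q hQ (P x) (hPQ x) (hQQ x) f a k n
  rw [← hg] at hs
  have h0 : ‖B g (R x)‖ ≤ SchwartzMap.seminorm ℂ 0 0 (B g) := norm_le_seminorm ℂ _ _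
  have hm : ‖R x‖ ^ m * ‖B g (R x)‖ ≤ SchwartzMap.seminorm ℂ m 0 (B g) :=
    norm_pow_mul_le_seminorm ℂ _ _ _
  have hx : ‖x‖ ^ m ≤ ‖P x‖ ^ m + ‖R x‖ ^ m := by
    refine (pow_le_pow_left₀ (norm_nonneg _) (hPR x) m).trans ?_
    rcases max_cases ‖P x‖ ‖R x‖ with ⟨h, _⟩ | ⟨h, _⟩ <;> rw [h]
    · simp
    · simp
  calc ‖x‖ ^ m * ‖B g (R x)‖ ≤ (‖P x‖ ^ m + ‖R x‖ ^ m) * ‖B g (R x)‖ := by gcongr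
    _ ≤ ‖P x‖ ^ m * SchwartzMap.seminorm ℂ 0 0 (B g) + SchwartzMap.seminorm ℂ m 0 (B g) := by
      rw [add_mul]; gcongr
    _ ≤ ‖P x‖ ^ m * (C * ∑ i ∈ s, SchwartzMap.seminorm ℂ i.1 i.2 g) +
        C * ∑ i ∈ s, SchwartzMap.seminorm ℂ i.1 i.2 g := by
      gcongr
      · refine le_trans ?_ (hC' g)
        have : 0 ≤ SchwartzMap.seminorm ℂ m 0 (B g) := apply_nonneg _ _
        linarith
      · refine le_trans ?_ (hC' g)
        have : 0 ≤ SchwartzMap.seminorm ℂ 0 0 (B g) := apply_nonneg _ _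
        linarith
    _ = C * ∑ i ∈ s, (‖P x‖ ^ 0 * SchwartzMap.seminorm ℂ i.1 i.2 g +
          ‖P x‖ ^ m * SchwartzMap.seminorm ℂ i.1 i.2 g) := by
      rw [Finset.sum_add_distrib, ← Finset.mul_sum, ← Finset.mul_sum]; ring
    _ ≤ C * ∑ i ∈ s, (‖Q‖ ^ i.2 * SchwartzMap.seminorm ℂ (0 + i.1) i.2 f +
          ‖Q‖ ^ i.2 * SchwartzMap.seminorm ℂ (m + i.1) i.2 f) := by
      refine mul_le_mul_of_nonneg_left (Finset.sum_le_sum fun i _ => ?_) C.2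
      exact add_le_add (hs 0 i.1 i.2) (hs m i.1 i.2)
    _ = _ := by
      simp [NNReal.smul_def]

theorem sliceFun_hasFDerivAt [FiniteDimensional ℝ W]
    (B : 𝓢(V, ℂ) →L[ℂ] 𝓢(V, ℂ)) (f : 𝓢(W, ℂ)) (x : W) :
    HasFDerivAt (sliceFun P Q R hQ B f)
      (∑ i, ((Module.finBasis ℝ W).coord i).toContinuousLinearMap.smulRight
        (sliceFun P Q R hQ B (∂_{P (Module.finBasis ℝ W i)} f) x +
         sliceFun P Q R hQ ((LineDeriv.lineDerivOpCLM ℂ 𝓢(V, ℂ) (R (Module.finBasis ℝ W i))) ∘L B) f x)) x := by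
  set b := Module.finBasis ℝ W with hb
  set T : 𝓢(W, ℂ) →L[ℂ] 𝓢(V, ℂ) := B ∘L restrictAffine Q hQ 0 with hT
  set g : 𝓢(W, ℂ) := compSubConstCLM ℂ (-(P x)) f with hg
  have hval : ∀ (f : 𝓢(W, ℂ)) (y : W), sliceFun P Q R hQ B f y =
      T (compSubConstCLM ℂ (-(P y)) f) (R y) := by
    intro f y
    simp [sliceFun, hT, restrictAffine]
  -- decomposition of a vector in the basis
  have hsum : ∀ (L : W →ₗ[ℝ] ℂ) (h : W), L h = ∑ i, (b.coord i h : ℝ) • L (b i) := by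
    intro L h
    conv_lhs => rw [← b.sum_repr h, map_sum]
    simp only [map_smul, Module.Basis.coord_apply]
  have hder : ∀ v : W, compSubConstCLM ℂ (-(P x)) (∂_{v} f) = ∂_{v} g := by
    intro v
    ext y
    have : HasFDerivAt g (fderiv ℝ f (y + P x)) y := by
      have : (g : W → ℂ) = fun y => f (y + P x) := by funext y; simp [hg]
      rw [this, hasFDerivAt_comp_add_right]
      exact f.hasFDerivAt _
    simp [lineDerivOp_apply_eq_fderiv, this.fderiv]
  set D : W →ₗ[ℝ] 𝓢(W, ℂ) :=
    { toFun := fun v => ∂_{v} g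
      map_add' := fun v w => LineDeriv.lineDerivOp_left_add v w g
      map_smul' := fun c v => LineDeriv.lineDerivOp_left_smul c v g } with hD
  -- the second order remainder of the translation
  have hrem : ∃ C : ℝ, ∀ h : W, ‖h‖ ≤ 1 → ∀ y : V,
      ‖T (compSubConstCLM ℂ (-h) g - g - ∂_{h} g) y‖ ≤ C * ‖h‖ ^ 2 := by
    have hq : Continuous (fun u : 𝓢(W, ℂ) =>
        ((SchwartzMap.seminorm ℂ 0 0 : Seminorm ℂ 𝓢(V, ℂ)).comp T.toLinearMap) u) :=
      ((schwartz_withSeminorms ℂ V ℂ).continuous_seminorm (0, 0)).comp T.continuous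
    obtain ⟨s, C, -, hC⟩ := Seminorm.bound_of_continuous (schwartz_withSeminorms ℂ W ℂ) _ hq
    choose c hc using fun i : ℕ × ℕ => exists_taylor_bound i.2 g i.1
    refine ⟨C * ∑ i ∈ s, max 0 (c i), fun h hh y => ?_⟩
    set u := compSubConstCLM ℂ (-h) g - g - ∂_{h} g with hu
    have hufun : (u : W → ℂ) = fun y => g (y + h) - g y - fderiv ℝ g y h := by
      funext y
      simp [hu, lineDerivOp_apply_eq_fderiv]
    have h1 : ‖T u y‖ ≤ C * ∑ i ∈ s, SchwartzMap.seminorm ℂ i.1 i.2 u := by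
      refine (norm_le_seminorm ℂ (T u) y).trans ((hC u).trans ?_)
      have := Seminorm.finset_sup_le_sum (schwartzSeminormFamily ℂ W ℂ) s u
      rw [seminorm_finsetSum_apply] at this
      exact mul_le_mul_of_nonneg_left this C.2
    refine h1.trans ?_
    rw [mul_assoc, Finset.sum_mul]
    refine mul_le_mul_of_nonneg_left (Finset.sum_le_sum fun i _ => ?_) C.2
    refine seminorm_le_bound ℂ _ _ _ (by positivity) fun y => ?_
    rw [hufun]
    refine (hc i h hh y).trans ?_
    gcongr
    exact le_max_right _ _
  have hdecomp : ∀ h : W, sliceFun P Q R hQ B f (x + h) - sliceFun P Q R hQ B f x =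
      T (compSubConstCLM ℂ (-(P h)) g - g - ∂_{P h} g) (R x + R h)
      + (T (∂_{P h} g) (R x + R h) - T (∂_{P h} g) (R x))
      + (T g (R x + R h) - T g (R x)) + T (∂_{P h} g) (R x) := by
    intro h
    rw [hval, hval, ← hg]
    have : compSubConstCLM ℂ (-(P (x + h))) f = compSubConstCLM ℂ (-(P h)) g := by
      rw [hg, compSubConstCLM_comp]
      congr 2
      simp [add_comm]
    rw [this]
    simp only [map_sub, map_add, sub_apply]
    ring
  have hTD : ∀ (h : W) (y : V), T (∂_{P h} g) y = ∑ i, (b.coord i h : ℝ) • T (∂_{P (b i)} g) y := by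
    intro h y
    let L : W →ₗ[ℝ] ℂ :=
      { toFun := fun v => T (D (P v)) y
        map_add' := fun v w => by simp
        map_smul' := fun c v => by simp }
    exact hsum L h
  rw [hasFDerivAt_iff_isLittleO_nhds_zero]
  have hl1 : (fun h : W => T (compSubConstCLM ℂ (-(P h)) g - g - ∂_{P h} g) (R x + R h))
      =o[𝓝 0] fun h => h := by
    obtain ⟨C, hC⟩ := hrem
    have hO : (fun h : W => T (compSubConstCLM ℂ (-(P h)) g - g - ∂_{P h} g) (R x + R h))
        =O[𝓝 0] fun h => ‖P h‖ ^ 2 := by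
      refine IsBigO.of_bound C ?_
      have : ∀ᶠ h in 𝓝 (0 : W), ‖P h‖ < 1 := by
        have hc : Continuous fun h => ‖P h‖ := by fun_prop
        have := hc.tendsto 0
        simp only [map_zero, norm_zero] at this
        exact this.eventually_lt_const one_pos
      filter_upwards [this] with h hh
      simpa using hC (P h) hh.le (R x + R h)
    have hO2 : (fun h : W => ‖P h‖ ^ 2) =O[𝓝 0] fun h : W => ‖h‖ ^ 2 := by
      have : (fun h : W => P h) =O[𝓝 0] fun h => h := P.isBigO_id _
      exact this.norm_norm.pow 2
    refine (hO.trans hO2).trans_isLittleO ?_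
    exact (isLittleO_norm_pow_id one_lt_two)
  have hl2 : (fun h : W => T (∂_{P h} g) (R x + R h) - T (∂_{P h} g) (R x))
      =o[𝓝 0] fun h => h := by
    have : (fun h : W => T (∂_{P h} g) (R x + R h) - T (∂_{P h} g) (R x)) = fun h =>
        ∑ i, (b.coord i h : ℝ) • (T (∂_{P (b i)} g) (R x + R h) - T (∂_{P (b i)} g) (R x)) := by
      funext h
      rw [hTD, hTD, ← Finset.sum_sub_distrib]
      simp only [smul_sub]
    rw [this]
    refine IsLittleO.fun_sum fun i _ => ?_
    have h1 : (fun h : W => (b.coord i h : ℝ)) =O[𝓝 0] fun h => h :=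
      (b.coord i).toContinuousLinearMap.isBigO_id _
    have h2 : (fun h : W => T (∂_{P (b i)} g) (R x + R h) - T (∂_{P (b i)} g) (R x))
        =o[𝓝 0] fun _ => (1 : ℝ) := by
      rw [isLittleO_one_iff]
      have hc : Continuous fun h : W =>
          T (∂_{P (b i)} g) (R x + R h) - T (∂_{P (b i)} g) (R x) := by
        have := (T (∂_{P (b i)} g)).continuous
        fun_prop
      simpa using hc.tendsto 0
    refine IsLittleO.of_norm_right ?_
    simpa using h1.norm_right.smul_isLittleO h2
  have hl3 : (fun h : W => T g (R x + R h) - T g (R x) - fderiv ℝ (T g) (R x) (R h))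
      =o[𝓝 0] fun h => h := by
    have := ((T g).hasFDerivAt (x := R x)).comp x R.hasFDerivAt
    rw [hasFDerivAt_iff_isLittleO_nhds_zero] at this
    simpa using this
  have hL : ∀ h : W, (∑ i, ((b.coord i).toContinuousLinearMap.smulRight
        (sliceFun P Q R hQ B (∂_{P (b i)} f) x +
         sliceFun P Q R hQ ((LineDeriv.lineDerivOpCLM ℂ 𝓢(V, ℂ) (R (b i))) ∘L B) f x) :
          W →L[ℝ] ℂ)) h = T (∂_{P h} g) (R x) + fderiv ℝ (T g) (R x) (R h) := by
    intro h
    have e1 : fderiv ℝ (T g) (R x) (R h) =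
        ∑ i, (b.coord i h : ℝ) • fderiv ℝ (T g) (R x) (R (b i)) :=
      hsum ((fderiv ℝ (T g) (R x)).toLinearMap ∘ₗ R.toLinearMap) h
    rw [hTD, e1, ← Finset.sum_add_distrib, sum_apply]
    refine Finset.sum_congr rfl fun i _ => ?_
    have e2 : sliceFun P Q R hQ B (∂_{P (b i)} f) x = T (∂_{P (b i)} g) (R x) := by
      rw [hval, hder]
    have e3 : sliceFun P Q R hQ ((LineDeriv.lineDerivOpCLM ℂ 𝓢(V, ℂ) (R (b i))) ∘L B) f x =
        fderiv ℝ (T g) (R x) (R (b i)) := by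
      have e4 : B (restrictAffine Q hQ (P x) f) = T g := by
        simp [hT, hg, restrictAffine]
      simp [sliceFun, e4, lineDerivOp_apply_eq_fderiv]
    rw [← e2, ← e3, ← smul_add]
    rfl
  have hfin := (hl1.add hl2).add hl3
  refine hfin.congr_left fun h => ?_
  rw [hL, hdecomp]
  ring

theorem sliceFun_contDiff [FiniteDimensional ℝ W]
    (B : 𝓢(V, ℂ) →L[ℂ] 𝓢(V, ℂ)) (f : 𝓢(W, ℂ)) : ContDiff ℝ ∞ (sliceFun P Q R hQ B f) := by
  suffices h : ∀ (n : ℕ) (B : 𝓢(V, ℂ) →L[ℂ] 𝓢(V, ℂ)) (f : 𝓢(W, ℂ)),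
      ContDiff ℝ n (sliceFun P Q R hQ B f) by
    rw [contDiff_infty]
    exact fun n => h n B f
  intro n
  induction n with
  | zero =>
    intro B f
    have : Continuous (sliceFun P Q R hQ B f) := continuous_iff_continuousAt.2 fun x =>
      (sliceFun_hasFDerivAt P Q R hQ B f x).continuousAt
    exact contDiff_zero.2 this
  | succ n ih =>
    intro B f
    push_cast
    rw [contDiff_succ_iff_hasFDerivAt]
    refine ⟨_, ?_, fun x => sliceFun_hasFDerivAt P Q R hQ B f x⟩
    refine ContDiff.sum fun i _ => ?_
    exact ContDiff.smulRight contDiff_const ((ih _ _).add (ih _ _))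

theorem sliceFun_iteratedFDeriv_decay [FiniteDimensional ℝ W]
    (hPQ : ∀ x y, ‖P x‖ ≤ ‖Q y + P x‖)
    (hQQ : ∀ x y, ‖y‖ ≤ ‖Q y + P x‖) (hPR : ∀ x, ‖x‖ ≤ max ‖P x‖ ‖R x‖) (m n : ℕ) :
    ∀ (B : 𝓢(V, ℂ) →L[ℂ] 𝓢(V, ℂ)), ∃ q : Seminorm ℂ 𝓢(W, ℂ), Continuous q ∧
      ∀ f x, ‖x‖ ^ m * ‖iteratedFDeriv ℝ n (sliceFun P Q R hQ B f) x‖ ≤ q f := by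
  induction n with
  | zero =>
    intro B
    simpa using sliceFun_decay P Q R hQ hPQ hQQ hPR B m
  | succ n ih =>
    intro B
    set b := Module.finBasis ℝ W with hb
    choose q hqc hq using ih
    set p : Fin (Module.finrank ℝ W) → Seminorm ℂ 𝓢(W, ℂ) := fun i =>
      ‖(b.coord i).toContinuousLinearMap‖₊ •
        ((q B).comp (LineDeriv.lineDerivOpCLM ℂ 𝓢(W, ℂ) (P (b i))).toLinearMap +
        q ((LineDeriv.lineDerivOpCLM ℂ 𝓢(V, ℂ) (R (b i))) ∘L B)) with hp
    have hpe : ∀ i f, p i f = ‖(b.coord i).toContinuousLinearMap‖ * (q B (∂_{P (b i)} f) +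
        q ((LineDeriv.lineDerivOpCLM ℂ 𝓢(V, ℂ) (R (b i))) ∘L B) f) := by
      intro i f
      simp [hp, NNReal.smul_def, mul_add]
    refine ⟨∑ i, p i, ?_, fun f x => ?_⟩
    · have e : ∀ f, (∑ i, p i) f = ∑ i, ‖(b.coord i).toContinuousLinearMap‖ *
          (q B (LineDeriv.lineDerivOpCLM ℂ 𝓢(W, ℂ) (P (b i)) f) +
          q ((LineDeriv.lineDerivOpCLM ℂ 𝓢(V, ℂ) (R (b i))) ∘L B) f) := fun f => by
        rw [seminorm_finsetSum_apply]
        simp [hpe]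
      refine (Continuous.congr ?_ fun f => (e f).symm)
      have h1 : ∀ B, Continuous fun f => q B f := hqc
      refine continuous_finsetSum _ fun i _ => continuous_const.mul (Continuous.add ?_ (h1 _))
      exact (h1 B).comp (LineDeriv.lineDerivOpCLM ℂ 𝓢(W, ℂ) (P (b i))).continuous
    · rw [← norm_iteratedFDeriv_fderiv]
      have hfd : fderiv ℝ (sliceFun P Q R hQ B f) = fun x => ∑ i,
          (ContinuousLinearMap.smulRightL ℝ W ℂ (b.coord i).toContinuousLinearMap)
          (sliceFun P Q R hQ B (∂_{P (b i)} f) x +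
          sliceFun P Q R hQ ((LineDeriv.lineDerivOpCLM ℂ 𝓢(V, ℂ) (R (b i))) ∘L B) f x) := by
        funext x
        exact (sliceFun_hasFDerivAt P Q R hQ B f x).fderiv
      have hcd : ∀ B f, ContDiff ℝ n (sliceFun P Q R hQ B f) := fun B f =>
        (sliceFun_contDiff P Q R hQ B f).of_le (by exact_mod_cast le_top)
      have hadd := fun i => (hcd B (∂_{P (b i)} f)).add
          (hcd ((LineDeriv.lineDerivOpCLM ℂ 𝓢(V, ℂ) (R (b i))) ∘L B) f)
      rw [hfd, iteratedFDeriv_fun_sum_apply (fun i _ => ?_), seminorm_finsetSum_apply]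
      · refine (mul_le_mul_of_nonneg_left (norm_sum_le _ _) (by positivity)).trans ?_
        rw [Finset.mul_sum]
        refine Finset.sum_le_sum fun i _ => ?_
        rw [hpe]
        have h1 := ContinuousLinearMap.norm_iteratedFDeriv_comp_left
          (ContinuousLinearMap.smulRightL ℝ W ℂ (b.coord i).toContinuousLinearMap)
          (hadd i).contDiffAt (x := x) le_rfl
        rw [ContinuousLinearMap.norm_smulRightL] at h1
        have h2 : ‖iteratedFDeriv ℝ n (sliceFun P Q R hQ B (∂_{P (b i)} f) +
            sliceFun P Q R hQ ((LineDeriv.lineDerivOpCLM ℂ 𝓢(V, ℂ) (R (b i))) ∘L B) f) x‖ ≤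
            ‖iteratedFDeriv ℝ n (sliceFun P Q R hQ B (∂_{P (b i)} f)) x‖ +
            ‖iteratedFDeriv ℝ n (sliceFun P Q R hQ
              ((LineDeriv.lineDerivOpCLM ℂ 𝓢(V, ℂ) (R (b i))) ∘L B) f) x‖ := by
          rw [iteratedFDeriv_add_apply (hcd _ _).contDiffAt (hcd _ _).contDiffAt]
          exact norm_add_le _ _
        have h3 := hq B (∂_{P (b i)} f) x
        have h4 := hq ((LineDeriv.lineDerivOpCLM ℂ 𝓢(V, ℂ) (R (b i))) ∘L B) f x
        calc _ ≤ ‖x‖ ^ m * (‖(b.coord i).toContinuousLinearMap‖ *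
              (‖iteratedFDeriv ℝ n (sliceFun P Q R hQ B (∂_{P (b i)} f)) x‖ +
              ‖iteratedFDeriv ℝ n (sliceFun P Q R hQ
                ((LineDeriv.lineDerivOpCLM ℂ 𝓢(V, ℂ) (R (b i))) ∘L B) f) x‖)) := by
              refine mul_le_mul_of_nonneg_left ?_ (by positivity)
              exact h1.trans (mul_le_mul_of_nonneg_left h2 (norm_nonneg _))
          _ = ‖(b.coord i).toContinuousLinearMap‖ *
              (‖x‖ ^ m * ‖iteratedFDeriv ℝ n (sliceFun P Q R hQ B (∂_{P (b i)} f)) x‖ +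
              ‖x‖ ^ m * ‖iteratedFDeriv ℝ n (sliceFun P Q R hQ
                ((LineDeriv.lineDerivOpCLM ℂ 𝓢(V, ℂ) (R (b i))) ∘L B) f) x‖) := by ring
          _ ≤ _ := by gcongr
      · exact ((ContinuousLinearMap.smulRightL ℝ W ℂ (b.coord i).toContinuousLinearMap).contDiff.comp
          (hadd i)).contDiffAt

/-- The operator `f ↦ (x ↦ B (y ↦ f (Q y + P x)) (R x))` on Schwartz functions. -/
noncomputable def sliceCLM [FiniteDimensional ℝ W]
    (hPQ : ∀ x y, ‖P x‖ ≤ ‖Q y + P x‖)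
    (hQQ : ∀ x y, ‖y‖ ≤ ‖Q y + P x‖) (hPR : ∀ x, ‖x‖ ≤ max ‖P x‖ ‖R x‖)
    (B : 𝓢(V, ℂ) →L[ℂ] 𝓢(V, ℂ)) : 𝓢(W, ℂ) →L[ℂ] 𝓢(W, ℂ) :=
  mkCLM (sliceFun P Q R hQ B) (fun f g x => by simp [sliceFun]) (fun a f x => by simp [sliceFun])
    (fun f => sliceFun_contDiff P Q R hQ B f) (fun n => by
      obtain ⟨q, hqc, hq⟩ := sliceFun_iteratedFDeriv_decay P Q R hQ hPQ hQQ hPR n.1 n.2 B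
      obtain ⟨s, C, -, hC⟩ := Seminorm.bound_of_continuous (schwartz_withSeminorms ℂ W ℂ) q hqc
      exact ⟨s, C, C.2, fun f x => (hq f x).trans (hC f)⟩)

end Slice

/- ### Bosonic Schwartz functions -/

/-- The `n`-particle configuration space `(ℝ^d)^n`. -/
abbrev Config (d n : ℕ) : Type := Fin n → EuclideanSpace ℝ (Fin d)

/-- The Schwartz space `𝓢(ℝ^{dn})`. -/
abbrev Schw (d n : ℕ) : Type := 𝓢(Config d n, ℂ)

variable {d k l j N : ℕ}

instance : (MeasureTheory.volume : MeasureTheory.Measure (Config d k)).IsAddHaarMeasure :=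
  inferInstanceAs (MeasureTheory.Measure.pi fun _ : Fin k =>
    (MeasureTheory.volume : MeasureTheory.Measure (EuclideanSpace ℝ (Fin d)))).IsAddHaarMeasure

/-- The action `(π f)(x_1, …, x_n) = f (x_{π(1)}, …, x_{π(n)})` of a permutation. -/
noncomputable def permute (π : Equiv.Perm (Fin k)) : Schw d k →L[ℂ] Schw d k :=
  compCLMOfContinuousLinearEquiv ℂ
    (LinearEquiv.funCongrLeft ℝ (EuclideanSpace ℝ (Fin d)) π).toContinuousLinearEquiv

theorem permute_apply (π : Equiv.Perm (Fin k)) (f : Schw d k) (x : Config d k) :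
    permute π f x = f (x ∘ π) := rfl

theorem permute_permute (π σ : Equiv.Perm (Fin k)) (f : Schw d k) :
    permute π (permute σ f) = permute (π * σ) f := rfl

/-- The symmetrization operator `Sym_k` on Schwartz functions. -/
noncomputable def symmetrize (d k : ℕ) : Schw d k →L[ℂ] Schw d k :=
  ((k.factorial : ℂ)⁻¹) • ∑ π : Equiv.Perm (Fin k), permute π

/-- The bosonic Schwartz space `𝓢_s(ℝ^{dk})`, with the subspace topology. -/
def bosonic (d k : ℕ) : Submodule ℂ (Schw d k) where
  carrier := {f | ∀ π : Equiv.Perm (Fin k), permute π f = f}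
  add_mem' hf hg π := by rw [map_add, hf π, hg π]
  zero_mem' π := map_zero _
  smul_mem' c f hf π := by rw [map_smul, hf π]

theorem permute_sum_permute (π : Equiv.Perm (Fin k)) (f : Schw d k) :
    permute π (∑ σ : Equiv.Perm (Fin k), permute σ f) = ∑ σ : Equiv.Perm (Fin k), permute σ f := by
  rw [map_sum]
  simp only [permute_permute]
  exact Equiv.sum_comp (Equiv.mulLeft π) fun σ => permute σ f

theorem symmetrize_mem (f : Schw d k) : symmetrize d k f ∈ bosonic d k := by
  intro π
  have e : symmetrize d k f = ((k.factorial : ℂ)⁻¹) • ∑ σ : Equiv.Perm (Fin k), permute σ f := by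
    simp [symmetrize]
  rw [e, map_smul, permute_sum_permute]

/-- Symmetrization as a map `𝓢(ℝ^{dk}) → 𝓢_s(ℝ^{dk})`. -/
noncomputable def symProj (d k : ℕ) : Schw d k →L[ℂ] bosonic d k :=
  (symmetrize d k).codRestrict (bosonic d k) symmetrize_mem

/- ### Operators on the bosonic Schwartz space -/

/-- The bilinear distributional pairing `(f, g) ↦ ∫ f g`, as the inclusion of the bosonic Schwartz
space into its strong dual. -/
noncomputable def toDual (d k : ℕ) : bosonic d k →L[ℂ] (bosonic d k →L[ℂ] ℂ) :=
  (ContinuousLinearMap.precomp ℂ ((toLpCLM ℂ ℂ 2 MeasureTheory.volume) ∘L (bosonic d k).subtypeL)) ∘L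
    ((ContinuousLinearMap.lsmul ℂ ℂ).lpPairing MeasureTheory.volume 2 2) ∘L
      ((toLpCLM ℂ ℂ 2 MeasureTheory.volume) ∘L (bosonic d k).subtypeL)

theorem toDual_apply (f g : bosonic d k) :
    toDual d k f g = ∫ x, (f : Schw d k) x * (g : Schw d k) x := by
  simp only [toDual, ContinuousLinearMap.comp_apply]
  erw [ContinuousLinearMap.lpPairing_eq_integral]
  refine MeasureTheory.integral_congr_ae ?_
  filter_upwards [(f : Schw d k).coeFn_toLp 2 MeasureTheory.volume,
    (g : Schw d k).coeFn_toLp 2 MeasureTheory.volume] with x hf hg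
  simp [hf, hg]

/-- The space of continuous linear maps `𝓢_s(ℝ^{dk}) → 𝓢_s(ℝ^{dk})`. It is a separate type since it
carries the topology induced by `𝓛(𝓢_s, 𝓢_s')`, and not that of `𝓛(𝓢_s, 𝓢_s)`. -/
def Op (d k : ℕ) : Type := bosonic d k →L[ℂ] bosonic d k

namespace Op

noncomputable instance : AddCommGroup (Op d k) :=
  inferInstanceAs (AddCommGroup (bosonic d k →L[ℂ] bosonic d k))

noncomputable instance : Module ℂ (Op d k) :=
  inferInstanceAs (Module ℂ (bosonic d k →L[ℂ] bosonic d k))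

/-- The underlying continuous linear map. -/
def toCLM (A : Op d k) : bosonic d k →L[ℂ] bosonic d k := A

/-- An operator seen as an element of `𝓛(𝓢_s, 𝓢_s')`. -/
noncomputable def toForm (A : Op d k) : bosonic d k →L[ℂ] (bosonic d k →L[ℂ] ℂ) :=
  toDual d k ∘L A.toCLM

/-- The topology induced by that of bounded convergence on `𝓛(𝓢_s, 𝓢_s')`, where `𝓢_s'` is the
strong dual. -/
noncomputable instance : TopologicalSpace (Op d k) :=
  TopologicalSpace.induced toForm inferInstance

/-- Composition of operators. -/
noncomputable def comp (A B : Op d k) : Op d k := ContinuousLinearMap.comp A.toCLM B.toCLM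

/-- `A^* = -A`, that is `⟨f, A g⟩ = -⟨A f, g⟩` for the `L²` inner product. -/
def IsSkewAdjoint (A : Op d k) : Prop :=
  ∀ f g : bosonic d k,
    ∫ x, starRingEnd ℂ ((f : Schw d k) x) * (A.toCLM g : Schw d k) x =
      -∫ x, starRingEnd ℂ ((A.toCLM f : Schw d k) x) * (g : Schw d k) x

/-- The extension `A ∘ Sym_k` of `A` to the whole Schwartz space. -/
noncomputable def full (A : Op d k) : Schw d k →L[ℂ] Schw d k :=
  (bosonic d k).subtypeL ∘L A.toCLM ∘L symProj d k

end Op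

theorem integrable_conj_mul (f g : Schw d k) :
    MeasureTheory.Integrable fun x => starRingEnd ℂ (f x) * g x := by
  have h1 : MeasureTheory.MemLp (fun x => starRingEnd ℂ (f x)) 2 MeasureTheory.volume :=
    (f.memLp 2 MeasureTheory.volume).star
  exact h1.integrable_mul (g.memLp 2 MeasureTheory.volume)

/-- The real vector space `𝔤_k` of `k`-particle bosonic observables, with the topology induced from
`Op d k`. -/
noncomputable def observables (d k : ℕ) : Submodule ℝ (Op d k) where
  carrier := {A | A.IsSkewAdjoint}
  add_mem' {A B} hA hB f g := by
    have e : ∀ h x, ((A + B).toCLM h : Schw d k) x =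
      (A.toCLM h : Schw d k) x + (B.toCLM h : Schw d k) x := fun h x => rfl
    simp only [e, map_add, mul_add, add_mul]
    rw [MeasureTheory.integral_add (integrable_conj_mul _ _) (integrable_conj_mul _ _),
      MeasureTheory.integral_add (integrable_conj_mul _ _) (integrable_conj_mul _ _), hA f g, hB f g,
      neg_add]
  zero_mem' f g := by
    have e : ∀ h x, ((0 : Op d k).toCLM h : Schw d k) x = 0 := fun h x => rfl
    simp [e]
  smul_mem' c A hA f g := by
    have e : ∀ h x, ((c • A).toCLM h : Schw d k) x = (c : ℂ) * (A.toCLM h : Schw d k) x :=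
      fun h x => rfl
    have e1 : ∀ x, starRingEnd ℂ ((f : Schw d k) x) * ((c : ℂ) * (A.toCLM g : Schw d k) x) =
      (c : ℂ) * (starRingEnd ℂ ((f : Schw d k) x) * (A.toCLM g : Schw d k) x) := fun x => by ring
    simp only [e, e1, map_mul, Complex.conj_ofReal, mul_assoc]
    rw [MeasureTheory.integral_const_mul, MeasureTheory.integral_const_mul, hA f g, mul_neg]

/- ### Extension of operators to more particles -/

section Extension

/-- The configuration `x` with the coordinates in the range of `i` set to zero. -/
noncomputable def killCLM (i : Fin k ↪ Fin N) : Config d N →L[ℝ] Config d N :=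
  LinearMap.toContinuousLinearMap
    { toFun := fun x => Function.extend i 0 x
      map_add' := fun x y => by
        have := Function.extend_add i (0 : Config d k) 0 x y
        simpa using this
      map_smul' := fun c x => by
        have := Function.extend_smul c i (0 : Config d k) x
        simpa using this }

/-- The configuration with coordinates `y` in the range of `i` and zero elsewhere. -/
noncomputable def insertCLM (i : Fin k ↪ Fin N) : Config d k →L[ℝ] Config d N :=
  LinearMap.toContinuousLinearMap
    { toFun := fun y => Function.extend i y 0
      map_add' := fun x y => by
        have := Function.extend_add i x y (0 : Config d N) 0
        simpa using this
      map_smul' := fun c x => by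
        have := Function.extend_smul c i x (0 : Config d N)
        simpa using this }

/-- The coordinates `(x_{i(1)}, …, x_{i(k)})`. -/
noncomputable def coordsCLM (i : Fin k ↪ Fin N) : Config d N →L[ℝ] Config d k :=
  LinearMap.toContinuousLinearMap (LinearMap.funLeft ℝ (EuclideanSpace ℝ (Fin d)) i)

theorem insert_add_kill (i : Fin k ↪ Fin N) (x : Config d N) (y : Config d k) :
    insertCLM i y + killCLM i x = Function.extend i y x := by
  have := Function.extend_add i y (0 : Config d k) 0 x
  simp only [add_zero, zero_add] at this
  exact this.symm

theorem norm_kill_le (i : Fin k ↪ Fin N) (x : Config d N) (y : Config d k) :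
    ‖killCLM i x‖ ≤ ‖insertCLM i y + killCLM i x‖ := by
  rw [insert_add_kill, pi_norm_le_iff_of_nonneg (norm_nonneg _)]
  intro a
  refine le_trans ?_ (norm_le_pi_norm _ a)
  change ‖Function.extend i (0 : Config d k) x a‖ ≤ _
  by_cases h : ∃ b, i b = a
  · obtain ⟨b, rfl⟩ := h
    simp [i.injective.extend_apply]
  · rw [Function.extend_apply' _ _ _ h, Function.extend_apply' _ _ _ h]

theorem norm_le_insert (i : Fin k ↪ Fin N) (x : Config d N) (y : Config d k) :
    ‖y‖ ≤ ‖insertCLM i y + killCLM i x‖ := by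
  rw [insert_add_kill, pi_norm_le_iff_of_nonneg (norm_nonneg _)]
  intro a
  refine le_trans (le_of_eq ?_) (norm_le_pi_norm _ (i a))
  rw [i.injective.extend_apply]

theorem norm_le_max (i : Fin k ↪ Fin N) (x : Config d N) :
    ‖x‖ ≤ max ‖killCLM i x‖ ‖coordsCLM i x‖ := by
  rw [pi_norm_le_iff_of_nonneg (by positivity)]
  intro a
  by_cases h : ∃ b, i b = a
  · obtain ⟨b, rfl⟩ := h
    exact le_max_of_le_right (norm_le_pi_norm (coordsCLM i x) b)
  · refine le_max_of_le_left (le_trans (le_of_eq ?_) (norm_le_pi_norm (killCLM i x) a))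
    change _ = ‖Function.extend i (0 : Config d k) x a‖
    rw [Function.extend_apply' _ _ _ h]

theorem antilipschitz_insert (i : Fin k ↪ Fin N) :
    AntilipschitzWith 1 (insertCLM i : Config d k → Config d N) :=
  AddMonoidHomClass.antilipschitz_of_bound _ fun y => by
    simpa using norm_le_insert i (0 : Config d N) y

/-- The slice `y ↦ f (x with the coordinates i(1), …, i(k) replaced by y_1, …, y_k)`. -/
noncomputable def slice (i : Fin k ↪ Fin N) (x : Config d N) : Schw d N →L[ℂ] Schw d k :=
  restrictAffine (insertCLM i) (antilipschitz_insert i) (killCLM i x)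

theorem slice_apply (i : Fin k ↪ Fin N) (x : Config d N) (f : Schw d N) (y : Config d k) :
    slice i x f y = f (Function.extend i y x) := by
  rw [slice, restrictAffine_apply, insert_add_kill]

/-- The `N`-particle operator `B_{(i(1), …, i(k))}`: it acts as `B` in the variables
`x_{i(1)}, …, x_{i(k)}` and as the identity in the other ones. -/
noncomputable def extend (B : Schw d k →L[ℂ] Schw d k) (i : Fin k ↪ Fin N) :
    Schw d N →L[ℂ] Schw d N :=
  sliceCLM (killCLM i) (insertCLM i) (coordsCLM i) (antilipschitz_insert i) (norm_kill_le i)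
    (norm_le_insert i) (norm_le_max i) B

theorem extend_apply (B : Schw d k →L[ℂ] Schw d k) (i : Fin k ↪ Fin N) (f : Schw d N)
    (x : Config d N) : extend B i f x = B (slice i x f) (x ∘ i) := rfl

theorem permute_extend (B : Schw d k →L[ℂ] Schw d k) (i : Fin k ↪ Fin N) (π : Equiv.Perm (Fin N))
    (f : Schw d N) (hf : f ∈ bosonic d N) :
    permute π (extend B i f) = extend B (i.trans π.toEmbedding) f := by
  ext x
  rw [permute_apply, extend_apply, extend_apply]
  have hs : slice i (x ∘ π) f = slice (i.trans π.toEmbedding) x f := by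
    ext y
    rw [slice_apply, slice_apply]
    conv_rhs => rw [← hf π, permute_apply]
    congr 1
    funext a
    by_cases h : ∃ b, i b = a
    · obtain ⟨b, rfl⟩ := h
      have e : π (i b) = (i.trans π.toEmbedding) b := rfl
      rw [i.injective.extend_apply, Function.comp_apply, e,
        (i.trans π.toEmbedding).injective.extend_apply]
    · rw [Function.extend_apply' _ _ _ h, Function.comp_apply, Function.comp_apply,
        Function.extend_apply']
      rintro ⟨b, hb⟩
      exact h ⟨b, π.injective hb⟩
  rw [hs]
  rfl

end Extension

/- ### The embeddings, the brackets and the hierarchies -/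

/-- `C_{k,N} = 1 / |P_k^N|`, where `P_k^N` is the set of `k`-tuples of distinct elements of
`{1, …, N}`. -/
noncomputable def tupleCoeff (k N : ℕ) : ℝ := (Fintype.card (Fin k ↪ Fin N) : ℝ)⁻¹

/-- `C_{k,N} ∑_{i ∈ P_k^N} A_{(i(1), …, i(k))}` on `𝓢(ℝ^{dN})`. -/
noncomputable def embedFull (N : ℕ) (A : Op d k) : Schw d N →L[ℂ] Schw d N :=
  (tupleCoeff k N : ℂ) • ∑ i : Fin k ↪ Fin N, extend A.full i

theorem embedFull_mem (A : Op d k) (f : bosonic d N) : embedFull N A f ∈ bosonic d N := by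
  intro π
  have e : embedFull N A f = (tupleCoeff k N : ℂ) • ∑ i : Fin k ↪ Fin N, extend A.full i f := by
    simp [embedFull]
  rw [e, map_smul, map_sum]
  congr 1
  simp only [permute_extend _ _ _ _ f.2]
  exact Equiv.sum_comp (Equiv.embeddingCongr (Equiv.refl (Fin k)) π)
    fun i => extend A.full i (f : Schw d N)

/-- The embedding `ε_{k,N}` of `k`-particle operators into `N`-particle operators. -/
noncomputable def embed (N : ℕ) (A : Op d k) : Op d N :=
  ((embedFull N A) ∘L (bosonic d N).subtypeL).codRestrict (bosonic d N) (embedFull_mem A)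

/-- The bracket `N (A B - B A)` of `𝔤_N`. -/
noncomputable def commutator (A B : Op d N) : Op d N := (N : ℂ) • (A.comp B - B.comp A)

/-- The inverse of the injective map `ε_{k,N} : 𝔤_k → 𝔤_N`. -/
noncomputable def embedInv (k : ℕ) (T : Op d N) : observables d k :=
  Function.invFun (fun A : observables d k => embed N (A : Op d k)) T

/-- The direct sum `𝔉_∞` of the spaces `𝔤_k`, `k ≥ 1`. -/
abbrev Hierarchy (d : ℕ) : Type := DirectSum ℕ+ fun k => observables d k

/-- The inclusion of `𝔤_k` into `𝔉_∞`. -/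
noncomputable def inclusion (d : ℕ) (k : ℕ+) : observables d k →ₗ[ℝ] Hierarchy d :=
  DirectSum.lof ℝ ℕ+ (fun k => observables d k) k

/-- The topology of the locally convex direct sum: the finest locally convex vector space topology
for which all the inclusions of the summands are continuous. -/
noncomputable instance : TopologicalSpace (Hierarchy d) :=
  sInf {t : TopologicalSpace (Hierarchy d) | (∀ k : ℕ+, Continuous[_, t] (inclusion d k)) ∧
    @IsTopologicalAddGroup (Hierarchy d) t _ ∧
    @ContinuousSMul ℝ (Hierarchy d) _ _ t ∧
    @LocallyConvexSpace ℝ (Hierarchy d) _ _ _ _ t}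

instance : IsTopologicalAddGroup (Hierarchy d) := topologicalAddGroup_sInf fun _ ht => ht.2.1

instance : ContinuousSMul ℝ (Hierarchy d) := continuousSMul_sInf fun _ ht => ht.2.2.1

instance : LocallyConvexSpace ℝ (Hierarchy d) := .sInf fun _ ht => ht.2.2.2

theorem continuous_inclusion (k : ℕ+) : Continuous (inclusion d k) :=
  continuous_sInf_rng.2 fun _ ht => ht.1 k

/-- The space `𝔊_N` of observable `N`-hierarchies, as the subspace of `𝔉_∞` of the sequences with
`A^{(k)} = 0` for `k > N`. -/
def finiteHierarchy (d : ℕ) (N : ℕ+) : Submodule ℝ (Hierarchy d) where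
  carrier := {A | ∀ k : ℕ+, N < k → A k = 0}
  add_mem' hA hB k hk := by rw [DirectSum.add_apply, hA k hk, hB k hk, add_zero]
  zero_mem' k _ := rfl
  smul_mem' c A hA k hk := by rw [DirectSum.smul_apply, hA k hk, smul_zero]

theorem finiteHierarchy_mono {M N : ℕ+} (h : M ≤ N) : finiteHierarchy d M ≤ finiteHierarchy d N :=
  fun _ hA k hk => hA k (h.trans_lt hk)

/-- The component of order `k` of the bracket of `𝔊_N`. -/
noncomputable def bracketComponent (N : ℕ+) (A B : finiteHierarchy d N) (k : ℕ+) :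
    observables d k :=
  ∑ p ∈ Finset.Icc 1 N ×ˢ Finset.Icc 1 N with min ((p.1 : ℕ) + p.2 - 1) N = k,
    embedInv k (commutator (embed N ((A : Hierarchy d) p.1 : Op d p.1))
      (embed N ((B : Hierarchy d) p.2 : Op d p.2)))

/-- The bracket of `𝔊_N`. -/
noncomputable def bracket (N : ℕ+) (A B : finiteHierarchy d N) : finiteHierarchy d N :=
  ⟨DirectSum.mk (fun k : ℕ+ => observables d k) (Finset.Icc 1 N)
      fun k => bracketComponent N A B k,
    fun k hk => DirectSum.mk_apply_of_notMem fun h =>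
      absurd (Finset.mem_Icc.1 (Finset.mem_coe.1 h)).2 (not_le.2 hk)⟩

/- ### Contractions -/

/-- The symmetrization `Sym_k(T) = (1 / k!) ∑_π π T π⁻¹` of an operator, on `𝓢(ℝ^{dk})`. -/
noncomputable def symOpFull (T : Schw d k →L[ℂ] Schw d k) : Schw d k →L[ℂ] Schw d k :=
  ((k.factorial : ℂ)⁻¹) • ∑ π : Equiv.Perm (Fin k), permute π ∘L T ∘L permute π⁻¹

theorem symOpFull_mem (T : Schw d k →L[ℂ] Schw d k) (f : bosonic d k) :
    symOpFull T f ∈ bosonic d k := by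
  have e : symOpFull T f = symmetrize d k (T f) := by
    simp [symOpFull, symmetrize, f.2 _]
  rw [e]
  exact symmetrize_mem _

/-- The bosonic symmetrization `Sym_k(T)`, as an operator on `𝓢_s(ℝ^{dk})`. -/
noncomputable def symOp (T : Schw d k →L[ℂ] Schw d k) : Op d k :=
  ((symOpFull T) ∘L (bosonic d k).subtypeL).codRestrict (bosonic d k) (symOpFull_mem T)

/-- The `r`-fold contraction `A ∘_r B = A_{(1, …, l)} ∑_{α ∈ P_r^l} B_{(α, l+1, …, l+j-r)}` on
`𝓢(ℝ^{dk})`; it is used for `1 ≤ r ≤ min l j` and `k = l + j - 1`. The tuples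
`(α_1, …, α_r, l+1, …, l+j-r)` are the injections of `Fin j` into `Fin k` selected in the sum. -/
noncomputable def contraction (r k : ℕ) (A : Op d l) (B : Op d j) : Schw d k →L[ℂ] Schw d k :=
  (if h : l ≤ k then extend A.full (Fin.castLEEmb h) else 0) ∘L
    ∑ i : Fin j ↪ Fin k with ∀ a : Fin j,
        ((a : ℕ) < r → (i a : ℕ) < l) ∧ (r ≤ (a : ℕ) → (i a : ℕ) = l + (a - r)),
      extend B.full i

/-- The contraction commutator `[A, B]_r = C(j, r) A ∘_r B - C(l, r) B ∘_r A`. -/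
noncomputable def contractionCommutator (r k : ℕ) (A : Op d l) (B : Op d j) :
    Schw d k →L[ℂ] Schw d k :=
  (j.choose r : ℂ) • contraction r k A B - (l.choose r : ℂ) • contraction r k B A

/-- The constant `N C_{l,N} C_{j,N} / (C_{k,N} ∏_{m=1}^{r-1} (N - k + m))`. -/
noncomputable def contractionCoeff (l j k r N : ℕ) : ℝ :=
  N * tupleCoeff l N * tupleCoeff j N /
    (tupleCoeff k N * ∏ m ∈ Finset.Icc 1 (r - 1), ((N : ℝ) - k + m))

/-- The pairs `(l, j)` with `l, j ≥ 1` and `l + j - 1 = k`. -/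
def pairs (k : ℕ+) : Finset (ℕ+ × ℕ+) :=
  {p ∈ Finset.Icc 1 k ×ˢ Finset.Icc 1 k | p.1 + p.2 = k + 1}

end BosonHierarchy

open BosonHierarchy

/-! The commutator of two averages over tuples is a double sum of commutators $[A_i,B_{i'}]$, which
is sorted by the number $r$ of common entries of the $\ell$-tuple $i$ and the $j$-tuple $i'$. For
$r=0$ the two operators act in disjoint variables and commute. For $r\ge1$ bosonic symmetry allows
the common entries to be moved to the first $r$ places of $i'$, which accounts for $\binom jr$. The
two tuples together have $\ell+j-r$ entries, so completing them to a tuple $p$ of length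
$k=\ell+j-1$ leaves $r-1$ free entries. The sum over pairs with $r$ common entries is therefore, up
to this count, the sum over all $p$ of the $r$-fold contraction acting in the variables $p$
(`choose_smul_sum_extend_contraction`). Averaging over $p$ absorbs $\mathrm{Sym}_k$, and for $k\le
N$ the commutator is $\epsilon_{k,N}$ of $\sum_r C_{\ell jkrN}\,\mathrm{Sym}_k([A,B]_r)$
(`commutator_eq_embed`). If $\ell+j-1>N$, then $k=N$ and $\epsilon_{N,N}$ is the identity
(`embed_self`).

Uniqueness of the preimage is the injectivity of $\epsilon_{k,N}$ (`embed_injective`), tested on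
tensor powers $f^{\otimes N}$. This and the commutation in disjoint variables (`extend_comm`) rest
on the density of the span of products of one-particle test functions in the Schwartz space
(`span_tensor_closure_eq_top`).

For the limit, $C_{k,N}\sim N^{-k}$, so the constant tends to $1$ for $r=1$, and each further
contraction divides it by a factor of order $N$. Once $N\ge 2N_0-1$ the bracket is a combination of
finitely many fixed observables in which only the real coefficients depend on $N$
(`bracket_eq_sum`), so the continuity of the vector space operations of $\mathfrak F_\infty$ gives
convergence. -/

namespace BosonHierarchy

/-! ### Density in the Schwartz space: cutoffs, mollifiers and Riemann sums. -/

section Density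

open MeasureTheory

theorem tendsto_of_seminorm {V ι : Type} [NormedAddCommGroup V] [NormedSpace ℝ V] {l : Filter ι}
    {g : ι → 𝓢(V, ℂ)} {f : 𝓢(V, ℂ)}
    (h : ∀ (k n : ℕ) (ε : ℝ), 0 < ε → ∀ᶠ i in l, ∀ x,
      ‖x‖ ^ k * ‖iteratedFDeriv ℝ n (g i - f) x‖ ≤ ε) : Tendsto g l (𝓝 f) := by
  rw [(schwartz_withSeminorms ℂ V ℂ).tendsto_nhds]
  rintro ⟨k, n⟩ ε hε
  filter_upwards [h k n (ε / 2) (by positivity)] with i hi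
  exact (seminorm_le_bound ℂ k n _ (by positivity) hi).trans_lt (by linarith)

theorem iteratedFDeriv_sub_coe {V : Type} [NormedAddCommGroup V] [NormedSpace ℝ V]
    (f g : 𝓢(V, ℂ)) (n : ℕ) (x : V) :
    iteratedFDeriv ℝ n (f - g : 𝓢(V, ℂ)) x = iteratedFDeriv ℝ n f x - iteratedFDeriv ℝ n g x := by
  have : ((f - g : 𝓢(V, ℂ)) : V → ℂ) = (f : V → ℂ) - g := by ext; simp
  rw [this, iteratedFDeriv_sub_apply (f.contDiffAt n) (g.contDiffAt n)]

theorem exists_iteratedFDeriv_bound {V : Type} [NormedAddCommGroup V] [NormedSpace ℝ V]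
    {χ : V → ℂ} (h1 : ContDiff ℝ ∞ χ) (h2 : HasCompactSupport χ)
    (n : ℕ) : ∃ C : ℝ, 0 ≤ C ∧ ∀ x, ‖iteratedFDeriv ℝ n χ x‖ ≤ C := by
  let g : 𝓢(V, ℂ) := h2.toSchwartzMap h1
  exact ⟨SchwartzMap.seminorm ℝ 0 n g, apply_nonneg _ _,
    fun x => g.norm_iteratedFDeriv_le_seminorm ℝ n x⟩

variable {V : Type} [NormedAddCommGroup V] [NormedSpace ℝ V] [FiniteDimensional ℝ V]

/-- The cutoffs $\chi(tx)f(x)$ tend to $f$ as $t\to0$: the error lives on $t\|x\|\ge1$, where one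
more power of the weight gains a factor $t$, and derivatives falling on $\chi(t\,\cdot)$ only
produce factors $t^i\le1$. -/
theorem dense_hasCompactSupport : Dense {f : 𝓢(V, ℂ) | HasCompactSupport f} := by
  intro f
  let b : ContDiffBump (0 : V) := ⟨1, 2, one_pos, one_lt_two⟩
  let χ : V → ℂ := fun x => (b x : ℂ)
  have hχ : ContDiff ℝ ∞ χ := Complex.ofRealCLM.contDiff.comp b.contDiff
  have hχc : HasCompactSupport χ := b.hasCompactSupport.comp_left (g := fun x : ℝ => (x : ℂ)) rfl
  choose C hC0 hC using exists_iteratedFDeriv_bound hχ hχc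
  have hψ : ContDiff ℝ ∞ (fun x => χ x - 1) := hχ.sub contDiff_const
  have hψb : ∀ i x, ‖iteratedFDeriv ℝ i (fun x => χ x - 1) x‖ ≤ C i + 1 := by
    intro i x
    have e : (fun x => χ x - 1) = χ - fun _ => (1 : ℂ) := rfl
    rw [e, iteratedFDeriv_sub_apply (hχ.of_le (mod_cast le_top)).contDiffAt
      (contDiff_const.contDiffAt)]
    refine (norm_sub_le _ _).trans (add_le_add (hC i x) ?_)
    rcases i with _ | i
    · simp
    · rw [iteratedFDeriv_const_of_ne (by simp)]
      simp
  let t : ℕ → ℝ := fun j => 1 / ((j : ℝ) + 1)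
  have ht0 : ∀ j, 0 < t j := fun j => by positivity
  have ht1 : ∀ j, t j ≤ 1 := fun j => by
    simp only [t]
    rw [div_le_one (by positivity)]
    have : (0 : ℝ) ≤ j := by positivity
    linarith
  have hsm : ∀ j, ContDiff ℝ ∞ (fun x => χ (t j • x)) := fun j =>
    hχ.comp (contDiff_const_smul (t j))
  have hcs : ∀ j, HasCompactSupport (fun x => χ (t j • x)) := fun j =>
    hχc.comp_smul (ht0 j).ne'
  let g : ℕ → 𝓢(V, ℂ) := fun j =>
    HasCompactSupport.toSchwartzMap (f := fun x => χ (t j • x) * f x) (hcs j).mul_right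
      ((hsm j).mul (f.smooth ⊤))
  refine mem_closure_of_tendsto (f := g) (b := atTop) ?_ (Eventually.of_forall fun j =>
    (hcs j).mul_right)
  refine tendsto_of_seminorm fun k n ε hε => ?_
  -- The Leibniz bound for the error is `t j * M`; the weight `k + 1` pays for the factor `t j`.
  set M : ℝ := ∑ i ∈ Finset.range (n + 1), (n.choose i : ℝ) * (C i + 1) *
    SchwartzMap.seminorm ℝ (k + 1) (n - i) f with hM
  have hM0 : 0 ≤ M := Finset.sum_nonneg fun i _ => by
    have := hC0 i
    positivity
  have hlim : Tendsto (fun j => t j * M) atTop (𝓝 0) := by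
    simpa only [zero_mul] using (tendsto_one_div_add_atTop_nhds_zero_nat (𝕜 := ℝ)).mul_const M
  filter_upwards [hlim.eventually_lt_const hε] with j hj x
  refine le_trans ?_ hj.le
  have hgf : ((g j - f : 𝓢(V, ℂ)) : V → ℂ) = fun x => (χ (t j • x) - 1) * f x := by
    funext x
    change χ (t j • x) * f x - f x = _
    ring
  rw [hgf]
  rcases lt_or_ge (t j * ‖x‖) 1 with hx | hx
  · have : (fun x => (χ (t j • x) - 1) * f x) =ᶠ[𝓝 x] fun _ => 0 := by
      have ho : IsOpen {x : V | t j * ‖x‖ < 1} := isOpen_lt (by fun_prop) (by fun_prop)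
      filter_upwards [ho.mem_nhds hx] with y hy
      have : b (t j • y) = 1 := by
        apply b.one_of_mem_closedBall
        simpa [norm_smul, abs_of_pos (ht0 j)] using (le_of_lt hy : t j * ‖y‖ ≤ 1)
      simp [χ, this]
    have h0 : iteratedFDeriv ℝ n (fun x => (χ (t j • x) - 1) * f x) x = 0 := by
      rw [(this.iteratedFDeriv ℝ n).eq_of_nhds]
      simp
    rw [h0]
    simpa using mul_nonneg (ht0 j).le hM0
  · have hψt : ContDiff ℝ ∞ (fun x => χ (t j • x) - 1) := (hsm j).sub contDiff_const
    refine (mul_le_mul_of_nonneg_left (norm_iteratedFDeriv_mul_le (N := n)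
      (hψt.of_le (mod_cast le_top)) (f.smooth n) x le_rfl) (by positivity)).trans ?_
    rw [hM, Finset.mul_sum, Finset.mul_sum]
    refine Finset.sum_le_sum fun i _ => ?_
    have h1 : ‖iteratedFDeriv ℝ i (fun x => χ (t j • x) - 1) x‖ ≤ C i + 1 := by
      rw [iteratedFDeriv_comp_const_smul (f := fun x => χ x - 1) (t j)
        (hψ.of_le (mod_cast le_top)), norm_smul, norm_pow,
        Real.norm_of_nonneg (ht0 j).le]
      refine (mul_le_mul (pow_le_one₀ (ht0 j).le (ht1 j)) (hψb i _) (norm_nonneg _)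
        zero_le_one).trans ?_
      rw [one_mul]
    have h2 : ‖x‖ ^ k * ‖iteratedFDeriv ℝ (n - i) f x‖ ≤
        t j * SchwartzMap.seminorm ℝ (k + 1) (n - i) f := by
      refine le_trans ?_ (mul_le_mul_of_nonneg_left (f.le_seminorm ℝ (k + 1) (n - i) x) (ht0 j).le)
      calc ‖x‖ ^ k * ‖iteratedFDeriv ℝ (n - i) f x‖
          = 1 * (‖x‖ ^ k * ‖iteratedFDeriv ℝ (n - i) f x‖) := (one_mul _).symm
        _ ≤ (t j * ‖x‖) * (‖x‖ ^ k * ‖iteratedFDeriv ℝ (n - i) f x‖) := by gcongr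
        _ = _ := by ring
    have := hC0 i
    calc _ = (n.choose i : ℝ) * ‖iteratedFDeriv ℝ i (fun x => χ (t j • x) - 1) x‖ *
          (‖x‖ ^ k * ‖iteratedFDeriv ℝ (n - i) f x‖) := by ring
      _ ≤ (n.choose i : ℝ) * (C i + 1) * (t j * SchwartzMap.seminorm ℝ (k + 1) (n - i) f) := by
        gcongr
      _ = _ := by ring

variable [MeasurableSpace V] [BorelSpace V] (μ : Measure V) [μ.IsAddHaarMeasure]

/-- The target is a general space `F` because the induction on the order of differentiation applies
this to `iteratedFDeriv ℝ n g`. -/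
theorem hasFDerivAt_integral_mul_sub {F : Type} [NormedAddCommGroup F] [NormedSpace ℝ F]
    [NormedSpace ℂ F] [IsScalarTower ℝ ℂ F] [CompleteSpace F]
    {φ : V → ℂ} (hφ : Continuous φ) {g : V → F} (hg : ContDiff ℝ 1 g) (hgc : HasCompactSupport g)
    (x : V) : HasFDerivAt (fun x => ∫ a, φ a • g (x - a) ∂μ)
      (∫ a, φ a • fderiv ℝ g (x - a) ∂μ) x :=
  hgc.hasFDerivAt_convolution_right (ContinuousLinearMap.lsmul ℝ ℂ : ℂ →L[ℝ] F →L[ℝ] F)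
    (hφ.locallyIntegrable (μ := μ)) hg x

theorem contDiff_integral_mul_sub {φ : V → ℂ} (hφ : Continuous φ) {g : V → ℂ}
    (hg : ContDiff ℝ ∞ g) (hgc : HasCompactSupport g) :
    ContDiff ℝ ∞ (fun x => ∫ a, φ a • g (x - a) ∂μ) :=
  hgc.contDiff_convolution_right (n := ⊤) (ContinuousLinearMap.lsmul ℝ ℂ : ℂ →L[ℝ] ℂ →L[ℝ] ℂ)
    (hφ.locallyIntegrable (μ := μ)) hg

omit [NormedSpace ℝ V] [FiniteDimensional ℝ V] [BorelSpace V] [μ.IsAddHaarMeasure] in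
theorem hasCompactSupport_integral_mul_sub {φ : V → ℂ} (hφ : HasCompactSupport φ) {g : V → ℂ}
    (hg : HasCompactSupport g) : HasCompactSupport (fun x => ∫ a, φ a • g (x - a) ∂μ) :=
  hφ.convolution (ContinuousLinearMap.lsmul ℝ ℂ : ℂ →L[ℝ] ℂ →L[ℝ] ℂ) hg

theorem iteratedFDeriv_integral_mul_sub {φ : V → ℂ} (hφ : Continuous φ) {g : V → ℂ}
    (hg : ContDiff ℝ ∞ g) (hgc : HasCompactSupport g) (n : ℕ) :
    iteratedFDeriv ℝ n (fun x => ∫ a, φ a • g (x - a) ∂μ) =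
      fun x => ∫ a, φ a • iteratedFDeriv ℝ n g (x - a) ∂μ := by
  induction n with
  | zero =>
    funext x
    rw [iteratedFDeriv_zero_eq_comp]
    simp only [iteratedFDeriv_zero_eq_comp, Function.comp_apply]
    exact (ContinuousLinearEquiv.integral_comp_comm (E := ℂ) (F := V [×0]→L[ℝ] ℂ) (𝕜 := ℝ) (μ := μ)
      (continuousMultilinearCurryFin0 ℝ V ℂ).symm.toContinuousLinearEquiv
      fun a => φ a • g (x - a)).symm
  | succ n ih =>
    funext x
    have h1 : ContDiff ℝ 1 (iteratedFDeriv ℝ n g) :=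
      hg.iteratedFDeriv_right (m := 1) (i := n) (mod_cast le_top)
    rw [iteratedFDeriv_succ_eq_comp_left, ih, Function.comp_apply,
      (hasFDerivAt_integral_mul_sub μ hφ h1 (hgc.iteratedFDeriv n) x).fderiv]
    simp only [iteratedFDeriv_succ_eq_comp_left, Function.comp_apply]
    exact (ContinuousLinearEquiv.integral_comp_comm (E := V →L[ℝ] (V [×n]→L[ℝ] ℂ))
      (F := V [×(n + 1)]→L[ℝ] ℂ) (𝕜 := ℝ) (μ := μ)
      (continuousMultilinearCurryLeftEquiv ℝ (fun _ : Fin (n + 1) => V) ℂ).symm.toContinuousLinearEquiv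
      fun a => φ a • fderiv ℝ (iteratedFDeriv ℝ n g) (x - a)).symm

omit [FiniteDimensional ℝ V] [MeasurableSpace V] [BorelSpace V] in
/-- A weighted form of the uniform continuity of the derivatives of a test function. -/
theorem exists_uniform_translation_bound (g : 𝓢(V, ℂ)) (hg : HasCompactSupport g) (k n : ℕ)
    (A : ℝ) {ε : ℝ} (hε : 0 < ε) : ∃ δ > 0, ∀ x a b : V, ‖a‖ ≤ A → ‖a - b‖ < δ →
      ‖x‖ ^ k * ‖iteratedFDeriv ℝ n g (x - a) - iteratedFDeriv ℝ n g (x - b)‖ ≤ ε := by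
  have hu : UniformContinuous (iteratedFDeriv ℝ n g) :=
    (hg.iteratedFDeriv n).uniformContinuous_of_continuous
      ((g.smooth n).continuous_iteratedFDeriv le_rfl)
  obtain ⟨R₀, hR₀⟩ := (hg.iteratedFDeriv (𝕜 := ℝ) n).isCompact.isBounded.exists_norm_le
  have hz : ∀ y, R₀ < ‖y‖ → iteratedFDeriv ℝ n g y = 0 := fun y hy =>
    image_eq_zero_of_notMem_tsupport fun h => not_lt.2 (hR₀ y h) hy
  set R : ℝ := |R₀| + |A| + 1 with hR
  have hRpos : 0 < R := by positivity
  obtain ⟨δ, hδ, h⟩ := Metric.uniformContinuous_iff.1 hu (ε / R ^ k) (by positivity)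
  refine ⟨min δ 1, by positivity, fun x a b ha hab => ?_⟩
  rcases le_or_gt ‖x‖ R with hx | hx
  · have h1 : ‖iteratedFDeriv ℝ n g (x - a) - iteratedFDeriv ℝ n g (x - b)‖ ≤ ε / R ^ k := by
      rw [← dist_eq_norm]
      refine (h ?_).le
      rw [dist_eq_norm, sub_sub_sub_cancel_left, norm_sub_rev]
      exact hab.trans_le (min_le_left _ _)
    calc _ ≤ R ^ k * (ε / R ^ k) := by gcongr
      _ = ε := by field_simp
  · have hab1 : ‖a - b‖ < 1 := hab.trans_le (min_le_right _ _)
    have h1 := norm_sub_norm_le x a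
    have h2 := norm_sub_norm_le x b
    have h3 := norm_sub_norm_le b a
    rw [norm_sub_rev b a] at h3
    have h4 := le_abs_self R₀
    have h5 := le_abs_self A
    rw [hz _ (by linarith), hz _ (by linarith)]
    simpa using hε.le

/-- Since $\int\rho_i=1$, the $n$-th derivative of the error is
$\int\rho_i(a)\,(D^nf(x-a)-D^nf(x))\,da$. Only small $a$ contribute, so weighted uniform continuity
of $D^nf$ and $\int|\rho_i|\le1$ bound it. -/
theorem tendsto_mollify (f : 𝓢(V, ℂ)) (hf : HasCompactSupport f) (ρ : ℕ → V → ℂ)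
    (hρ : ∀ i, Continuous (ρ i)) (hρc : ∀ i, HasCompactSupport (ρ i))
    (h1 : ∀ i, ∫ a, ρ i a ∂μ = 1) (h2 : ∀ i, ∫ a, ‖ρ i a‖ ∂μ ≤ 1) (δ : ℕ → ℝ)
    (hδ : Tendsto δ atTop (𝓝 0)) (hsupp : ∀ i a, δ i ≤ ‖a‖ → ρ i a = 0) (G : ℕ → 𝓢(V, ℂ))
    (hG : ∀ i x, G i x = ∫ a, ρ i a • f (x - a) ∂μ) : Tendsto G atTop (𝓝 f) := by
  refine tendsto_of_seminorm fun k n ε hε => ?_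
  obtain ⟨δ₀, hδ₀, h⟩ := exists_uniform_translation_bound f hf k n 0 hε
  filter_upwards [hδ.eventually_lt_const hδ₀] with i hi x
  have hGi : (G i : V → ℂ) = fun x => ∫ a, ρ i a • f (x - a) ∂μ := funext (hG i)
  have hDc : Continuous (iteratedFDeriv ℝ n f) := (f.smooth n).continuous_iteratedFDeriv le_rfl
  have hint : Integrable (ρ i) μ := (hρ i).integrable_of_hasCompactSupport (hρc i)
  have hint2 : Integrable (fun a => ρ i a • iteratedFDeriv ℝ n f (x - a)) μ :=
    (Continuous.smul (hρ i) (by fun_prop)).integrable_of_hasCompactSupport (hρc i).smul_right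
  have e : iteratedFDeriv ℝ n (G i - f : 𝓢(V, ℂ)) x =
      ∫ a, ρ i a • (iteratedFDeriv ℝ n f (x - a) - iteratedFDeriv ℝ n f x) ∂μ := by
    rw [iteratedFDeriv_sub_coe, hGi, iteratedFDeriv_integral_mul_sub μ (hρ i) (f.smooth ⊤) hf]
    simp only [smul_sub]
    rw [integral_sub hint2 (hint.smul_const _), integral_smul_const, h1, one_smul]
  rw [e]
  calc ‖x‖ ^ k * ‖∫ a, ρ i a • (iteratedFDeriv ℝ n f (x - a) - iteratedFDeriv ℝ n f x) ∂μ‖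
      = ‖∫ a, (‖x‖ ^ k : ℝ) •
          (ρ i a • (iteratedFDeriv ℝ n f (x - a) - iteratedFDeriv ℝ n f x)) ∂μ‖ := by
        rw [integral_smul, norm_smul, Real.norm_of_nonneg (by positivity)]
    _ ≤ ∫ a, ‖ρ i a‖ * ε ∂μ := by
        refine norm_integral_le_of_norm_le (hint.norm.mul_const ε) (ae_of_all _ fun a => ?_)
        rw [norm_smul, norm_smul, Real.norm_of_nonneg (by positivity)]
        rcases le_or_gt (δ i) ‖a‖ with ha | ha
        · simp [hsupp i a ha]
        · have := h x 0 a (by simp) (by simpa using ha.trans hi)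
          rw [sub_zero, norm_sub_rev] at this
          calc _ = ‖ρ i a‖ * (‖x‖ ^ k *
                ‖iteratedFDeriv ℝ n f (x - a) - iteratedFDeriv ℝ n f x‖) := by ring
            _ ≤ _ := by gcongr
    _ ≤ 1 * ε := by
        rw [integral_mul_const]
        gcongr
        exact h2 i
    _ = ε := one_mul ε

omit [NormedAddCommGroup V] [NormedSpace ℝ V] [FiniteDimensional ℝ V] [BorelSpace V]
  [μ.IsAddHaarMeasure] in
theorem integral_smul_comp_simpleFunc {F : Type} [NormedAddCommGroup F] [NormedSpace ℝ F]
    [NormedSpace ℂ F] [CompleteSpace F] {f : V → ℂ} (hf : Integrable f μ)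
    (s : SimpleFunc V V) (Φ : V → F) :
    Integrable (fun a => f a • Φ (s a)) μ ∧
    ∫ a, f a • Φ (s a) ∂μ = ∑ b ∈ s.range, (∫ a in s ⁻¹' {b}, f a ∂μ) • Φ b := by
  have e : (fun a => f a • Φ (s a)) =
      fun a => ∑ b ∈ s.range, (s ⁻¹' {b}).indicator f a • Φ b := by
    funext a
    rw [Finset.sum_eq_single (s a)]
    · simp
    · intro b _ hb
      rw [Set.indicator_of_notMem (by simpa using hb.symm), zero_smul]
    · intro h
      exact absurd (SimpleFunc.mem_range_self s a) h
  have hi : ∀ b, Integrable (fun a => (s ⁻¹' {b}).indicator f a • Φ b) μ := fun b =>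
    (hf.indicator (s.measurableSet_fiber b)).smul_const _
  rw [e]
  refine ⟨integrable_finsetSum _ fun b _ => hi b, ?_⟩
  rw [integral_finsetSum _ fun b _ => hi b]
  refine Finset.sum_congr rfl fun b _ => ?_
  rw [integral_smul_const, integral_indicator (s.measurableSet_fiber b)]

/-- The convolution is approximated by Riemann sums: replacing $a$ by the value $s_m(a)$ of a simple
function in $\rho(x-a)$ turns the integral into a finite combination of translates of $\rho$. -/
theorem mem_closure_span_translates (f : V → ℂ) (hf : Continuous f) (hfc : HasCompactSupport f)
    (ρ : 𝓢(V, ℂ)) (hρ : HasCompactSupport ρ) (G : 𝓢(V, ℂ))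
    (hG : ∀ x, G x = ∫ a, f a • ρ (x - a) ∂μ) :
    G ∈ closure (Submodule.span ℂ (Set.range fun b : V => compSubConstCLM ℂ b ρ) :
      Set 𝓢(V, ℂ)) := by
  have hint : Integrable f μ := hf.integrable_of_hasCompactSupport hfc
  let e : ℕ → V := TopologicalSpace.denseSeq V
  let s : ℕ → SimpleFunc V V := fun m => SimpleFunc.nearestPt e m
  let g : ℕ → 𝓢(V, ℂ) := fun m =>
    ∑ b ∈ (s m).range, (∫ a in (s m) ⁻¹' {b}, f a ∂μ) • compSubConstCLM ℂ b ρ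
  refine mem_closure_of_tendsto (f := g) (b := atTop) ?_ (Eventually.of_forall fun m =>
    Submodule.sum_mem _ fun b _ => Submodule.smul_mem _ _ (Submodule.subset_span ⟨b, rfl⟩))
  refine tendsto_of_seminorm fun k n ε hε => ?_
  obtain ⟨A, hA⟩ := hfc.isCompact.isBounded.exists_norm_le
  set I : ℝ := ∫ a, ‖f a‖ ∂μ with hI
  have hI0 : 0 ≤ I := integral_nonneg fun _ => norm_nonneg _
  -- The error will be at most $I$ times this tolerance; the $+1$ covers $I=0$.
  obtain ⟨δ, hδ, h⟩ := exists_uniform_translation_bound ρ hρ k n A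
    (show 0 < ε / (I + 1) by positivity)
  -- Nearest points in a dense sequence converge uniformly on a compact set, by a finite subcover.
  have hnear : ∀ᶠ m in atTop, ∀ a ∈ tsupport f, ‖a - s m a‖ < δ := by
    have hcov : tsupport f ⊆ ⋃ i : ℕ, Metric.ball (e i) δ := by
      intro a _
      obtain ⟨i, hi⟩ := (TopologicalSpace.denseRange_denseSeq V).exists_dist_lt a hδ
      exact Set.mem_iUnion.2 ⟨i, hi⟩
    obtain ⟨T, hT⟩ := hfc.isCompact.elim_finite_subcover _ (fun _ => Metric.isOpen_ball) hcov
    filter_upwards [eventually_ge_atTop (T.sup id)] with m hm a ha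
    obtain ⟨i, hi, hai⟩ := Set.mem_iUnion₂.1 (hT ha)
    have h1 := SimpleFunc.edist_nearestPt_le e a ((Finset.le_sup (f := id) hi).trans hm)
    rw [edist_dist, edist_dist, ENNReal.ofReal_le_ofReal_iff dist_nonneg] at h1
    rw [← dist_eq_norm, dist_comm]
    refine h1.trans_lt ?_
    rw [dist_comm]
    exact hai
  filter_upwards [hnear] with m hm x
  have hGe : (G : V → ℂ) = fun x => ∫ a, f a • ρ (x - a) ∂μ := funext hG
  have hDc : Continuous (iteratedFDeriv ℝ n ρ) := (ρ.smooth n).continuous_iteratedFDeriv le_rfl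
  have hDg : iteratedFDeriv ℝ n (g m) x =
      ∫ a, f a • iteratedFDeriv ℝ n ρ (x - s m a) ∂μ := by
    rw [(integral_smul_comp_simpleFunc μ hint (s m) fun b => iteratedFDeriv ℝ n ρ (x - b)).2]
    have e1 : (g m : V → ℂ) =
        fun x => ∑ b ∈ (s m).range, (∫ a in (s m) ⁻¹' {b}, f a ∂μ) • ρ (x - b) := by
      funext x
      simp only [g, sum_apply]
      rfl
    have hcd : ∀ b, ContDiff ℝ n fun x => ρ (x - b) := fun b =>
      (ρ.smooth n).comp (contDiff_id.sub contDiff_const)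
    have hcd' : ∀ b ∈ (s m).range, ContDiffAt ℝ n
        (fun x => (∫ a in (s m) ⁻¹' {b}, f a ∂μ) • ρ (x - b)) x := fun b _ =>
      ((hcd b).const_smul _).contDiffAt
    rw [e1, iteratedFDeriv_fun_sum_apply hcd']
    refine Finset.sum_congr rfl fun b _ => ?_
    rw [iteratedFDeriv_const_smul_apply' (hcd b).contDiffAt, iteratedFDeriv_comp_sub]
  have hi2 : Integrable (fun a => f a • iteratedFDeriv ℝ n ρ (x - a)) μ :=
    (Continuous.smul hf (by fun_prop)).integrable_of_hasCompactSupport hfc.smul_right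
  have hi1 := (integral_smul_comp_simpleFunc μ hint (s m)
    fun b => iteratedFDeriv ℝ n ρ (x - b)).1
  have e2 : iteratedFDeriv ℝ n (g m - G : 𝓢(V, ℂ)) x =
      ∫ a, f a • (iteratedFDeriv ℝ n ρ (x - s m a) - iteratedFDeriv ℝ n ρ (x - a)) ∂μ := by
    rw [iteratedFDeriv_sub_coe, hDg, hGe, iteratedFDeriv_integral_mul_sub μ hf (ρ.smooth ⊤) hρ]
    simp only [smul_sub]
    rw [integral_sub hi1 hi2]
  rw [e2]
  calc ‖x‖ ^ k *
        ‖∫ a, f a • (iteratedFDeriv ℝ n ρ (x - s m a) - iteratedFDeriv ℝ n ρ (x - a)) ∂μ‖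
      = ‖∫ a, (‖x‖ ^ k : ℝ) •
          (f a • (iteratedFDeriv ℝ n ρ (x - s m a) - iteratedFDeriv ℝ n ρ (x - a))) ∂μ‖ := by
        rw [integral_smul, norm_smul, Real.norm_of_nonneg (by positivity)]
    _ ≤ ∫ a, ‖f a‖ * (ε / (I + 1)) ∂μ := by
        refine norm_integral_le_of_norm_le (hint.norm.mul_const _) (ae_of_all _ fun a => ?_)
        rw [norm_smul, norm_smul, Real.norm_of_nonneg (by positivity)]
        by_cases ha : a ∈ tsupport f
        · have := h x a (s m a) (hA a ha) (hm a ha)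
          rw [norm_sub_rev] at this
          calc _ = ‖f a‖ * (‖x‖ ^ k *
                ‖iteratedFDeriv ℝ n ρ (x - s m a) - iteratedFDeriv ℝ n ρ (x - a)‖) := by ring
            _ ≤ _ := by gcongr
        · simp [image_eq_zero_of_notMem_tsupport ha]
    _ = I * (ε / (I + 1)) := by rw [integral_mul_const]
    _ ≤ (I + 1) * (ε / (I + 1)) := by gcongr; linarith
    _ = ε := by field_simp

/-- Compactly supported Schwartz functions are limits of combinations of translates of the members
of an approximate identity. -/
theorem mem_of_approximate_identity (M : Submodule ℂ 𝓢(V, ℂ)) (hM : IsClosed (M : Set 𝓢(V, ℂ)))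
    (ρ : ℕ → 𝓢(V, ℂ)) (hρc : ∀ i, HasCompactSupport (ρ i))
    (h1 : ∀ i, ∫ a, ρ i a ∂μ = 1) (h2 : ∀ i, ∫ a, ‖ρ i a‖ ∂μ ≤ 1) (δ : ℕ → ℝ)
    (hδ : Tendsto δ atTop (𝓝 0)) (hsupp : ∀ i a, δ i ≤ ‖a‖ → ρ i a = 0)
    (hmem : ∀ i b, compSubConstCLM ℂ b (ρ i) ∈ M) (f : 𝓢(V, ℂ)) : f ∈ M := by
  have hcl : ∀ f : 𝓢(V, ℂ), HasCompactSupport f → f ∈ M := by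
    intro f hf
    let G : ℕ → 𝓢(V, ℂ) := fun i =>
      (hasCompactSupport_integral_mul_sub μ (hρc i) hf).toSchwartzMap
        (contDiff_integral_mul_sub μ (ρ i).continuous (f.smooth ⊤) hf)
    have hG : ∀ i x, G i x = ∫ a, ρ i a • f (x - a) ∂μ := fun i x => rfl
    have hlim := tendsto_mollify μ f hf (fun i => ρ i) (fun i => (ρ i).continuous) hρc h1 h2 δ hδ
      hsupp G hG
    refine hM.mem_of_tendsto hlim (Eventually.of_forall fun i => ?_)
    -- Substituting $a\mapsto x-a$ exchanges the roles of $\rho_i$ and $f$: the mollification also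
    -- averages translates of $\rho_i$ against $f$.
    have := mem_closure_span_translates μ f f.continuous hf (ρ i) (hρc i) (G i) fun x => by
      rw [hG, ← integral_sub_left_eq_self _ μ x]
      refine integral_congr_ae (ae_of_all _ fun a => ?_)
      simp [mul_comm]
    refine closure_minimal ?_ hM this
    exact Submodule.span_le.2 (by rintro _ ⟨b, rfl⟩; exact hmem i b)
  exact closure_minimal (fun f hf => hcl f hf) hM (dense_hasCompactSupport f)

end Density

variable {d k l j N : ℕ}

/-! ### Tensor products of test functions, and operators in disjoint variables. -/

section Tensor

open MeasureTheory

/-- Smooth compactly supported one-particle functions. -/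
def testFun (d : ℕ) : Submodule ℂ (EuclideanSpace ℝ (Fin d) → ℂ) where
  carrier := {f | ContDiff ℝ ∞ f ∧ HasCompactSupport f}
  add_mem' hf hg := ⟨hf.1.add hg.1, hf.2.add hg.2⟩
  zero_mem' := ⟨contDiff_const, HasCompactSupport.zero⟩
  smul_mem' c _ hf := ⟨hf.1.const_smul c, hf.2.smul_left (f := fun _ => c)⟩

/-- The tensor product `x ↦ ∏ a, f a (x a)` of one-particle test functions. -/
noncomputable def tensor (f : Fin N → testFun d) : Schw d N :=
  HasCompactSupport.toSchwartzMap
    (f := fun x : Config d N => ∏ a, (f a : EuclideanSpace ℝ (Fin d) → ℂ) (x a))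
    (HasCompactSupport.intro (isCompact_univ_pi fun a => (f a).2.2) fun x hx => by
      simp only [Set.mem_univ_pi, not_forall] at hx
      obtain ⟨a, ha⟩ := hx
      exact Finset.prod_eq_zero (Finset.mem_univ a) (image_eq_zero_of_notMem_tsupport ha))
    (contDiff_prod fun a _ => (f a).2.1.comp (contDiff_apply ℝ _ a))

theorem tensor_apply (f : Fin N → testFun d) (x : Config d N) :
    tensor f x = ∏ a, (f a : EuclideanSpace ℝ (Fin d) → ℂ) (x a) := rfl

theorem hasCompactSupport_tensor (f : Fin N → testFun d) : HasCompactSupport (tensor f) :=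
  HasCompactSupport.intro (isCompact_univ_pi fun a => (f a).2.2) fun x hx => by
    simp only [Set.mem_univ_pi, not_forall] at hx
    obtain ⟨a, ha⟩ := hx
    exact Finset.prod_eq_zero (Finset.mem_univ a) (image_eq_zero_of_notMem_tsupport ha)

/-- The translate of a test function. -/
def translate (b : EuclideanSpace ℝ (Fin d)) (f : testFun d) : testFun d :=
  ⟨fun x => (f : EuclideanSpace ℝ (Fin d) → ℂ) (x - b),
    f.2.1.comp (contDiff_id.sub contDiff_const),
    f.2.2.comp_homeomorph (Homeomorph.subRight b)⟩

theorem compSubConst_tensor (f : Fin N → testFun d) (b : Config d N) :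
    compSubConstCLM ℂ b (tensor f) = tensor fun a => translate (b a) (f a) := rfl

/-- A product of one-particle bumps is an approximate identity whose translates are again tensor
products, so `mem_of_approximate_identity` applies to the closed span. -/
theorem span_tensor_closure_eq_top :
    (Submodule.span ℂ (Set.range (tensor : (Fin N → testFun d) → Schw d N))).topologicalClosure
      = ⊤ := by
  refine eq_top_iff.2 fun f _ => ?_
  set M := (Submodule.span ℂ (Set.range (tensor : (Fin N → testFun d) → Schw d N)))
  let b : ℕ → ContDiffBump (0 : EuclideanSpace ℝ (Fin d)) := fun i =>
    ⟨1 / (2 * ((i : ℝ) + 1)), 1 / ((i : ℝ) + 1), by positivity, by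
      have : (0 : ℝ) < (i : ℝ) + 1 := by positivity
      rw [div_lt_div_iff₀ (by positivity) this]
      linarith⟩
  let β : ℕ → testFun d := fun i => ⟨fun x => (b i x : ℂ),
    Complex.ofRealCLM.contDiff.comp (b i).contDiff,
    (b i).hasCompactSupport.comp_left (g := fun x : ℝ => (x : ℂ)) rfl⟩
  let B : ℕ → Config d N → ℝ := fun i x => ∏ a, b i (x a)
  have hB0 : ∀ i x, 0 ≤ B i x := fun i x => Finset.prod_nonneg fun a _ => (b i).nonneg
  have hτ : ∀ i x, tensor (fun _ : Fin N => β i) x = (B i x : ℂ) := fun i x => by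
    simp [tensor_apply, β, B]
  have hBc : ∀ i, Continuous (B i) := fun i =>
    continuous_finsetProd _ fun a _ => (b i).continuous.comp (continuous_apply a)
  have hBs : ∀ i, HasCompactSupport (B i) := fun i => by
    have e : B i = Complex.re ∘ tensor fun _ : Fin N => β i := by
      funext x
      rw [Function.comp_apply, hτ, Complex.ofReal_re]
    rw [e]
    exact (hasCompactSupport_tensor fun _ : Fin N => β i).comp_left rfl
  have hpos : ∀ i, 0 < ∫ x, B i x := fun i => by
    refine (hBc i).integral_pos_of_hasCompactSupport_nonneg_nonzero (hBs i) (hB0 i) (x := 0) ?_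
    refine Finset.prod_ne_zero_iff.2 fun a _ => ?_
    rw [(b i).one_of_mem_closedBall]
    · exact one_ne_zero
    · exact Metric.mem_closedBall_self (b i).rIn_pos.le
  let ρ : ℕ → Schw d N := fun i => (((∫ x, B i x)⁻¹ : ℝ) : ℂ) • tensor (fun _ : Fin N => β i)
  have hρ : ∀ i x, ρ i x = (((∫ x, B i x)⁻¹ * B i x : ℝ) : ℂ) := fun i x => by
    simp [ρ, hτ]
  refine mem_of_approximate_identity volume M.topologicalClosure M.isClosed_topologicalClosure ρ
    (fun i => ?_) (fun i => ?_) (fun i => ?_) (fun i => 1 / ((i : ℝ) + 1))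
    tendsto_one_div_add_atTop_nhds_zero_nat (fun i x hx => ?_) (fun i a => ?_) f
  · exact (hasCompactSupport_tensor _).smul_left (f := fun _ => (((∫ x, B i x)⁻¹ : ℝ) : ℂ))
  · simp only [hρ]
    rw [integral_complex_ofReal, integral_const_mul, inv_mul_cancel₀ (hpos i).ne']
    simp
  · simp only [hρ, Complex.norm_real]
    refine le_of_eq ?_
    calc _ = ∫ a, (∫ x, B i x)⁻¹ * B i a := by
          congr 1
          funext a
          exact Real.norm_of_nonneg (mul_nonneg (inv_nonneg.2 (hpos i).le) (hB0 i a))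
      _ = 1 := by rw [integral_const_mul, inv_mul_cancel₀ (hpos i).ne']
  -- Configurations carry the sup norm, so a large configuration has one coordinate outside the
  -- support of its bump.
  · have hx' : ¬ ‖x‖ < (b i).rOut := not_lt.2 hx
    rw [pi_norm_lt_iff (b i).rOut_pos] at hx'
    push Not at hx'
    obtain ⟨a, ha⟩ := hx'
    have : B i x = 0 := Finset.prod_eq_zero (Finset.mem_univ a)
      ((b i).zero_of_le_dist (by simpa using ha))
    rw [hρ, this]
    simp
  · refine M.le_topologicalClosure ?_
    rw [map_smul, compSubConst_tensor]
    exact M.smul_mem _ (Submodule.subset_span ⟨_, rfl⟩)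

theorem ext_tensor {X : Type} [AddCommGroup X] [Module ℂ X] [TopologicalSpace X] [T2Space X]
    {S T : Schw d N →L[ℂ] X} (h : ∀ f : Fin N → testFun d, S (tensor f) = T (tensor f)) :
    S = T := by
  refine ContinuousLinearMap.ext_on (s := Set.range (tensor : (Fin N → testFun d) → Schw d N))
    ?_ (by rintro _ ⟨f, rfl⟩; exact h f)
  rw [dense_iff_closure_eq, ← Submodule.topologicalClosure_coe, span_tensor_closure_eq_top]
  rfl

theorem slice_tensor (f : Fin N → testFun d) (i : Fin k ↪ Fin N) (x : Config d N) :
    slice i x (tensor f) =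
      (∏ a ∈ (Finset.univ.map i)ᶜ, (f a : EuclideanSpace ℝ (Fin d) → ℂ) (x a)) •
        tensor (f ∘ i) := by
  ext y
  rw [slice_apply, tensor_apply, ← Finset.prod_compl_mul_prod (Finset.univ.map i),
    Finset.prod_map]
  simp only [i.injective.extend_apply, smul_apply, tensor_apply, smul_eq_mul, Function.comp_apply]
  congr 1
  refine Finset.prod_congr rfl fun a ha => ?_
  rw [Function.extend_apply']
  rintro ⟨b, rfl⟩
  simp at ha

theorem extend_tensor (B : Schw d k →L[ℂ] Schw d k) (f : Fin N → testFun d) (i : Fin k ↪ Fin N)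
    (x : Config d N) : extend B i (tensor f) x =
      (∏ a ∈ (Finset.univ.map i)ᶜ, (f a : EuclideanSpace ℝ (Fin d) → ℂ) (x a)) *
        B (tensor (f ∘ i)) (x ∘ i) := by
  rw [extend_apply, slice_tensor, map_smul, smul_apply, smul_eq_mul]

/-- A slice of a tensor product is a scalar multiple of a tensor product, and disjointness keeps the
`B` factor constant along the slice taken for `A`. The resulting expression is symmetric in the two
operators, which is what `extend_comm` uses. -/
theorem extend_extend_tensor (A : Schw d l →L[ℂ] Schw d l) (B : Schw d k →L[ℂ] Schw d k)
    (i : Fin l ↪ Fin N) (i' : Fin k ↪ Fin N) (h : Disjoint (Set.range i) (Set.range i'))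
    (f : Fin N → testFun d) (x : Config d N) :
    extend A i (extend B i' (tensor f)) x =
      (∏ a ∈ (Finset.univ.map i)ᶜ \ Finset.univ.map i',
          (f a : EuclideanSpace ℝ (Fin d) → ℂ) (x a)) *
        (A (tensor (f ∘ i)) (x ∘ i) * B (tensor (f ∘ i')) (x ∘ i')) := by
  have hne : ∀ a b, i a ≠ i' b := fun a b e =>
    Set.disjoint_left.1 h ⟨a, rfl⟩ (e ▸ ⟨b, rfl⟩)
  have hs : slice i x (extend B i' (tensor f)) =
      ((∏ a ∈ (Finset.univ.map i)ᶜ \ Finset.univ.map i',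
          (f a : EuclideanSpace ℝ (Fin d) → ℂ) (x a)) *
        B (tensor (f ∘ i')) (x ∘ i')) • tensor (f ∘ i) := by
    ext y
    have e1 : Function.extend i y x ∘ i' = x ∘ i' := by
      funext b
      rw [Function.comp_apply, Function.extend_apply']
      · rfl
      · rintro ⟨a, ha⟩
        exact hne a b ha
    have e2 : (Finset.univ.map i')ᶜ =
        ((Finset.univ.map i)ᶜ \ Finset.univ.map i') ∪ Finset.univ.map i := by
      ext a
      simp only [Finset.mem_compl, Finset.mem_map, Finset.mem_univ, true_and, Finset.mem_union,
        Finset.mem_sdiff, not_exists]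
      constructor
      · intro h1
        by_cases h2 : ∃ b, i b = a
        · exact Or.inr h2
        · exact Or.inl ⟨not_exists.1 h2, h1⟩
      · rintro (⟨-, h1⟩ | ⟨b, rfl⟩) c hc
        · exact h1 c hc
        · exact hne b c hc.symm
    have e3 : Disjoint ((Finset.univ.map i)ᶜ \ Finset.univ.map i') (Finset.univ.map i) :=
      Finset.disjoint_left.2 fun a h1 h2 =>
        Finset.mem_compl.1 (Finset.mem_sdiff.1 h1).1 h2
    rw [slice_apply, extend_tensor, e1, e2, Finset.prod_union e3, Finset.prod_map]
    simp only [i.injective.extend_apply, smul_apply, tensor_apply, smul_eq_mul,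
      Function.comp_apply]
    rw [mul_right_comm]
    congr 2
    refine Finset.prod_congr rfl fun a ha => ?_
    rw [Function.extend_apply']
    rintro ⟨b, rfl⟩
    simp at ha
  rw [extend_apply, hs, map_smul, smul_apply, smul_eq_mul]
  ring

/-- Operators acting in disjoint sets of variables commute. -/
theorem extend_comm (A : Schw d l →L[ℂ] Schw d l) (B : Schw d k →L[ℂ] Schw d k)
    (i : Fin l ↪ Fin N) (i' : Fin k ↪ Fin N) (h : Disjoint (Set.range i) (Set.range i')) :
    extend A i ∘L extend B i' = extend B i' ∘L extend A i := by
  refine ext_tensor fun f => ?_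
  ext x
  rw [ContinuousLinearMap.comp_apply, ContinuousLinearMap.comp_apply,
    extend_extend_tensor _ _ _ _ h, extend_extend_tensor _ _ _ _ h.symm]
  have : (Finset.univ.map i)ᶜ \ Finset.univ.map i' =
      (Finset.univ.map i')ᶜ \ Finset.univ.map i := by
    ext a
    simp only [Finset.mem_sdiff, Finset.mem_compl, and_comm]
  rw [this, mul_comm (A _ _)]

end Tensor

/-! ### Functoriality of the extension, and bosonic symmetry. -/

section Algebra

theorem slice_slice (p : Fin k ↪ Fin N) (i : Fin l ↪ Fin k) (x : Config d N) (f : Schw d N) :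
    slice i (x ∘ p) (slice p x f) = slice (i.trans p) x f := by
  ext y
  rw [slice_apply, slice_apply, slice_apply]
  congr 1
  funext a
  by_cases h : ∃ b, p b = a
  · obtain ⟨b, rfl⟩ := h
    rw [p.injective.extend_apply]
    by_cases h' : ∃ c, i c = b
    · obtain ⟨c, rfl⟩ := h'
      rw [i.injective.extend_apply]
      exact ((i.trans p).injective.extend_apply y x c).symm
    · rw [Function.extend_apply' _ _ _ h', Function.extend_apply', Function.comp_apply]
      rintro ⟨c, hc⟩
      exact h' ⟨c, p.injective hc⟩
  · rw [Function.extend_apply' _ _ _ h, Function.extend_apply']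
    rintro ⟨c, hc⟩
    exact h ⟨i c, hc⟩

/-- With `extend_comp`, this makes the extension of a contraction along $p$ a sum of products
$A_iB_{i'}$ of operators on $N$ particles. -/
theorem extend_extend (A : Schw d l →L[ℂ] Schw d l) (i : Fin l ↪ Fin k) (p : Fin k ↪ Fin N) :
    extend (extend A i) p = extend A (i.trans p) := by
  ext f x
  rw [extend_apply, extend_apply, slice_slice, extend_apply]
  rfl

theorem extend_comp (A B : Schw d k →L[ℂ] Schw d k) (p : Fin k ↪ Fin N) :
    extend (A ∘L B) p = extend A p ∘L extend B p := by
  ext f x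
  rw [extend_apply, ContinuousLinearMap.comp_apply, ContinuousLinearMap.comp_apply, extend_apply]
  congr 2
  ext y
  have e : Function.extend p y x ∘ p = y := funext fun b => p.injective.extend_apply y x b
  rw [slice_apply, extend_apply, e]
  congr 2
  ext z
  rw [slice_apply, slice_apply]
  congr 1
  funext a
  by_cases h : ∃ b, p b = a
  · obtain ⟨b, rfl⟩ := h
    simp [p.injective.extend_apply]
  · simp [Function.extend_apply' _ _ _ h]

/-- `extend` as a linear map. -/
noncomputable def extendLinear (i : Fin k ↪ Fin N) :
    (Schw d k →L[ℂ] Schw d k) →ₗ[ℂ] (Schw d N →L[ℂ] Schw d N) where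
  toFun B := extend B i
  map_add' _ _ := rfl
  map_smul' _ _ := rfl

theorem extendLinear_apply (i : Fin k ↪ Fin N) (B : Schw d k →L[ℂ] Schw d k) :
    extendLinear i B = extend B i := rfl

theorem symmetrize_apply (f : Schw d k) :
    symmetrize d k f = ((k.factorial : ℂ)⁻¹) • ∑ σ : Equiv.Perm (Fin k), permute σ f := by
  simp [symmetrize]

theorem symmetrize_of_mem {f : Schw d k} (hf : f ∈ bosonic d k) : symmetrize d k f = f := by
  rw [symmetrize_apply, Finset.sum_congr rfl fun σ _ => hf σ]
  simp only [Finset.sum_const, Finset.card_univ, Fintype.card_perm, Fintype.card_fin]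
  rw [← Nat.cast_smul_eq_nsmul ℂ, smul_smul, inv_mul_cancel₀, one_smul]
  exact_mod_cast k.factorial_ne_zero

theorem symmetrize_permute (σ : Equiv.Perm (Fin k)) (f : Schw d k) :
    symmetrize d k (permute σ f) = symmetrize d k f := by
  rw [symmetrize_apply, symmetrize_apply]
  simp only [permute_permute]
  congr 1
  exact Equiv.sum_comp (Equiv.mulRight σ) fun π => permute π f

theorem symProj_of_mem (f : bosonic d k) : symProj d k f = f :=
  Subtype.ext (symmetrize_of_mem f.2)

namespace Op

theorem full_apply (A : Op d k) (f : Schw d k) : A.full f = A.toCLM (symProj d k f) := rfl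

theorem full_apply_of_mem (A : Op d k) (f : bosonic d k) : A.full f = A.toCLM f := by
  rw [full_apply, symProj_of_mem]

theorem full_mem (A : Op d k) (f : Schw d k) : A.full f ∈ bosonic d k :=
  (A.toCLM (symProj d k f)).2

theorem full_permute (A : Op d k) (σ : Equiv.Perm (Fin k)) (f : Schw d k) :
    A.full (permute σ f) = A.full f := by
  rw [full_apply, full_apply]
  congr 2
  exact Subtype.ext (symmetrize_permute σ f)

theorem ext_apply {A B : Op d k} (h : ∀ f : bosonic d k, ∀ x,
    (A.toCLM f : Schw d k) x = (B.toCLM f : Schw d k) x) : A = B :=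
  ContinuousLinearMap.ext fun f => Subtype.ext (SchwartzMap.ext (h f))

theorem add_apply (A B : Op d k) (f : bosonic d k) :
    (A + B).toCLM f = A.toCLM f + B.toCLM f := rfl

theorem sub_apply (A B : Op d k) (f : bosonic d k) :
    (A - B).toCLM f = A.toCLM f - B.toCLM f := rfl

theorem smul_apply (c : ℂ) (A : Op d k) (f : bosonic d k) :
    (c • A).toCLM f = c • A.toCLM f := rfl

theorem zero_apply (f : bosonic d k) : (0 : Op d k).toCLM f = 0 := rfl

/-- Evaluation of an operator at a function and at a point. -/
noncomputable def evalAt (f : bosonic d k) (x : Config d k) : Op d k →ₗ[ℂ] ℂ where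
  toFun A := (A.toCLM f : Schw d k) x
  map_add' _ _ := rfl
  map_smul' _ _ := rfl

end Op

theorem slice_perm_trans (i : Fin k ↪ Fin N) (σ : Equiv.Perm (Fin k)) (x : Config d N)
    (f : Schw d N) :
    slice (σ.toEmbedding.trans i) x f = permute σ⁻¹ (slice i x f) := by
  ext y
  rw [permute_apply, slice_apply, slice_apply]
  congr 1
  funext a
  by_cases h : ∃ b, i b = a
  · obtain ⟨b, rfl⟩ := h
    have e : i b = (σ.toEmbedding.trans i) (σ⁻¹ b) := by simp
    rw [i.injective.extend_apply, e, (σ.toEmbedding.trans i).injective.extend_apply]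
    rfl
  · rw [Function.extend_apply' _ _ _ h, Function.extend_apply']
    rintro ⟨b, hb⟩
    exact h ⟨σ b, hb⟩

/-- A permutation of the slice variables is induced by the permutation of all $N$ variables that is
supported on the range of `i`. -/
theorem slice_mem {f : Schw d N} (hf : f ∈ bosonic d N) (i : Fin k ↪ Fin N) (x : Config d N) :
    slice i x f ∈ bosonic d k := by
  intro σ
  ext y
  rw [permute_apply, slice_apply, slice_apply]
  conv_rhs => rw [← hf (σ.viaFintypeEmbedding i), permute_apply]
  congr 1
  funext a
  by_cases h : a ∈ Set.range i
  · obtain ⟨b, rfl⟩ := h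
    rw [Function.comp_apply, Equiv.Perm.viaFintypeEmbedding_apply_image, i.injective.extend_apply,
      i.injective.extend_apply]
    rfl
  · rw [Function.comp_apply, Equiv.Perm.viaFintypeEmbedding_apply_notMem_range _ _ h,
      Function.extend_apply' _ _ _ h, Function.extend_apply' _ _ _ h]

/-- `A.full` symmetrizes its input and has symmetric output, so the order of the tuple is invisible.
This is what lets common entries be moved to chosen positions. -/
theorem extend_full_perm (A : Op d k) (i : Fin k ↪ Fin N) (σ : Equiv.Perm (Fin k)) :
    extend A.full (σ.toEmbedding.trans i) = extend A.full i := by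
  ext f x
  rw [extend_apply, extend_apply, slice_perm_trans, A.full_permute]
  exact congrArg (fun g : Schw d k => g (x ∘ i)) (A.full_mem _ σ)

end Algebra

/-! ### Polarization and injectivity of the embeddings. -/

section Injectivity

/-- Ryser's formula for the permanent. -/
theorem sum_neg_one_pow_mul_prod_sum_compl {R : Type} [CommRing R] (c : Fin k → Fin k → R) :
    ∑ S : Finset (Fin k), (-1) ^ S.card * ∏ a, ∑ i ∈ Sᶜ, c i a =
      ∑ π : Equiv.Perm (Fin k), ∏ a, c (π a) a := by
  -- Expanding the product gives the maps $\varphi$ whose image avoids $S$.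
  have h1 : ∀ S : Finset (Fin k), ∏ a, ∑ i ∈ Sᶜ, c i a =
      ∑ φ : Fin k → Fin k, if S ⊆ (Finset.univ.image φ)ᶜ then ∏ a, c (φ a) a else 0 := by
    intro S
    rw [Finset.prod_univ_sum, ← Finset.sum_filter]
    refine Finset.sum_congr ?_ fun _ _ => rfl
    ext φ
    simp only [Fintype.mem_piFinset, Finset.mem_compl, Finset.mem_filter, Finset.mem_univ,
      true_and, Finset.subset_iff, Finset.mem_image, not_exists]
    exact ⟨fun h x hx a e => h a (e ▸ hx), fun h a ha => h ha a rfl⟩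
  simp only [h1, Finset.mul_sum]
  rw [Finset.sum_comm]
  -- Inclusion-exclusion: the signs over the subsets of the complement of the image cancel unless
  -- $\varphi$ is onto, hence bijective.
  have h2 : ∀ φ : Fin k → Fin k, ∑ S : Finset (Fin k),
      (-1 : R) ^ S.card * (if S ⊆ (Finset.univ.image φ)ᶜ then ∏ a, c (φ a) a else 0) =
      if Function.Bijective φ then ∏ a, c (φ a) a else 0 := by
    intro φ
    have h3 : ∑ S ∈ ((Finset.univ.image φ)ᶜ).powerset, (-1 : R) ^ S.card =
        if (Finset.univ.image φ)ᶜ = ∅ then 1 else 0 := by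
      have := congrArg (Int.cast : ℤ → R)
        (Finset.sum_powerset_neg_one_pow_card (x := (Finset.univ.image φ)ᶜ))
      push_cast at this
      rw [this]
    have h4 : (Finset.univ.image φ)ᶜ = ∅ ↔ Function.Bijective φ := by
      rw [Finset.compl_eq_empty_iff, ← Finite.surjective_iff_bijective,
        Finset.eq_univ_iff_forall]
      simp [Function.Surjective]
    calc _ = (∑ S ∈ ((Finset.univ.image φ)ᶜ).powerset, (-1 : R) ^ S.card) * ∏ a, c (φ a) a := by
          simp only [mul_ite, mul_zero, Finset.sum_mul]
          rw [← Finset.sum_filter]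
          refine Finset.sum_congr ?_ fun _ _ => rfl
          ext S
          simp
      _ = _ := by
          rw [h3, ite_mul, one_mul, zero_mul]
          simp only [h4]
  simp only [h2]
  rw [← Finset.sum_filter]
  symm
  refine Finset.sum_bij (fun (π : Equiv.Perm (Fin k)) _ => (π : Fin k → Fin k)) ?_ ?_ ?_ ?_
  · intro π _
    exact Finset.mem_filter.2 ⟨Finset.mem_univ _, π.bijective⟩
  · intro π _ π' _ h
    exact Equiv.coe_fn_injective h
  · intro φ hφ
    exact ⟨Equiv.ofBijective φ (Finset.mem_filter.1 hφ).2, Finset.mem_univ _, rfl⟩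
  · intro _ _
    rfl

/-- The tensor power of a test function. -/
noncomputable def power (k : ℕ) (f : testFun d) : bosonic d k :=
  ⟨tensor fun _ => f, fun π => by
    ext x
    rw [permute_apply, tensor_apply, tensor_apply]
    exact Equiv.prod_comp π fun a => (f : EuclideanSpace ℝ (Fin d) → ℂ) (x a)⟩

/-- Polarization: at a point $x$ the symmetrized product is a permanent with entries $f_i(x_a)$, and
Ryser's formula writes it through $N$-fold powers of partial sums, here with $N=k$. -/
theorem symProj_tensor (f : Fin k → testFun d) : symProj d k (tensor f) =
    ((k.factorial : ℂ)⁻¹) • ∑ S : Finset (Fin k), ((-1 : ℂ) ^ S.card) •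
      power k (∑ i ∈ Sᶜ, f i) := by
  refine Subtype.ext (SchwartzMap.ext fun x => ?_)
  have e1 : (symProj d k (tensor f) : Schw d k) x = ((k.factorial : ℂ)⁻¹) *
      ∑ σ : Equiv.Perm (Fin k), ∏ a, (f a : EuclideanSpace ℝ (Fin d) → ℂ) (x (σ a)) := by
    change symmetrize d k (tensor f) x = _
    rw [symmetrize_apply, smul_apply, sum_apply]
    rfl
  have e2 : ∑ σ : Equiv.Perm (Fin k), ∏ a, (f a : EuclideanSpace ℝ (Fin d) → ℂ) (x (σ a)) =
      ∑ σ : Equiv.Perm (Fin k), ∏ a, (f (σ a) : EuclideanSpace ℝ (Fin d) → ℂ) (x a) := by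
    rw [← Equiv.sum_comp (Equiv.inv (Equiv.Perm (Fin k)))]
    refine Finset.sum_congr rfl fun σ _ => ?_
    rw [← Equiv.prod_comp σ]
    simp
  rw [e1, e2, ← sum_neg_one_pow_mul_prod_sum_compl
    fun i a => (f i : EuclideanSpace ℝ (Fin d) → ℂ) (x a)]
  simp only [Submodule.coe_smul, Submodule.coe_sum, smul_apply, sum_apply, smul_eq_mul, power,
    tensor_apply, Finset.sum_apply]

/-- By polarization `D` kills all symmetrized tensor products, and these determine
$D\circ\mathrm{Sym}_k$ by density. -/
theorem Op.eq_zero_of_power {D : Op d k} (h : ∀ f : testFun d, D.toCLM (power k f) = 0) :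
    D = 0 := by
  have h1 : D.toCLM ∘L symProj d k = 0 := ext_tensor fun f => by
    rw [ContinuousLinearMap.comp_apply, symProj_tensor]
    simp [h]
  refine ContinuousLinearMap.ext fun f => ?_
  have := congrArg (fun T : Schw d k →L[ℂ] bosonic d k => T (f : Schw d k)) h1
  rw [ContinuousLinearMap.comp_apply, symProj_of_mem] at this
  exact this

/-- Induction on the number of coordinates of $y$ different from $p$. Put $y$ into the first $k$
slots of $x$ and $p$ into the others. A tuple that meets every slot with a value other than $p$
contributes $f(p)^{N-k}g(y)$, by symmetry of $g$; every other tuple sees fewer such values and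
contributes $0$ by induction. The vanishing sum is thus a positive multiple of $f(p)^{N-k}g(y)$. -/
theorem eq_zero_of_sum_embedding {E : Type} {g : (Fin k → E) → ℂ}
    (hsym : ∀ (σ : Equiv.Perm (Fin k)) y, g (y ∘ σ) = g y) {f : E → ℂ} {p : E} (hp : f p ≠ 0)
    (hkN : k ≤ N)
    (h : ∀ x : Fin N → E, ∑ i : Fin k ↪ Fin N,
      (∏ a ∈ (Finset.univ.map i)ᶜ, f (x a)) * g (x ∘ i) = 0) (y : Fin k → E) : g y = 0 := by
  classical
  induction hm : (Finset.univ.filter fun b => y b ≠ p).card using Nat.strong_induction_on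
    generalizing y with
  | _ m ih =>
  set c : Fin k ↪ Fin N := Fin.castLEEmb hkN with hc
  set x : Fin N → E := Function.extend c y fun _ => p with hx
  have hxc : ∀ b, x (c b) = y b := fun b => c.injective.extend_apply _ _ b
  have hxn : ∀ a, x a ≠ p → ∃ b, c b = a ∧ y b ≠ p := by
    intro a ha
    by_cases h' : ∃ b, c b = a
    · obtain ⟨b, rfl⟩ := h'
      exact ⟨b, rfl, hxc b ▸ ha⟩
    · exact absurd (Function.extend_apply' _ _ _ h') ha
  have key : ∀ i : Fin k ↪ Fin N, (∏ a ∈ (Finset.univ.map i)ᶜ, f (x a)) * g (x ∘ i) =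
      if ∀ b, y b ≠ p → ∃ b', i b' = c b then f p ^ (N - k) * g y else 0 := by
    intro i
    split_ifs with hi
    · congr 1
      · have : ∀ a ∈ (Finset.univ.map i)ᶜ, f (x a) = f p := by
          intro a ha
          congr 1
          by_contra hne
          obtain ⟨b, rfl, hb⟩ := hxn a hne
          obtain ⟨b', hb'⟩ := hi b hb
          simp [← hb'] at ha
        rw [Finset.prod_congr rfl this, Finset.prod_const, Finset.card_compl, Finset.card_map]
        simp
      · choose! s hs using hi
        -- The partial matching `s` of the coordinates different from `p` extends to a permutation;
        -- after reordering by it, `x ∘ i` becomes `y`.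
        obtain ⟨σ, hσ⟩ := Finset.exists_equiv_extend_of_card_eq (α := Fin k) (β := Fin k)
          (t := Finset.univ) (by simp) (s := Finset.univ.filter fun b => y b ≠ p) (f := s)
          (Finset.subset_univ _) (fun b hb b' hb' e => by
            have h1 := hs b (by simpa using hb)
            have h2 := hs b' (by simpa using hb')
            rw [e, h2] at h1
            exact (c.injective h1).symm)
        let τ : Equiv.Perm (Fin k) := σ.trans (Equiv.subtypeUnivEquiv fun a => Finset.mem_univ a)
        have hτ : ∀ b, y b ≠ p → i (τ b) = c b := fun b hb => by
          rw [← hs b hb]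
          exact congrArg i (hσ b (by simpa using hb))
        rw [← hsym τ]
        congr 1
        funext b
        by_cases hb : y b = p
        · by_contra hne
          rw [hb] at hne
          obtain ⟨b', hb', hy⟩ := hxn _ hne
          rw [Function.comp_apply, ← hτ b' hy] at *
          have := τ.injective (i.injective hb')
          exact hy (this ▸ hb)
        · change x (i (τ b)) = y b
          rw [hτ b hb, hxc]
    -- Here `i` misses a slot `c b` with `y b ≠ p`, so `i` maps the non-`p` positions of `x ∘ i`
    -- injectively into a proper subset of those slots.
    · rw [ih _ ?_ (x ∘ i) rfl, mul_zero]
      push Not at hi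
      obtain ⟨b, hb, hbi⟩ := hi
      rw [← hm, ← Finset.card_map i, ← Finset.card_map c]
      refine Finset.card_lt_card ⟨?_, fun hsub => ?_⟩
      · intro a ha
        obtain ⟨b', hb', rfl⟩ := Finset.mem_map.1 ha
        obtain ⟨b'', e, hy⟩ := hxn (i b') (Finset.mem_filter.1 hb').2
        rw [← e]
        simpa using hy
      · have : c b ∈ Finset.map i (Finset.univ.filter fun b' => (x ∘ i) b' ≠ p) :=
          hsub (by simpa using hb)
        obtain ⟨b', -, e⟩ := Finset.mem_map.1 this
        exact hbi b' e
  have := h x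
  simp only [key] at this
  rw [← Finset.sum_filter, Finset.sum_const, nsmul_eq_mul] at this
  have hcard : (Finset.univ.filter fun i : Fin k ↪ Fin N =>
      ∀ b, y b ≠ p → ∃ b', i b' = c b).card ≠ 0 := by
    rw [Finset.card_ne_zero]
    exact ⟨c, by simp⟩
  rcases mul_eq_zero.1 this with h1 | h1
  · exact absurd (by exact_mod_cast h1) hcard
  · exact (mul_eq_zero.1 h1).resolve_left (pow_ne_zero _ hp)

theorem embed_apply (A : Op d k) (F : bosonic d N) :
    ((embed N A).toCLM F : Schw d N) =
      (tupleCoeff k N : ℂ) • ∑ i : Fin k ↪ Fin N, extend A.full i F := by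
  change embedFull N A F = _
  simp [embedFull]

theorem tupleCoeff_ne_zero (h : k ≤ N) : tupleCoeff k N ≠ 0 := by
  have : Nonempty (Fin k ↪ Fin N) := ⟨Fin.castLEEmb h⟩
  exact inv_ne_zero (by exact_mod_cast Fintype.card_ne_zero)

/-- Evaluated on $f^{\otimes N}$, the vanishing of the embedded operator is exactly the hypothesis
of `eq_zero_of_sum_embedding` for $g=D f^{\otimes k}$. -/
theorem embed_eq_zero (hk : 1 ≤ k) (hkN : k ≤ N) {D : Op d k} (h : embed N D = 0) : D = 0 := by
  refine Op.eq_zero_of_power fun f => Subtype.ext (SchwartzMap.ext fun y => ?_)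
  change (D.toCLM (power k f) : Schw d k) y = 0
  -- If $f$ vanishes identically there is no base point $p$, but then $f^{\otimes k}=0$ because
  -- $k\ge1$.
  by_cases hf : ∀ p, (f : EuclideanSpace ℝ (Fin d) → ℂ) p = 0
  · have : power k f = 0 := Subtype.ext (SchwartzMap.ext fun x =>
      Finset.prod_eq_zero (Finset.mem_univ (⟨0, hk⟩ : Fin k)) (hf _))
    rw [this, map_zero]
    rfl
  push Not at hf
  obtain ⟨p, hp⟩ := hf
  refine eq_zero_of_sum_embedding (g := (D.toCLM (power k f) : Schw d k))
    (f := (f : EuclideanSpace ℝ (Fin d) → ℂ)) (fun σ y => ?_) hp hkN (fun x => ?_) y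
  · exact congrArg (fun u : Schw d k => u y) ((D.toCLM (power k f)).2 σ)
  · have h1 : ((embed N D).toCLM (power N f) : Schw d N) x = 0 := by rw [h]; rfl
    rw [embed_apply, smul_apply, sum_apply, smul_eq_mul] at h1
    have h2 := (mul_eq_zero.1 h1).resolve_left (by exact_mod_cast tupleCoeff_ne_zero hkN)
    rw [← h2]
    refine Finset.sum_congr rfl fun i _ => ?_
    exact (extend_tensor D.full _ i x).symm ▸ by rw [← D.full_apply_of_mem]; rfl

theorem embed_sub (A B : Op d k) : embed N (A - B) = embed N A - embed N B := by
  refine Op.ext_apply fun f x => ?_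
  rw [Op.sub_apply, Submodule.coe_sub, embed_apply, embed_apply, embed_apply, ← smul_sub,
    ← Finset.sum_sub_distrib]
  rfl

theorem embed_injective (hk : 1 ≤ k) (hkN : k ≤ N) :
    Function.Injective (embed N : Op d k → Op d N) := fun A B h =>
  sub_eq_zero.1 (embed_eq_zero hk hkN (by rw [embed_sub, h, sub_self]))

end Injectivity

/-! ### Skew-adjointness of extensions and commutators. -/

section Skew

open MeasureTheory

theorem integral_permute (σ : Equiv.Perm (Fin k)) (F : Config d k → ℂ) :
    ∫ x, F (x ∘ σ) = ∫ x, F x := by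
  have := (volume_measurePreserving_piCongrLeft
    (fun _ : Fin k => EuclideanSpace ℝ (Fin d)) σ⁻¹).integral_comp' F
  rw [← this]
  congr 1
  funext x
  congr 1
  funext a
  have := Equiv.piCongrLeft_apply_apply (fun _ : Fin k => EuclideanSpace ℝ (Fin d)) σ⁻¹ x (σ a)
  have hσ : σ⁻¹ (σ a) = a := σ.symm_apply_apply a
  rw [hσ] at this
  exact this.symm

/-- The configuration with coordinates `q.1` in the range of `i` and `q.2` elsewhere. -/
noncomputable def glue (i : Fin k ↪ Fin N) :
    (Config d k × (((Set.range i)ᶜ : Set (Fin N)) → EuclideanSpace ℝ (Fin d))) ≃ᵐ Config d N :=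
  (MeasurableEquiv.sumPiEquivProdPi fun _ => EuclideanSpace ℝ (Fin d)).symm.trans
    (MeasurableEquiv.piCongrLeft (fun _ => EuclideanSpace ℝ (Fin d))
      ((Equiv.sumCongr (Equiv.ofInjective i i.injective) (Equiv.refl _)).trans
        (Equiv.Set.sumCompl (Set.range i))))

theorem glue_apply_embedding (i : Fin k ↪ Fin N) (q) (b : Fin k) :
    glue (d := d) i q (i b) = q.1 b :=
  Equiv.piCongrLeft_apply_apply (fun _ => EuclideanSpace ℝ (Fin d))
      ((Equiv.sumCongr (Equiv.ofInjective i i.injective) (Equiv.refl _)).trans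
        (Equiv.Set.sumCompl (Set.range i))) _ (Sum.inl b)

theorem glue_apply_compl (i : Fin k ↪ Fin N) (q) (a : ((Set.range i)ᶜ : Set (Fin N))) :
    glue (d := d) i q a = q.2 a :=
  Equiv.piCongrLeft_apply_apply (fun _ => EuclideanSpace ℝ (Fin d))
      ((Equiv.sumCongr (Equiv.ofInjective i i.injective) (Equiv.refl _)).trans
        (Equiv.Set.sumCompl (Set.range i))) _ (Sum.inr a)

theorem measurePreserving_glue (i : Fin k ↪ Fin N) : MeasurePreserving (glue (d := d) i) :=
  (volume_measurePreserving_piCongrLeft (fun _ => EuclideanSpace ℝ (Fin d)) _).comp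
    (volume_measurePreserving_sumPiEquivProdPi_symm fun _ => EuclideanSpace ℝ (Fin d))

theorem glue_eq_extend (i : Fin k ↪ Fin N) (y : Config d k)
    (z : ((Set.range i)ᶜ : Set (Fin N)) → EuclideanSpace ℝ (Fin d)) :
    glue i (y, z) = Function.extend i y (glue i (0, z)) := by
  funext a
  by_cases h : a ∈ Set.range i
  · obtain ⟨b, rfl⟩ := h
    rw [glue_apply_embedding, i.injective.extend_apply]
  · rw [Function.extend_apply' _ _ _ h]
    exact (glue_apply_compl i (y, z) ⟨a, h⟩).trans (glue_apply_compl i (0, z) ⟨a, h⟩).symm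

theorem integral_glue (i : Fin k ↪ Fin N) {H : Config d N → ℂ} (hH : Integrable H) :
    ∫ x, H x = ∫ z, ∫ y, H (glue i (y, z)) := by
  rw [← (measurePreserving_glue i).integral_comp' H]
  refine integral_prod_symm _ ?_
  exact (measurePreserving_glue i).integrable_comp_of_integrable hH

/-- In glued coordinates the extension acts as `B` in $y$, with $z$ a parameter; this is the form
needed for Fubini. -/
theorem extend_glue (B : Schw d k →L[ℂ] Schw d k) (i : Fin k ↪ Fin N) (f : Schw d N)
    (y : Config d k) (z : ((Set.range i)ᶜ : Set (Fin N)) → EuclideanSpace ℝ (Fin d)) :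
    extend B i f (glue i (y, z)) = B (slice i (glue i (0, z)) f) y := by
  have h1 : glue i (y, z) ∘ i = y := funext fun b => glue_apply_embedding i (y, z) b
  rw [extend_apply, h1]
  congr 2
  ext w
  rw [slice_apply, slice_apply]
  congr 1
  rw [← glue_eq_extend, glue_eq_extend i y z]
  funext a
  by_cases h : a ∈ Set.range i
  · obtain ⟨b, rfl⟩ := h
    rw [i.injective.extend_apply, glue_apply_embedding]
  · rw [Function.extend_apply' _ _ _ h, Function.extend_apply' _ _ _ h]
    exact (glue_apply_compl i (0, z) ⟨a, h⟩).trans (glue_apply_compl i (w, z) ⟨a, h⟩).symm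

/-- Formal skew-adjointness on the whole Schwartz space. -/
def IsSkewOn (T : Schw d k →L[ℂ] Schw d k) : Prop :=
  ∀ f g : Schw d k, ∫ x, starRingEnd ℂ (f x) * T g x = -∫ x, starRingEnd ℂ (T f x) * g x

theorem integral_conj_symmetrize_mul (f : Schw d k) (h : bosonic d k) :
    ∫ x, starRingEnd ℂ (symmetrize d k f x) * (h : Schw d k) x =
      ∫ x, starRingEnd ℂ (f x) * (h : Schw d k) x := by
  have e : ∀ x, starRingEnd ℂ (symmetrize d k f x) * (h : Schw d k) x =
      ((k.factorial : ℂ)⁻¹) * ∑ σ : Equiv.Perm (Fin k),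
        starRingEnd ℂ (permute σ f x) * (h : Schw d k) x := fun x => by
    rw [symmetrize_apply, smul_apply, sum_apply, smul_eq_mul, map_mul, map_sum, mul_assoc,
      Finset.sum_mul]
    simp
  simp only [e]
  rw [integral_const_mul, integral_finsetSum _ fun σ _ => integrable_conj_mul _ _]
  have e2 : ∀ σ : Equiv.Perm (Fin k), ∫ x, starRingEnd ℂ (permute σ f x) * (h : Schw d k) x =
      ∫ x, starRingEnd ℂ (f x) * (h : Schw d k) x := fun σ => by
    rw [← integral_permute σ fun x => starRingEnd ℂ (f x) * (h : Schw d k) x]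
    congr 1
    funext x
    rw [permute_apply, ← permute_apply σ (h : Schw d k) x, h.2 σ]
  simp only [e2, Finset.sum_const, Finset.card_univ, Fintype.card_perm, Fintype.card_fin,
    nsmul_eq_mul]
  rw [← mul_assoc, inv_mul_cancel₀ (by exact_mod_cast k.factorial_ne_zero), one_mul]

theorem integral_conj_mul_comm (f g : Schw d k) :
    ∫ x, starRingEnd ℂ (f x) * g x = starRingEnd ℂ (∫ x, starRingEnd ℂ (g x) * f x) := by
  rw [← integral_conj]
  congr 1
  funext x
  simp [mul_comm]

/-- Symmetrization is invisible when paired with a symmetric function, so it can be inserted on one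
side, the skewness of `A` used on bosonic functions, and symmetrization removed on the other side
after a conjugation. -/
theorem Op.IsSkewAdjoint.full {A : Op d k} (hA : A.IsSkewAdjoint) : IsSkewOn A.full := by
  intro f g
  have h1 := integral_conj_symmetrize_mul f (A.toCLM (symProj d k g))
  have h2 := integral_conj_symmetrize_mul g (A.toCLM (symProj d k f))
  have h3 := hA (symProj d k f) (symProj d k g)
  calc _ = _ := h1.symm
    _ = _ := h3
    _ = _ := by
      congr 1
      rw [integral_conj_mul_comm]
      refine (congrArg (starRingEnd ℂ) h2).trans ?_
      rw [← integral_conj_mul_comm]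
      rfl

/-- Fubini: for fixed values of the untouched variables this is the skewness of `B` on slices. -/
theorem IsSkewOn.extend {B : Schw d k →L[ℂ] Schw d k} (hB : IsSkewOn B) (i : Fin k ↪ Fin N) :
    IsSkewOn (extend B i) := by
  intro f g
  rw [integral_glue i (integrable_conj_mul _ _), integral_glue i (integrable_conj_mul _ _),
    ← integral_neg]
  congr 1
  funext z
  have e : ∀ (f : Schw d N) y, f (glue i (y, z)) = slice i (glue i (0, z)) f y := fun f y => by
    rw [slice_apply, glue_eq_extend]
  simp only [extend_glue]
  simp only [e]
  exact hB _ _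

theorem IsSkewOn.comp_sub_comp {S T : Schw d k →L[ℂ] Schw d k} (hS : IsSkewOn S)
    (hT : IsSkewOn T) : IsSkewOn (S ∘L T - T ∘L S) := by
  intro f g
  have e : ∀ h x, (S ∘L T - T ∘L S) h x = S (T h) x - T (S h) x := fun h x => rfl
  simp only [e, mul_sub, map_sub, sub_mul]
  rw [integral_sub (integrable_conj_mul _ _) (integrable_conj_mul _ _),
    integral_sub (integrable_conj_mul _ _) (integrable_conj_mul _ _),
    hS f (T g), hT (S f) g, hT f (S g), hS (T f) g]
  ring

theorem IsSkewOn.add {S T : Schw d k →L[ℂ] Schw d k} (hS : IsSkewOn S)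
    (hT : IsSkewOn T) : IsSkewOn (S + T) := by
  intro f g
  have e : ∀ h x, (S + T) h x = S h x + T h x := fun h x => rfl
  simp only [e, mul_add, map_add, add_mul]
  rw [integral_add (integrable_conj_mul _ _) (integrable_conj_mul _ _),
    integral_add (integrable_conj_mul _ _) (integrable_conj_mul _ _), hS, hT]
  ring

theorem IsSkewOn.zero : IsSkewOn (0 : Schw d k →L[ℂ] Schw d k) := by
  intro f g
  simp

theorem IsSkewOn.sum {ι : Type} (s : Finset ι) {T : ι → Schw d k →L[ℂ] Schw d k}
    (hT : ∀ i ∈ s, IsSkewOn (T i)) : IsSkewOn (∑ i ∈ s, T i) :=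
  Finset.sum_induction _ _ (fun _ _ => IsSkewOn.add) IsSkewOn.zero hT

theorem IsSkewOn.smul {T : Schw d k →L[ℂ] Schw d k} (hT : IsSkewOn T) (c : ℝ) :
    IsSkewOn ((c : ℂ) • T) := by
  intro f g
  have e : ∀ h x, ((c : ℂ) • T) h x = (c : ℂ) * T h x := fun h x => rfl
  simp only [e, map_mul, Complex.conj_ofReal, mul_left_comm _ (c : ℂ), mul_assoc]
  rw [integral_const_mul, integral_const_mul, hT]
  ring

theorem Op.isSkewAdjoint_of_isSkewOn {A : Op d k} {T : Schw d k →L[ℂ] Schw d k}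
    (hT : IsSkewOn T) (h : ∀ f : bosonic d k, (A.toCLM f : Schw d k) = T f) :
    A.IsSkewAdjoint := fun f g => by
  simp only [h]
  exact hT f g

theorem embed_mem (A : observables d k) : embed N (A : Op d k) ∈ observables d N := by
  refine Op.isSkewAdjoint_of_isSkewOn (T := embedFull N (A : Op d k)) ?_ fun f => rfl
  exact (IsSkewOn.sum _ fun i _ => (Op.IsSkewAdjoint.full A.2).extend i).smul _

theorem commutator_mem (A B : observables d N) :
    commutator (A : Op d N) (B : Op d N) ∈ observables d N := by
  refine Op.isSkewAdjoint_of_isSkewOn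
    (T := ((N : ℝ) : ℂ) • ((A : Op d N).full ∘L (B : Op d N).full -
      (B : Op d N).full ∘L (A : Op d N).full)) ?_ fun f => ?_
  · exact ((Op.IsSkewAdjoint.full A.2).comp_sub_comp (Op.IsSkewAdjoint.full B.2)).smul _
  · have e : ∀ A B : Op d N, (A.full ∘L B.full) (f : Schw d N) = A.toCLM (B.toCLM f) :=
      fun A B => by
        rw [ContinuousLinearMap.comp_apply, Op.full_apply_of_mem, Op.full_apply_of_mem]
    rw [smul_apply, sub_apply, e, e, Complex.ofReal_natCast]
    rfl

end Skew

/-! ### Counting pairs of tuples by their common entries. -/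

section Combinatorics

theorem card_embedding_extending {q : ℕ} (hq : q ≤ k) (p₀ : Fin q ↪ Fin N) :
    (Finset.univ.filter fun p : Fin k ↪ Fin N => (Fin.castLEEmb hq).trans p = p₀).card =
      (N - q).descFactorial (k - q) := by
  classical
  obtain ⟨m, rfl⟩ := Nat.exists_eq_add_of_le hq
  let e : (Fin (q + m) ↪ Fin N) ≃ Σ f : Fin q ↪ Fin N, Fin m ↪ ((Set.range f)ᶜ : Set (Fin N)) :=
    (Equiv.embeddingCongr finSumFinEquiv.symm (Equiv.refl _)).trans
      Equiv.sumEmbeddingEquivSigmaEmbeddingRestricted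
  have he : ∀ p, (e p).1 = (Fin.castLEEmb hq).trans p := fun p => rfl
  rw [← Fintype.card_subtype]
  have h1 : Fintype.card {p : Fin (q + m) ↪ Fin N // (Fin.castLEEmb hq).trans p = p₀} =
      Fintype.card (Fin m ↪ ((Set.range p₀)ᶜ : Set (Fin N))) := by
    refine Fintype.card_congr ?_
    exact (e.subtypeEquiv fun p => by rw [he]).trans
      (Equiv.sigmaSubtype p₀)
  rw [h1, Fintype.card_embedding_eq, Fintype.card_fin, add_tsub_cancel_left]
  congr 1
  rw [Fintype.card_compl_set, Set.card_range_of_injective p₀.injective, Fintype.card_fin,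
    Fintype.card_fin]

/-- The positions of the tuple `i'` whose entries are also entries of `i`. -/
def commonIdx (i : Fin l ↪ Fin N) (i' : Fin j ↪ Fin N) : Finset (Fin j) :=
  Finset.univ.filter fun a => ∃ b, i b = i' a

theorem mem_commonIdx {i : Fin l ↪ Fin N} {i' : Fin j ↪ Fin N} {a : Fin j} :
    a ∈ commonIdx i i' ↔ ∃ b, i b = i' a := by simp [commonIdx]

theorem map_commonIdx (i : Fin l ↪ Fin N) (i' : Fin j ↪ Fin N) :
    (commonIdx i i').map i' = Finset.univ.map i ∩ Finset.univ.map i' := by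
  ext a
  simp only [Finset.mem_map, mem_commonIdx, Finset.mem_inter, Finset.mem_univ, true_and]
  constructor
  · rintro ⟨b, ⟨c, hc⟩, rfl⟩
    exact ⟨⟨c, hc⟩, b, rfl⟩
  · rintro ⟨⟨c, hc⟩, b, rfl⟩
    exact ⟨b, ⟨c, hc⟩, rfl⟩

theorem card_commonIdx_comm (i : Fin l ↪ Fin N) (i' : Fin j ↪ Fin N) :
    (commonIdx i i').card = (commonIdx i' i).card := by
  rw [← Finset.card_map i', map_commonIdx, Finset.inter_comm, ← map_commonIdx, Finset.card_map]

theorem card_commonIdx_le (i : Fin l ↪ Fin N) (i' : Fin j ↪ Fin N) :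
    (commonIdx i i').card ≤ min l j := by
  refine le_min ?_ ?_
  · rw [card_commonIdx_comm]
    exact (Finset.card_le_univ _).trans (by simp)
  · exact (Finset.card_le_univ _).trans (by simp)

/-- The first `r` positions. -/
def firstIdx (j r : ℕ) : Finset (Fin j) := Finset.univ.filter fun a => (a : ℕ) < r

theorem card_firstIdx {r : ℕ} (h : r ≤ j) : (firstIdx j r).card = r := by
  rw [firstIdx, Fin.card_filter_val_lt, min_eq_right h]

theorem exists_perm_mem_iff {s t : Finset (Fin j)} (h : s.card = t.card) :
    ∃ σ : Equiv.Perm (Fin j), ∀ a, σ a ∈ t ↔ a ∈ s := by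
  let e : {a // a ∈ s} ≃ {a // a ∈ t} := Finset.equivOfCardEq h
  refine ⟨e.extendSubtype, fun a => ⟨fun h => ?_, fun h => e.extendSubtype_mem a h⟩⟩
  by_contra h'
  exact e.extendSubtype_not_mem a h' h

/-- The common positions form one of $\binom jr$ sets of size $r$, and reordering the second tuple
carries each such set to the first $r$ positions without changing the summand. -/
theorem sum_card_commonIdx_eq {M : Type} [AddCommGroup M] [Module ℂ M] {r : ℕ} (hr : r ≤ j)
    (G : (Fin l ↪ Fin N) → (Fin j ↪ Fin N) → M)
    (hG : ∀ i i' (σ : Equiv.Perm (Fin j)), G i (σ.toEmbedding.trans i') = G i i') :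
    ∑ q : (Fin l ↪ Fin N) × (Fin j ↪ Fin N) with (commonIdx q.1 q.2).card = r, G q.1 q.2 =
      (j.choose r : ℂ) • ∑ q : (Fin l ↪ Fin N) × (Fin j ↪ Fin N) with
        commonIdx q.1 q.2 = firstIdx j r, G q.1 q.2 := by
  classical
  rw [← Finset.sum_fiberwise_of_maps_to (s := Finset.univ.filter fun q :
    (Fin l ↪ Fin N) × (Fin j ↪ Fin N) => (commonIdx q.1 q.2).card = r)
    (t := Finset.powersetCard r (Finset.univ : Finset (Fin j)))
    (g := fun q => commonIdx q.1 q.2)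
    (fun q hq => Finset.mem_powersetCard.2 ⟨Finset.subset_univ _, (Finset.mem_filter.1 hq).2⟩)]
  have key : ∀ T ∈ Finset.powersetCard r (Finset.univ : Finset (Fin j)),
      ∑ q ∈ Finset.univ.filter (fun q : (Fin l ↪ Fin N) × (Fin j ↪ Fin N) =>
        (commonIdx q.1 q.2).card = r) with commonIdx q.1 q.2 = T, G q.1 q.2 =
      ∑ q : (Fin l ↪ Fin N) × (Fin j ↪ Fin N) with commonIdx q.1 q.2 = firstIdx j r,
        G q.1 q.2 := by
    intro T hT
    have hTc := (Finset.mem_powersetCard.1 hT).2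
    obtain ⟨σ, hσ⟩ := exists_perm_mem_iff (s := firstIdx j r) (t := T)
      ((card_firstIdx hr).trans hTc.symm)
    have hcom : ∀ (i : Fin l ↪ Fin N) (i' : Fin j ↪ Fin N) a,
        a ∈ commonIdx i (σ.toEmbedding.trans i') ↔ σ a ∈ commonIdx i i' := fun i i' a => by
      rw [mem_commonIdx, mem_commonIdx]
      rfl
    refine Finset.sum_equiv ((Equiv.refl _).prodCongr
      (Equiv.embeddingCongr σ.symm (Equiv.refl _))) (fun q => ?_) (fun q _ => ?_)
    · have e : ((Equiv.refl _).prodCongr (Equiv.embeddingCongr σ.symm (Equiv.refl _))) q =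
          (q.1, σ.toEmbedding.trans q.2) := rfl
      rw [e]
      simp only [Finset.mem_filter, Finset.mem_univ, true_and]
      constructor
      · rintro ⟨-, h⟩
        ext a
        rw [hcom, h, hσ]
      · intro h
        have : commonIdx q.1 q.2 = T := by
          ext a
          obtain ⟨b, rfl⟩ := σ.surjective a
          rw [← hcom, h, hσ]
        exact ⟨this ▸ hTc, this⟩
    · exact (hG q.1 q.2 σ).symm
  rw [Finset.sum_congr rfl key, Finset.sum_const, Finset.card_powersetCard, Finset.card_univ,
    Fintype.card_fin, Nat.cast_smul_eq_nsmul]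

/-- The tuples occurring in an `r`-fold contraction. -/
noncomputable def contractionTuples (l j r k : ℕ) : Finset (Fin j ↪ Fin k) :=
  Finset.univ.filter fun i => ∀ a : Fin j,
    ((a : ℕ) < r → (i a : ℕ) < l) ∧ (r ≤ (a : ℕ) → (i a : ℕ) = l + (a - r))

/-- The first $\ell$ entries of $p$ must be $i$, and the next $j-r$ must be the entries of $i'$ not
shared with $i$. So the first $k+1-r=\ell+j-r$ entries are forced and the last $r-1$ are free, while
$\beta$ is determined by $p$ because $p$ is injective. -/
theorem card_contraction_fiber {r : ℕ} (hr : 1 ≤ r) (hrl : r ≤ l) (hrj : r ≤ j)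
    (hk : k + 1 = l + j) (hlk : l ≤ k) (i : Fin l ↪ Fin N) (i' : Fin j ↪ Fin N)
    (h : commonIdx i i' = firstIdx j r) :
    (((Finset.univ : Finset (Fin k ↪ Fin N)) ×ˢ contractionTuples l j r k).filter fun q =>
      ((Fin.castLEEmb hlk).trans q.1, q.2.trans q.1) = (i, i')).card =
      (N - (k + 1 - r)).descFactorial (r - 1) := by
  have hlt : ∀ a : Fin j, (∃ b, i b = i' a) ↔ (a : ℕ) < r := fun a => by
    rw [← mem_commonIdx, h, firstIdx]
    simp
  have hq : k + 1 - r ≤ k := by omega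
  -- The forced initial segment of $p$; it is injective because the entries of $i'$ from position
  -- $r$ on do not occur in $i$.
  let p₀ : Fin (k + 1 - r) ↪ Fin N :=
    ⟨fun b => if hb : (b : ℕ) < l then i ⟨b, hb⟩ else i' ⟨b - l + r, by omega⟩, by
      intro b c hbc
      simp only at hbc
      split_ifs at hbc with h1 h2 h2
      · have := congrArg Fin.val (i.injective hbc)
        exact Fin.ext this
      · have := (hlt _).1 ⟨_, hbc⟩
        simp at this
      · have := (hlt _).1 ⟨_, hbc.symm⟩
        simp at this
      · have := congrArg Fin.val (i'.injective hbc)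
        simp only at this
        exact Fin.ext (by omega)⟩
  have hp₀1 : ∀ (b : Fin (k + 1 - r)) (hb : (b : ℕ) < l), p₀ b = i ⟨b, hb⟩ := fun b hb =>
    dif_pos hb
  have hp₀2 : ∀ (b : Fin (k + 1 - r)) (hb : ¬ (b : ℕ) < l),
    p₀ b = i' ⟨b - l + r, by omega⟩ := fun b hb => dif_neg hb
  have hcard := card_embedding_extending hq p₀
  rw [show k - (k + 1 - r) = r - 1 by omega] at hcard
  rw [← hcard]
  refine Finset.card_bij (fun q _ => q.1) ?_ ?_ ?_
  · rintro ⟨p, β⟩ hq'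
    simp only [Finset.mem_filter, Finset.mem_product, Finset.mem_univ, true_and,
      Prod.mk.injEq, contractionTuples] at hq' ⊢
    obtain ⟨hβ, rfl, rfl⟩ := hq'
    ext1 b
    by_cases hb : (b : ℕ) < l
    · rw [hp₀1 b hb]
      rfl
    · rw [hp₀2 b hb]
      simp only [Function.Embedding.trans_apply]
      congr 1
      apply Fin.ext
      rw [(hβ _).2 (by simp)]
      simp
      omega
  · rintro ⟨p, β⟩ h1 ⟨p', β'⟩ h2 e
    simp only [Finset.mem_filter, Finset.mem_product, Finset.mem_univ, true_and,
      Prod.mk.injEq] at h1 h2 e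
    subst e
    refine Prod.ext rfl ?_
    ext1 b
    apply p.injective
    have := h1.2.2.trans h2.2.2.symm
    exact congrArg (fun f : Fin j ↪ Fin N => f b) this
  · intro p hp
    have hp' : ∀ b, p (Fin.castLE hq b) = p₀ b := fun b =>
      congrArg (fun f : Fin (k + 1 - r) ↪ Fin N => f b) (Finset.mem_filter.1 hp).2
    have hpl : ∀ b : Fin l, p (Fin.castLE hlk b) = i b := fun b => by
      have := hp' ⟨b, by omega⟩
      rw [hp₀1 _ b.2] at this
      exact this
    have hpr : ∀ a : Fin j, r ≤ (a : ℕ) → ∃ c : Fin k, (c : ℕ) = l + (a - r) ∧ p c = i' a :=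
      fun a ha => by
        have := hp' ⟨l + (a - r), by omega⟩
        rw [hp₀2 _ (by simp)] at this
        refine ⟨Fin.castLE hq ⟨l + (a - r), by omega⟩, rfl, this.trans ?_⟩
        congr 1
        apply Fin.ext
        simp
        omega
    -- Every entry of $i'$ lies in the range of $p$: the shared ones through $i$, the others through
    -- the forced segment. This defines $\beta$.
    have hex : ∀ a : Fin j, ∃ c, p c = i' a := fun a => by
      rcases lt_or_ge (a : ℕ) r with ha | ha
      · obtain ⟨b, hb⟩ := (hlt a).2 ha
        exact ⟨_, (hpl b).trans hb⟩
      · obtain ⟨c, -, hc⟩ := hpr a ha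
        exact ⟨c, hc⟩
    choose β hβ using hex
    let β' : Fin j ↪ Fin k := ⟨β, fun a b e => i'.injective (by rw [← hβ, ← hβ, e])⟩
    refine ⟨(p, β'), ?_, rfl⟩
    simp only [Finset.mem_filter, Finset.mem_product, Finset.mem_univ, true_and,
      Prod.mk.injEq, contractionTuples]
    refine ⟨fun a => ⟨fun ha => ?_, fun ha => ?_⟩, ?_, ?_⟩
    · obtain ⟨b, hb⟩ := (hlt a).2 ha
      have : β a = Fin.castLE hlk b := p.injective (by rw [hβ, hpl, hb])
      change (β a : ℕ) < l
      rw [this]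
      exact b.2
    · obtain ⟨c, hc, hc'⟩ := hpr a ha
      have : β a = c := p.injective (by rw [hβ, hc'])
      change (β a : ℕ) = _
      rw [this, hc]
    · ext1 b
      exact hpl b
    · ext1 a
      exact hβ a

theorem sum_contractionTuples {M : Type} [AddCommGroup M] [Module ℂ M] {r : ℕ} (hr : 1 ≤ r)
    (hrl : r ≤ l) (hrj : r ≤ j) (hk : k + 1 = l + j) (hlk : l ≤ k)
    (G : (Fin l ↪ Fin N) → (Fin j ↪ Fin N) → M) :
    ∑ p : Fin k ↪ Fin N, ∑ β ∈ contractionTuples l j r k,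
      G ((Fin.castLEEmb hlk).trans p) (β.trans p) =
    ((N - (k + 1 - r)).descFactorial (r - 1) : ℂ) •
      ∑ q : (Fin l ↪ Fin N) × (Fin j ↪ Fin N) with commonIdx q.1 q.2 = firstIdx j r,
        G q.1 q.2 := by
  classical
  rw [← Finset.sum_product', ← Finset.sum_fiberwise_of_maps_to
    (t := Finset.univ.filter fun q : (Fin l ↪ Fin N) × (Fin j ↪ Fin N) =>
      commonIdx q.1 q.2 = firstIdx j r)
    (g := fun q : (Fin k ↪ Fin N) × (Fin j ↪ Fin k) =>
      ((Fin.castLEEmb hlk).trans q.1, q.2.trans q.1)), Finset.smul_sum]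
  · refine Finset.sum_congr rfl fun q hq => ?_
    rw [← card_contraction_fiber hr hrl hrj hk hlk q.1 q.2 (Finset.mem_filter.1 hq).2,
      Nat.cast_smul_eq_nsmul, ← Finset.sum_const]
    refine Finset.sum_congr rfl fun s hs => ?_
    exact congrArg (fun t : (Fin l ↪ Fin N) × (Fin j ↪ Fin N) => G t.1 t.2)
      (Finset.mem_filter.1 hs).2
  · rintro ⟨p, β⟩ hq
    simp only [Finset.mem_product, Finset.mem_univ, true_and, contractionTuples,
      Finset.mem_filter] at hq ⊢
    ext a
    rw [mem_commonIdx, firstIdx, Finset.mem_filter]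
    simp only [Function.Embedding.trans_apply, EmbeddingLike.apply_eq_iff_eq, Finset.mem_univ,
      true_and]
    constructor
    · rintro ⟨b, hb⟩
      by_contra ha
      have h1 := (hq a).2 (not_lt.1 ha)
      rw [← hb] at h1
      have := b.2
      simp at h1
      omega
    · intro ha
      exact ⟨⟨β a, (hq a).1 ha⟩, Fin.ext rfl⟩

/-- The product in $C_{\ell jkrN}$ is the number of choices of the $r-1$ free entries in
`card_contraction_fiber`. -/
theorem prod_Icc_eq_descFactorial {r : ℕ} (hr : 1 ≤ r) (hrk : r ≤ k) (hkN : k ≤ N) :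
    ∏ m ∈ Finset.Icc 1 (r - 1), ((N : ℝ) - k + m) =
      ((N - (k + 1 - r)).descFactorial (r - 1) : ℝ) := by
  obtain ⟨n, rfl⟩ := Nat.exists_eq_add_of_le hkN
  obtain ⟨s, rfl⟩ := Nat.exists_eq_add_of_le' hr
  rw [show k + n - (k + 1 - (s + 1)) = n + s by omega, Nat.add_sub_cancel,
    Nat.add_descFactorial_eq_ascFactorial]
  clear hr hrk hkN
  induction s with
  | zero => simp
  | succ s ih =>
    rw [Finset.prod_Icc_succ_top (by omega), ih, Nat.ascFactorial_succ]
    push_cast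
    ring

end Combinatorics

/-! ### The commutator as an embedded sum of contractions. -/

section CommutatorFormula

/-- `embed N` as a linear map. -/
noncomputable def embedLinear (d k N : ℕ) : Op d k →ₗ[ℂ] Op d N where
  toFun := embed N
  map_add' A B := Op.ext_apply fun f x => by
    rw [Op.add_apply, Submodule.coe_add, embed_apply, embed_apply, embed_apply, ← smul_add,
      ← Finset.sum_add_distrib]
    rfl
  map_smul' c A := Op.ext_apply fun f x => by
    rw [RingHom.id_apply, Op.smul_apply, Submodule.coe_smul, embed_apply, embed_apply, smul_comm c,
      Finset.smul_sum]
    simp only [Finset.smul_sum, _root_.sum_apply]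
    rfl

theorem embedLinear_apply (A : Op d k) : embedLinear d k N A = embed N A := rfl

/-- On symmetric functions, conjugating `X` by a permutation amounts to reordering the tuple along
which it is extended. -/
theorem extend_symOp_full (X : Schw d k →L[ℂ] Schw d k) (p : Fin k ↪ Fin N) (F : bosonic d N) :
    extend (symOp X).full p F =
      ((k.factorial : ℂ)⁻¹) • ∑ π : Equiv.Perm (Fin k),
        extend X (π.toEmbedding.trans p) (F : Schw d N) := by
  ext x
  have hs := slice_mem F.2 p x
  have e1 : (symOp X).full (slice p x (F : Schw d N)) =
      ((k.factorial : ℂ)⁻¹) • ∑ π : Equiv.Perm (Fin k), permute π (X (slice p x (F : Schw d N))) := by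
    rw [(symOp X).full_apply_of_mem ⟨_, hs⟩]
    change symOpFull X (slice p x (F : Schw d N)) = _
    simp [symOpFull, hs _]
  rw [extend_apply, e1, smul_apply, sum_apply, smul_apply, sum_apply]
  congr 1
  refine Finset.sum_congr rfl fun π _ => ?_
  rw [permute_apply, extend_apply, slice_perm_trans, hs]
  rfl

/-- The sum over all tuples is invariant under reordering, so it absorbs the symmetrization of `X`.
-/
theorem embed_symOp (X : Schw d k →L[ℂ] Schw d k) (F : bosonic d N) :
    ((embed N (symOp X)).toCLM F : Schw d N) =
      (tupleCoeff k N : ℂ) • ∑ p : Fin k ↪ Fin N, extend X p (F : Schw d N) := by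
  rw [embed_apply]
  congr 1
  simp only [extend_symOp_full]
  rw [← Finset.smul_sum, Finset.sum_comm]
  have : ∀ π : Equiv.Perm (Fin k), ∑ p : Fin k ↪ Fin N,
      extend X (π.toEmbedding.trans p) (F : Schw d N) =
      ∑ p : Fin k ↪ Fin N, extend X p (F : Schw d N) := fun π =>
    Equiv.sum_comp (Equiv.embeddingCongr π.symm (Equiv.refl (Fin N)))
      fun p => extend X p (F : Schw d N)
  simp only [this, Finset.sum_const, Finset.card_univ, Fintype.card_perm, Fintype.card_fin]
  rw [← Nat.cast_smul_eq_nsmul ℂ, smul_smul, inv_mul_cancel₀, one_smul]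
  exact_mod_cast k.factorial_ne_zero

/-- Every $k$-tuple of distinct elements of a $k$-element set is a reordering of the identity tuple,
so all averaged terms agree. -/
theorem embed_self (A : Op d k) : embed k A = A := by
  refine Op.ext_apply fun F x => ?_
  have key : ∀ p : Fin k ↪ Fin k, extend A.full p (F : Schw d k) = A.toCLM F := by
    intro p
    obtain ⟨σ, rfl⟩ : ∃ σ : Equiv.Perm (Fin k), p = σ.toEmbedding.trans (Function.Embedding.refl _) :=
      ⟨Equiv.ofBijective p p.injective.bijective_of_finite, rfl⟩
    rw [extend_full_perm]
    ext x
    rw [extend_apply, ← A.full_apply_of_mem]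
    have : slice (Function.Embedding.refl (Fin k)) x (F : Schw d k) = F := by
      ext y
      rw [slice_apply]
      congr 1
      funext a
      exact (Function.Embedding.refl (Fin k)).injective.extend_apply y x a
    rw [this]
    rfl
  rw [embed_apply]
  simp only [key, Finset.sum_const, Finset.card_univ]
  rw [← Nat.cast_smul_eq_nsmul ℂ, smul_smul, tupleCoeff, Complex.ofReal_inv,
    Complex.ofReal_natCast, inv_mul_cancel₀, one_smul]
  have : Nonempty (Fin k ↪ Fin k) := ⟨Function.Embedding.refl _⟩
  exact_mod_cast Fintype.card_ne_zero

/-- The sum of the products `A_i B_{i'}` over the tuples with exactly `r` common entries. -/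
noncomputable def pairSum (N r : ℕ) (A : Op d l) (B : Op d j) : Schw d N →L[ℂ] Schw d N :=
  ∑ q : (Fin l ↪ Fin N) × (Fin j ↪ Fin N) with (commonIdx q.1 q.2).card = r,
    extend A.full q.1 ∘L extend B.full q.2

theorem pairSum_swap (N r : ℕ) (A : Op d l) (B : Op d j) : pairSum N r B A =
    ∑ q : (Fin l ↪ Fin N) × (Fin j ↪ Fin N) with (commonIdx q.1 q.2).card = r,
      extend B.full q.2 ∘L extend A.full q.1 := by
  refine Finset.sum_equiv (Equiv.prodComm _ _) (fun q => ?_) fun q _ => rfl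
  simp only [Finset.mem_filter, Finset.mem_univ, true_and, Equiv.prodComm_apply, Prod.fst_swap,
    Prod.snd_swap]
  rw [card_commonIdx_comm]

theorem pairSum_zero_comm (N : ℕ) (A : Op d l) (B : Op d j) :
    pairSum N 0 A B = pairSum N 0 B A := by
  rw [pairSum_swap N 0 A B]
  refine Finset.sum_congr rfl fun q hq => extend_comm _ _ _ _ ?_
  have h := Finset.card_eq_zero.1 (Finset.mem_filter.1 hq).2
  refine Set.disjoint_left.2 ?_
  rintro _ ⟨b, rfl⟩ ⟨a, ha⟩
  have : a ∈ commonIdx q.1 q.2 := mem_commonIdx.2 ⟨b, ha.symm⟩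
  rw [h] at this
  simp at this

theorem isSkewOn_pairSum_sub (r : ℕ) {A : Op d l} {B : Op d j} (hA : A.IsSkewAdjoint)
    (hB : B.IsSkewAdjoint) : IsSkewOn (pairSum N r A B - pairSum N r B A) := by
  rw [pairSum_swap N r A B, pairSum, ← Finset.sum_sub_distrib]
  exact IsSkewOn.sum _ fun q _ => (hA.full.extend q.1).comp_sub_comp (hB.full.extend q.2)

theorem sum_extend_comp_extend (N : ℕ) (A : Op d l) (B : Op d j) :
    ∑ i : Fin l ↪ Fin N, ∑ i' : Fin j ↪ Fin N, extend A.full i ∘L extend B.full i' =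
      pairSum N 0 A B + ∑ r ∈ Finset.Icc 1 (min l j), pairSum N r A B := by
  have h0 : (0 : ℕ) ∉ Finset.Icc 1 (min l j) := by simp
  have hmaps : ∀ q ∈ (Finset.univ : Finset ((Fin l ↪ Fin N) × (Fin j ↪ Fin N))),
      (commonIdx q.1 q.2).card ∈ insert 0 (Finset.Icc 1 (min l j)) := by
    intro q _
    have := card_commonIdx_le q.1 q.2
    rw [Finset.mem_insert, Finset.mem_Icc]
    omega
  have h1 := Finset.sum_fiberwise_of_maps_to hmaps fun q => extend A.full q.1 ∘L extend B.full q.2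
  rw [← Finset.sum_insert (f := fun r => pairSum N r A B) h0]
  refine Eq.trans ?_ h1.symm
  exact (Finset.sum_product' Finset.univ Finset.univ
    fun (i : Fin l ↪ Fin N) (i' : Fin j ↪ Fin N) => extend A.full i ∘L extend B.full i').symm

theorem embed_embed (N : ℕ) (A : Op d l) (B : Op d j) (F : bosonic d N) :
    ((embed N A).toCLM ((embed N B).toCLM F) : Schw d N) =
      ((tupleCoeff l N * tupleCoeff j N : ℝ) : ℂ) •
        (pairSum N 0 A B F + ∑ r ∈ Finset.Icc 1 (min l j), pairSum N r A B F) := by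
  have e := congrArg (fun T : Schw d N →L[ℂ] Schw d N => T F) (sum_extend_comp_extend N A B)
  simp only [sum_apply, add_apply, ContinuousLinearMap.comp_apply] at e
  rw [embed_apply, embed_apply, ← e, Complex.ofReal_mul, mul_smul]
  simp only [map_smul, map_sum]
  rw [← Finset.smul_sum]

theorem commutator_embed (N : ℕ) (A : Op d l) (B : Op d j) (F : bosonic d N) :
    ((BosonHierarchy.commutator (embed N A) (embed N B)).toCLM F : Schw d N) =
      ((N * tupleCoeff l N * tupleCoeff j N : ℝ) : ℂ) •
        ∑ r ∈ Finset.Icc 1 (min l j), (pairSum N r A B - pairSum N r B A) F := by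
  have e : ((BosonHierarchy.commutator (embed N A) (embed N B)).toCLM F : Schw d N) =
      (N : ℂ) • (((embed N A).toCLM ((embed N B).toCLM F) : Schw d N) -
        ((embed N B).toCLM ((embed N A).toCLM F) : Schw d N)) := rfl
  rw [e, embed_embed, embed_embed, pairSum_zero_comm N A B, min_comm j l,
    mul_comm (tupleCoeff j N), ← smul_sub, add_sub_add_left_eq_sub, ← Finset.sum_sub_distrib,
    smul_smul]
  congr 1
  push_cast
  ring

/-- Both sides are multiples of the sum over pairs whose common positions are the first $r$:
`sum_contractionTuples` handles the left and `sum_card_commonIdx_eq` the right. -/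
theorem choose_smul_sum_extend_contraction {r : ℕ} (hr : 1 ≤ r) (hrl : r ≤ l) (hrj : r ≤ j)
    (hk : k + 1 = l + j) (A : Op d l) (B : Op d j) (F : Schw d N) :
    (j.choose r : ℂ) • ∑ p : Fin k ↪ Fin N, extend (contraction r k A B) p F =
      ((N - (k + 1 - r)).descFactorial (r - 1) : ℂ) • pairSum N r A B F := by
  have hlk : l ≤ k := by omega
  let G : (Fin l ↪ Fin N) → (Fin j ↪ Fin N) → Schw d N := fun i i' =>
    extend A.full i (extend B.full i' F)
  have h1 : ∀ p : Fin k ↪ Fin N, extend (contraction r k A B) p F =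
      ∑ β ∈ contractionTuples l j r k, G ((Fin.castLEEmb hlk).trans p) (β.trans p) := by
    intro p
    rw [contraction, dif_pos hlk, extend_comp, extend_extend, ← extendLinear_apply p (∑ i ∈ _, _),
      map_sum, ContinuousLinearMap.comp_apply, sum_apply, map_sum]
    refine Finset.sum_congr rfl fun β _ => ?_
    rw [extendLinear_apply, extend_extend]
  have h2 : pairSum N r A B F = ∑ q : (Fin l ↪ Fin N) × (Fin j ↪ Fin N) with
      (commonIdx q.1 q.2).card = r, G q.1 q.2 := by
    rw [pairSum, sum_apply]
    rfl
  rw [h2, sum_card_commonIdx_eq hrj G fun i i' σ => by simp only [G, extend_full_perm]]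
  simp only [h1]
  rw [sum_contractionTuples hr hrl hrj hk hlk, smul_comm]

theorem embed_symOp_contractionCommutator {r : ℕ} (hr : 1 ≤ r) (hrl : r ≤ l) (hrj : r ≤ j)
    (hk : k + 1 = l + j) (A : Op d l) (B : Op d j) (F : bosonic d N) :
    ((embed N (symOp (contractionCommutator r k A B))).toCLM F : Schw d N) =
      ((tupleCoeff k N * (N - (k + 1 - r)).descFactorial (r - 1) : ℝ) : ℂ) •
        (pairSum N r A B - pairSum N r B A) F := by
  have h1 : ∀ p : Fin k ↪ Fin N, extend (contractionCommutator r k A B) p (F : Schw d N) =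
      (j.choose r : ℂ) • extend (contraction r k A B) p (F : Schw d N) -
      (l.choose r : ℂ) • extend (contraction r k B A) p (F : Schw d N) := fun p => rfl
  rw [embed_symOp]
  simp only [h1]
  rw [Finset.sum_sub_distrib, ← Finset.smul_sum, ← Finset.smul_sum,
    choose_smul_sum_extend_contraction hr hrl hrj hk,
    choose_smul_sum_extend_contraction hr hrj hrl (hk.trans (add_comm _ _)), ← smul_sub,
    smul_smul, Complex.ofReal_mul, Complex.ofReal_natCast]
  rfl

/-- The case $N=k$ of the preceding identity: $\epsilon_{k,k}$ is the identity, so the operator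
itself is a real multiple of a sum of commutators $[A_i,B_{i'}]$, each of which is skew. -/
theorem symOp_contractionCommutator_mem {r : ℕ} (hr : 1 ≤ r) (hrl : r ≤ l) (hrj : r ≤ j)
    (hk : k + 1 = l + j) (A : observables d l) (B : observables d j) :
    symOp (contractionCommutator r k (A : Op d l) (B : Op d j)) ∈ observables d k := by
  refine Op.isSkewAdjoint_of_isSkewOn ((isSkewOn_pairSum_sub r A.2 B.2).smul
    (tupleCoeff k k * (k - (k + 1 - r)).descFactorial (r - 1))) fun F => ?_
  have := embed_symOp_contractionCommutator hr hrl hrj hk (A : Op d l) (B : Op d j) F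
  rw [embed_self] at this
  exact this

theorem contractionCoeff_mul {r : ℕ} (hr : 1 ≤ r) (hrk : r ≤ k) (hkN : k ≤ N) :
    contractionCoeff l j k r N * (tupleCoeff k N * (N - (k + 1 - r)).descFactorial (r - 1)) =
      N * tupleCoeff l N * tupleCoeff j N := by
  rw [contractionCoeff, prod_Icc_eq_descFactorial hr hrk hkN, div_mul_cancel₀]
  refine mul_ne_zero (tupleCoeff_ne_zero hkN) ?_
  rw [Nat.cast_ne_zero, Ne, Nat.descFactorial_eq_zero_iff_lt]
  omega

/-- The constant $C_{\ell jkrN}$ is exactly what cancels $C_{k,N}$ and the count of free entries,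
leaving the prefactor $N\,C_{\ell,N}\,C_{j,N}$ of the commutator (`contractionCoeff_mul`). -/
theorem commutator_eq_embed (hl : 1 ≤ l) (hk : k + 1 = l + j) (hkN : k ≤ N)
    (A : Op d l) (B : Op d j) :
    BosonHierarchy.commutator (embed N A) (embed N B) =
      embed N (∑ r ∈ Finset.Icc 1 (min l j), contractionCoeff l j k r N •
        symOp (contractionCommutator r k A B)) := by
  refine Op.ext_apply fun F x => ?_
  rw [commutator_embed, ← embedLinear_apply, map_sum]
  have e : ∀ r, embedLinear d k N (contractionCoeff l j k r N •
      symOp (contractionCommutator r k A B)) = (contractionCoeff l j k r N : ℂ) •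
        embed N (symOp (contractionCommutator r k A B)) := fun r =>
    (embedLinear d k N).map_smul (contractionCoeff l j k r N : ℂ) _
  simp only [e]
  rw [smul_apply, sum_apply, Finset.smul_sum]
  refine Eq.trans (Finset.sum_congr rfl fun r hr => ?_) (map_sum (Op.evalAt F x) _ _).symm
  obtain ⟨h1, h2⟩ := Finset.mem_Icc.1 hr
  have h3 := h2.trans (min_le_left _ _)
  have h4 := h2.trans (min_le_right _ _)
  rw [map_smul]
  change _ = (contractionCoeff l j k r N : ℂ) •
    ((embed N (symOp (contractionCommutator r k A B))).toCLM F : Schw d N) x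
  rw [embed_symOp_contractionCommutator h1 h3 h4 hk, smul_apply, smul_smul, ← Complex.ofReal_mul,
    contractionCoeff_mul h1 (by omega) hkN]

end CommutatorFormula

/-! ### Asymptotics of the constants. -/

section Coefficients

theorem tendsto_pow_mul_tupleCoeff (m : ℕ) :
    Tendsto (fun N : ℕ => (N : ℝ) ^ m * tupleCoeff m N) atTop (𝓝 1) := by
  have hz : ∀ᶠ N : ℕ in atTop, (N.descFactorial m : ℝ) ≠ 0 := by
    filter_upwards [eventually_ge_atTop m] with N hN
    rw [Nat.cast_ne_zero, Ne, Nat.descFactorial_eq_zero_iff_lt]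
    omega
  refine ((isEquivalent_iff_tendsto_one hz).1 (isEquivalent_descFactorial m).symm).congr
    fun N => ?_
  rw [tupleCoeff, Fintype.card_embedding_eq, Fintype.card_fin, Fintype.card_fin, Pi.div_apply,
    div_eq_mul_inv]

/-- Power counting: $N\cdot N^{-\ell}N^{-j}N^{k}=1$ since $k+1=\ell+j$. -/
theorem tendsto_contractionCoeff_one (hk : k + 1 = l + j) :
    Tendsto (fun N : ℕ => contractionCoeff l j k 1 N) atTop (𝓝 1) := by
  have h := ((tendsto_pow_mul_tupleCoeff l).mul (tendsto_pow_mul_tupleCoeff j)).div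
    (tendsto_pow_mul_tupleCoeff k) one_ne_zero
  rw [mul_one, div_one] at h
  refine h.congr' ?_
  filter_upwards [eventually_gt_atTop 0] with N hN
  have hN' : (N : ℝ) ≠ 0 := by positivity
  simp only [contractionCoeff, Pi.div_apply]
  have e : (N : ℝ) ^ l * tupleCoeff l N * ((N : ℝ) ^ j * tupleCoeff j N) =
      (N : ℝ) ^ k * (N * tupleCoeff l N * tupleCoeff j N) := by
    have : (N : ℝ) ^ l * (N : ℝ) ^ j = (N : ℝ) ^ k * N := by
      rw [← pow_add, ← hk, pow_succ]
    linear_combination (tupleCoeff l N * tupleCoeff j N) * this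
  rw [e, mul_div_mul_left _ _ (pow_ne_zero _ hN')]
  simp

theorem tendsto_contractionCoeff {r : ℕ} (hk : k + 1 = l + j) (hr : 2 ≤ r) :
    Tendsto (fun N : ℕ => contractionCoeff l j k r N) atTop (𝓝 0) := by
  have h1 : ∀ N, contractionCoeff l j k r N = contractionCoeff l j k 1 N *
      ∏ m ∈ Finset.Icc 1 (r - 1), ((N : ℝ) - k + m)⁻¹ := fun N => by
    rw [contractionCoeff, contractionCoeff, Finset.prod_inv_distrib]
    simp only [Nat.sub_self, Finset.Icc_eq_empty_of_lt one_pos, Finset.prod_empty]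
    ring
  have h2 : Tendsto (fun N : ℕ => ∏ m ∈ Finset.Icc 1 (r - 1), ((N : ℝ) - k + m)⁻¹) atTop
      (𝓝 (∏ m ∈ Finset.Icc 1 (r - 1), 0)) := by
    refine tendsto_finsetProd _ fun m _ => tendsto_inv_atTop_zero.comp ?_
    refine tendsto_atTop_add_const_right _ _ ?_
    simp only [sub_eq_add_neg]
    exact tendsto_atTop_add_const_right _ _ tendsto_natCast_atTop_atTop
  -- The product of limits is $0$ because $r\ge2$ leaves at least one factor.
  rw [Finset.prod_const, zero_pow (by simp; omega)] at h2
  simpa [h1] using (tendsto_contractionCoeff_one hk).mul h2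

end Coefficients

/-! ### The bracket at finite $N$ and its limit. -/

section Limit

theorem embedInv_embed (hk : 1 ≤ k) (hkN : k ≤ N) (D : observables d k) :
    embedInv k (embed N (D : Op d k)) = D :=
  Function.leftInverse_invFun (f := fun A : observables d k => embed N (A : Op d k))
    (fun _ _ h => Subtype.ext (embed_injective hk hkN h)) D

theorem embed_zero : embed N (0 : Op d k) = 0 := (embedLinear d k N).map_zero

theorem commutator_zero_left (T : Op d N) : BosonHierarchy.commutator 0 T = 0 := by
  refine Op.ext_apply fun F x => ?_
  change ((N : ℂ) • ((0 : Schw d N) - T.toCLM 0)) x = _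
  simp [Op.zero_apply]

theorem commutator_zero_right (T : Op d N) : BosonHierarchy.commutator T 0 = 0 := by
  refine Op.ext_apply fun F x => ?_
  change ((N : ℂ) • ((T.toCLM 0 : Schw d N) - 0)) x = _
  simp [Op.zero_apply]

theorem extend_zero_full (i : Fin k ↪ Fin N) : extend (0 : Op d k).full i = 0 :=
  (extendLinear i).map_zero

theorem contraction_zero_left (r k : ℕ) (B : Op d j) : contraction r k (0 : Op d l) B = 0 := by
  ext f x
  rw [contraction]
  split_ifs <;> simp [extend_zero_full]

theorem contraction_zero_right (r k : ℕ) (A : Op d l) : contraction r k A (0 : Op d j) = 0 := by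
  ext f x
  rw [contraction]
  simp [extend_zero_full]

theorem symOp_zero : symOp (0 : Schw d k →L[ℂ] Schw d k) = 0 := by
  refine Op.ext_apply fun F x => ?_
  change symOpFull 0 (F : Schw d k) x = 0
  simp [symOpFull]

theorem symOp_contractionCommutator_eq_zero (r k : ℕ) {A : Op d l} {B : Op d j}
    (h : A = 0 ∨ B = 0) : symOp (contractionCommutator r k A B) = 0 := by
  rcases h with rfl | rfl <;>
    simp [contractionCommutator, contraction_zero_left, contraction_zero_right, symOp_zero]

theorem mem_pairs {k : ℕ+} {p : ℕ+ × ℕ+} : p ∈ pairs k ↔ (k : ℕ) + 1 = p.1 + p.2 := by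
  have h1 := p.1.pos
  have h2 := p.2.pos
  simp only [pairs, Finset.mem_filter, Finset.mem_product, Finset.mem_Icc, ← PNat.coe_le_coe,
    ← PNat.coe_inj, PNat.add_coe, PNat.one_coe]
  omega

open Classical in
/-- The symmetrized contraction commutator as an observable. -/
noncomputable def contractionObs (r k : ℕ) (A : observables d l) (B : observables d j) :
    observables d k :=
  -- The default `0` is never taken when $1\le r\le\min\{\ell,j\}$ and $k+1=\ell+j$, by
  -- `symOp_contractionCommutator_mem`.
  if h : symOp (contractionCommutator r k (A : Op d l) (B : Op d j)) ∈ observables d k then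
    ⟨_, h⟩ else 0

theorem coe_contractionObs {r : ℕ} (hr : 1 ≤ r) (hrl : r ≤ l) (hrj : r ≤ j)
    (hk : k + 1 = l + j) (A : observables d l) (B : observables d j) :
    (contractionObs r k A B : Op d k) =
      symOp (contractionCommutator r k (A : Op d l) (B : Op d j)) := by
  rw [contractionObs, dif_pos (symOp_contractionCommutator_mem hr hrl hrj hk A B)]

/-- The observable whose image under `embed N` is the commutator of the embedded operators. -/
noncomputable def bracketTerm (N k : ℕ) (A : observables d l) (B : observables d j) :
    observables d k :=
  ∑ r ∈ Finset.Icc 1 (min l j), contractionCoeff l j k r N • contractionObs r k A B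

theorem coe_bracketTerm (N : ℕ) (hk : k + 1 = l + j) (A : observables d l)
    (B : observables d j) : (bracketTerm N k A B : Op d k) =
      ∑ r ∈ Finset.Icc 1 (min l j), contractionCoeff l j k r N •
        symOp (contractionCommutator r k (A : Op d l) (B : Op d j)) := by
  rw [bracketTerm, Submodule.coe_sum]
  refine Finset.sum_congr rfl fun r hr => ?_
  obtain ⟨h1, h2⟩ := Finset.mem_Icc.1 hr
  rw [Submodule.coe_smul, coe_contractionObs h1 (h2.trans (min_le_left _ _))
    (h2.trans (min_le_right _ _)) hk]

theorem embed_bracketTerm (hl : 1 ≤ l) (hk : k + 1 = l + j) (hkN : k ≤ N) (A : observables d l)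
    (B : observables d j) : embed N (bracketTerm N k A B : Op d k) =
      BosonHierarchy.commutator (embed N (A : Op d l)) (embed N (B : Op d j)) := by
  rw [commutator_eq_embed hl hk hkN, coe_bracketTerm N hk]

theorem eq_zero_or_eq_zero {N₀ : ℕ+} (A B : finiteHierarchy d N₀) {l j : ℕ+}
    (h : 2 * (N₀ : ℕ) < l + j) :
    ((A : Hierarchy d) l : Op d l) = 0 ∨ ((B : Hierarchy d) j : Op d j) = 0 := by
  rcases lt_or_ge (N₀ : ℕ) l with hl | hl
  · left
    rw [A.2 l (PNat.coe_lt_coe _ _ |>.1 hl)]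
    rfl
  · right
    rw [B.2 j (PNat.coe_lt_coe _ _ |>.1 (by omega))]
    rfl

theorem bracket_apply_of_le {N k : ℕ+} (h : k ≤ N) (A B : finiteHierarchy d N) :
    (bracket N A B : Hierarchy d) k = bracketComponent N A B k :=
  DirectSum.mk_apply_of_mem (Finset.mem_Icc.2 ⟨one_le, h⟩)

/-- The truncation $\min\{\ell+j-1,N\}$ adds pairs only at $k=N$. Those have $\ell+j-1>N\ge2N_0-1$,
so one index exceeds $N_0$ and the commutator is zero. -/
theorem bracketComponent_eq {N₀ N k : ℕ+} (A B : finiteHierarchy d N₀) (hN : N₀ ≤ N)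
    (hN2 : 2 * (N₀ : ℕ) - 1 ≤ N) (hk : k ≤ N) :
    bracketComponent N (Submodule.inclusion (finiteHierarchy_mono hN) A)
      (Submodule.inclusion (finiteHierarchy_mono hN) B) k =
    ∑ p ∈ pairs k, bracketTerm N k ((A : Hierarchy d) p.1) ((B : Hierarchy d) p.2) := by
  have hk' : (k : ℕ) ≤ N := PNat.coe_le_coe _ _ |>.2 hk
  rw [bracketComponent]
  symm
  refine Finset.sum_subset_zero_on_sdiff ?_ ?_ ?_
  · intro p hp
    rw [mem_pairs] at hp
    have h1 := p.1.pos
    have h2 := p.2.pos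
    simp only [Finset.mem_filter, Finset.mem_product, Finset.mem_Icc, ← PNat.coe_le_coe,
      PNat.one_coe]
    omega
  · intro p hp
    obtain ⟨h1, h2⟩ := Finset.mem_sdiff.1 hp
    rw [mem_pairs] at h2
    have h3 := (Finset.mem_filter.1 h1).2
    have h4 : ((A : Hierarchy d) p.1 : Op d p.1) = 0 ∨ ((B : Hierarchy d) p.2 : Op d p.2) = 0 :=
      eq_zero_or_eq_zero A B (by have := p.1.pos; have := N₀.pos; omega)
    have h5 : BosonHierarchy.commutator
        (embed N ((A : Hierarchy d) p.1 : Op d p.1)) (embed N ((B : Hierarchy d) p.2 : Op d p.2))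
        = embed N ((0 : observables d k) : Op d k) := by
      rw [Submodule.coe_zero, embed_zero]
      rcases h4 with h | h <;> rw [h, embed_zero]
      · exact commutator_zero_left _
      · exact commutator_zero_right _
    -- Injectivity is needed even here: it forces the chosen preimage of $0$ to be $0$.
    exact (congrArg (embedInv (k : ℕ)) h5).trans (embedInv_embed k.pos hk' 0)
  · intro p hp
    rw [mem_pairs] at hp
    have := embed_bracketTerm p.1.pos hp hk' ((A : Hierarchy d) p.1) ((B : Hierarchy d) p.2)
    exact ((congrArg (embedInv (k : ℕ)) this.symm).trans (embedInv_embed k.pos hk' _)).symm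

theorem sum_inclusion_apply (s : Finset ℕ+) (f : ∀ k : ℕ+, observables d k) (k : ℕ+) :
    (∑ i ∈ s, inclusion d i (f i)) k = if k ∈ s then f k else 0 := by
  have h : ∀ i, (inclusion d i (f i)) k = if i = k then f k else 0 := fun i => by
    split_ifs with hik
    · subst hik
      exact DirectSum.lof_apply (M := fun k : ℕ+ => observables d k) ℝ i (f i)
    · exact DirectSum.of_eq_of_ne _ _ _ (Ne.symm hik)
  rw [DirectSum.sum_apply]
  simp only [h, Finset.sum_ite_eq']

theorem bracketTerm_eq_zero (N : ℕ) (hk : k + 1 = l + j) {A : observables d l}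
    {B : observables d j} (h : (A : Op d l) = 0 ∨ (B : Op d j) = 0) : bracketTerm N k A B = 0 := by
  refine Subtype.ext ?_
  rw [coe_bracketTerm N hk, Submodule.coe_zero]
  refine Finset.sum_eq_zero fun r _ => ?_
  rw [symOp_contractionCommutator_eq_zero r k h, smul_zero]

/-- This reduces the limit in $\mathfrak F_\infty$ to scalars: the levels $k\le 2N_0-1$ and the
observables do not depend on $N$, only the coefficients inside `bracketTerm` do. -/
theorem bracket_eq_sum {N₀ N M : ℕ+} (A B : finiteHierarchy d N₀) (hN : N₀ ≤ N)
    (hM : (M : ℕ) = 2 * N₀ - 1) (hMN : M ≤ N) :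
    (bracket N (Submodule.inclusion (finiteHierarchy_mono hN) A)
      (Submodule.inclusion (finiteHierarchy_mono hN) B) : Hierarchy d) =
    ∑ k ∈ Finset.Icc 1 M, inclusion d k
      (∑ p ∈ pairs k, bracketTerm N k ((A : Hierarchy d) p.1) ((B : Hierarchy d) p.2)) := by
  have hMN' : (M : ℕ) ≤ N := PNat.coe_le_coe _ _ |>.2 hMN
  refine DirectSum.ext fun k => ?_
  rw [sum_inclusion_apply]
  rcases le_or_gt k N with hk | hk
  · rw [bracket_apply_of_le hk, bracketComponent_eq A B hN (by omega) hk]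
    split_ifs with h
    · rfl
    · refine Finset.sum_eq_zero fun p hp => ?_
      rw [mem_pairs] at hp
      refine bracketTerm_eq_zero _ hp (eq_zero_or_eq_zero A B ?_)
      have h1 : (M : ℕ) < k := by
        by_contra h2
        exact h (Finset.mem_Icc.2 ⟨one_le, PNat.coe_le_coe _ _ |>.1 (not_lt.1 h2)⟩)
      omega
  · rw [if_neg fun h => not_lt.2 ((Finset.mem_Icc.1 h).2.trans hMN) hk]
    exact (bracket N _ _).2 k hk

/-- Only scalars move, so the linear map `φ` need not be continuous. -/
theorem tendsto_bracketTerm {Y : Type} [AddCommGroup Y] [Module ℝ Y] [TopologicalSpace Y]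
    [IsTopologicalAddGroup Y] [ContinuousSMul ℝ Y] (φ : observables d k →ₗ[ℝ] Y)
    (hl : 1 ≤ l) (hj : 1 ≤ j) (hk : k + 1 = l + j) (A : observables d l) (B : observables d j) :
    Tendsto (fun N : ℕ => φ (bracketTerm N k A B)) atTop (𝓝 (φ (contractionObs 1 k A B))) := by
  have h1 : ∀ N : ℕ, φ (bracketTerm N k A B) = ∑ r ∈ Finset.Icc 1 (min l j),
      contractionCoeff l j k r N • φ (contractionObs r k A B) := fun N => by
    rw [bracketTerm, map_sum]
    simp only [map_smul]
  -- The limit is written with coefficients $1$ at $r=1$ and $0$ elsewhere, to compare the sums term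
  -- by term.
  have h2 : φ (contractionObs 1 k A B) = ∑ r ∈ Finset.Icc 1 (min l j),
      (if r = 1 then (1 : ℝ) else 0) • φ (contractionObs r k A B) := by
    simp only [ite_smul, one_smul, zero_smul, Finset.sum_ite_eq']
    rw [if_pos (Finset.mem_Icc.2 ⟨le_rfl, le_min hl hj⟩)]
  simp only [h1]
  rw [h2]
  refine tendsto_finsetSum _ fun r hr => Tendsto.smul_const ?_ _
  split_ifs with h
  · rw [h]
    exact tendsto_contractionCoeff_one hk
  · exact tendsto_contractionCoeff hk (by have := (Finset.mem_Icc.1 hr).1; omega)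

theorem tendsto_coe_Ici (N₀ : ℕ+) :
    Tendsto (fun N : Set.Ici N₀ => ((N.1 : ℕ+) : ℕ)) atTop atTop := by
  refine tendsto_atTop.2 fun b => ?_
  filter_upwards [eventually_ge_atTop (⟨max N₀ ⟨b + 1, b.succ_pos⟩, Set.mem_Ici.2 (le_max_left _ _)⟩ :
    Set.Ici N₀)] with N hN
  have h1 : (⟨b + 1, b.succ_pos⟩ : ℕ+) ≤ N.1 :=
    (le_max_right N₀ _).trans (show max N₀ ⟨b + 1, b.succ_pos⟩ ≤ N.1 from hN)
  exact (Nat.le_succ b).trans (PNat.coe_le_coe _ _ |>.2 h1)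

/-- The topology is induced by `Op.toForm`, so the claim is continuity of scalar multiplication in
$\mathcal L(\mathcal S_s,\mathcal S_s')$. -/
theorem Op.tendsto_smul_zero {c : ℕ → ℝ} (hc : Tendsto c atTop (𝓝 0)) (X : Op d k) :
    Tendsto (fun n => c n • X) atTop (𝓝 0) := by
  have hi : Topology.IsInducing (Op.toForm : Op d k → _) := ⟨rfl⟩
  rw [hi.tendsto_nhds_iff]
  have h0 : (0 : Op d k).toForm = 0 := ContinuousLinearMap.comp_zero _
  have h1 : Op.toForm ∘ (fun n => c n • X) = fun n => (c n : ℂ) • X.toForm := by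
    funext n
    exact ContinuousLinearMap.comp_smul (toDual d k) (c n : ℂ) X.toCLM
  rw [h0, h1]
  have h2 : Tendsto (fun n => (c n : ℂ)) atTop (𝓝 0) := by
    exact_mod_cast (Complex.continuous_ofReal.tendsto 0).comp hc
  have h3 := h2.smul_const X.toForm
  have h4 : (0 : ℂ) • X.toForm = 0 := by
    ext f g
    exact zero_mul (X.toForm f g)
  exact h4 ▸ h3

end Limit

end BosonHierarchy

theorem proposition2p3 (d : ℕ) (hd : 1 ≤ d) (N₀ : ℕ+) (A B : finiteHierarchy d N₀) :
    -- the bracket of `𝔊_N` is well defined: `ε_{k,N}⁻¹` is only applied to elements of the image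
    -- of the map `ε_{k,N}` which have exactly one preimage
    (∀ N : ℕ+, N₀ ≤ N → ∀ l j k : ℕ+, l ≤ N → j ≤ N → min ((l : ℕ) + j - 1) N = k →
      ∃! D : observables d k, embed N (D : Op d k) =
        BosonHierarchy.commutator (embed N ((A : Hierarchy d) l : Op d l))
          (embed N ((B : Hierarchy d) j : Op d j))) ∧
    -- convergence of the brackets in `𝔉_∞`, and the components of the limit
    (∃ C : Hierarchy d,
      (∀ k : ℕ+, (C k : Op d k) = ∑ p ∈ pairs k,
        symOp (contractionCommutator 1 k ((A : Hierarchy d) p.1 : Op d p.1)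
          ((B : Hierarchy d) p.2 : Op d p.2))) ∧
      Tendsto (fun N : Set.Ici N₀ =>
        (bracket N.1 (Submodule.inclusion (finiteHierarchy_mono N.2) A)
          (Submodule.inclusion (finiteHierarchy_mono N.2) B) : Hierarchy d)) atTop (𝓝 C)) ∧
    -- the terms with higher contractions vanish in the limit
    ∀ k : ℕ+,
      (∀ N : Set.Ici N₀, 2 * (N₀ : ℕ) - 1 ≤ (N.1 : ℕ) →
        ((bracket N.1 (Submodule.inclusion (finiteHierarchy_mono N.2) A)
          (Submodule.inclusion (finiteHierarchy_mono N.2) B) : Hierarchy d) k : Op d k) =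
          ∑ p ∈ pairs k, ∑ r ∈ Finset.Icc 1 (min (p.1 : ℕ) p.2),
            contractionCoeff p.1 p.2 k r N.1 •
              symOp (contractionCommutator r k ((A : Hierarchy d) p.1 : Op d p.1)
                ((B : Hierarchy d) p.2 : Op d p.2))) ∧
      ∀ p ∈ pairs k, ∀ r : ℕ, 2 ≤ r → r ≤ min (p.1 : ℕ) p.2 →
        Tendsto (fun N : ℕ => contractionCoeff p.1 p.2 k r N •
          symOp (contractionCommutator r k ((A : Hierarchy d) p.1 : Op d p.1)
            ((B : Hierarchy d) p.2 : Op d p.2))) atTop (𝓝 0) := by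
  refine ⟨?_, ?_, ?_⟩
  · intro N _ l j k hl hj hk
    have hl' : (l : ℕ) ≤ N := PNat.coe_le_coe _ _ |>.2 hl
    have hl0 := l.pos
    have hj0 := j.pos
    have hkN : (k : ℕ) ≤ N := hk ▸ min_le_right _ _
    refine existsUnique_of_exists_of_unique ?_ fun D D' h h' =>
      Subtype.ext (embed_injective k.pos hkN (h.trans h'.symm))
    -- Without truncation the preimage is explicit; with truncation $k=N$, and the commutator is its
    -- own preimage.
    rcases le_or_gt ((l : ℕ) + j - 1) N with h | h
    · exact ⟨_, embed_bracketTerm l.pos (by omega) hkN _ _⟩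
    · obtain rfl : k = N := PNat.coe_injective (by omega)
      exact ⟨⟨_, commutator_mem ⟨_, embed_mem _⟩ ⟨_, embed_mem _⟩⟩, embed_self _⟩
  · obtain ⟨M, hM⟩ : ∃ M : ℕ+, (M : ℕ) = 2 * N₀ - 1 :=
      ⟨⟨2 * N₀ - 1, by have := N₀.pos; omega⟩, rfl⟩
    refine ⟨∑ k ∈ Finset.Icc 1 M, inclusion d k
      (∑ p ∈ pairs k, contractionObs 1 k ((A : Hierarchy d) p.1) ((B : Hierarchy d) p.2)),
      fun k => ?_, ?_⟩
    · have hcoe : ((∑ p ∈ pairs k, contractionObs 1 k ((A : Hierarchy d) p.1)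
          ((B : Hierarchy d) p.2) : observables d k) : Op d k) = ∑ p ∈ pairs k,
          symOp (contractionCommutator 1 k ((A : Hierarchy d) p.1 : Op d p.1)
            ((B : Hierarchy d) p.2 : Op d p.2)) := by
        rw [Submodule.coe_sum]
        refine Finset.sum_congr rfl fun p hp => ?_
        exact coe_contractionObs le_rfl p.1.pos p.2.pos (mem_pairs.1 hp) _ _
      rw [sum_inclusion_apply]
      split_ifs with h
      · exact hcoe
      · symm
        refine Finset.sum_eq_zero fun p hp => ?_
        rw [mem_pairs] at hp
        refine symOp_contractionCommutator_eq_zero _ _ (eq_zero_or_eq_zero A B ?_)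
        have h1 : (M : ℕ) < k := by
          by_contra h2
          exact h (Finset.mem_Icc.2 ⟨one_le, PNat.coe_le_coe _ _ |>.1 (not_lt.1 h2)⟩)
        omega
    · have hlim : Tendsto (fun N : ℕ => ∑ k ∈ Finset.Icc 1 M, inclusion d k
          (∑ p ∈ pairs k, bracketTerm N k ((A : Hierarchy d) p.1) ((B : Hierarchy d) p.2))) atTop
          (𝓝 (∑ k ∈ Finset.Icc 1 M, inclusion d k
            (∑ p ∈ pairs k, contractionObs 1 k ((A : Hierarchy d) p.1)
              ((B : Hierarchy d) p.2)))) := by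
        simp only [map_sum]
        refine tendsto_finsetSum _ fun k _ => tendsto_finsetSum _ fun p hp => ?_
        exact tendsto_bracketTerm (inclusion d k) p.1.pos p.2.pos (mem_pairs.1 hp) _ _
      refine (hlim.comp (tendsto_coe_Ici N₀)).congr' ?_
      filter_upwards [(tendsto_coe_Ici N₀).eventually_ge_atTop (M : ℕ)] with N hN
      exact (bracket_eq_sum A B N.2 hM (PNat.coe_le_coe _ _ |>.1 hN)).symm
  · intro k
    refine ⟨fun N hN => ?_, fun p hp r hr _ => ?_⟩
    · have hsum : ∀ p ∈ pairs k, (bracketTerm N.1 k ((A : Hierarchy d) p.1)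
          ((B : Hierarchy d) p.2) : Op d k) = ∑ r ∈ Finset.Icc 1 (min (p.1 : ℕ) p.2),
          contractionCoeff p.1 p.2 k r N.1 •
            symOp (contractionCommutator r k ((A : Hierarchy d) p.1 : Op d p.1)
              ((B : Hierarchy d) p.2 : Op d p.2)) := fun p hp =>
        coe_bracketTerm _ (mem_pairs.1 hp) _ _
      rw [← Finset.sum_congr rfl hsum]
      -- For $k>N$ the right side also vanishes: $\ell+j=k+1>2N_0$ forces $A^{(\ell)}=0$ or
      -- $B^{(j)}=0$.
      rcases le_or_gt k N.1 with hk | hk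
      · rw [bracket_apply_of_le hk, bracketComponent_eq A B N.2 hN hk, Submodule.coe_sum]
      · rw [(bracket N.1 _ _).2 k hk]
        symm
        refine Finset.sum_eq_zero fun p hp => ?_
        have hp' := mem_pairs.1 hp
        have hk' : ((N.1 : ℕ+) : ℕ) < k := PNat.coe_lt_coe _ _ |>.2 hk
        rw [bracketTerm_eq_zero _ hp' (eq_zero_or_eq_zero A B (by omega))]
        rfl
    · exact Op.tendsto_smul_zero (tendsto_contractionCoeff (mem_pairs.1 hp) hr) _
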